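/- **Setting.** Let $I\subset\mathbb R$ be an open interval, $J=[-\tfrac12,\tfrac12]$, and let $\mathbb R^n$ and $\mathbb R^{n\times n}$ carry the max-norm. A *dynamic function* on an open interval $\Omega$ assigns to each $t\in\Omega$ a function $w(t)(\cdot)$ on $J$ (its dynamic value; *ordinary* if constant). Write $w(\tau\pm)=c$ if $\sup_{s\in J}|w(t)(s)-c|\to0$ as $t\to\tau\pm$. The space $s\mathbb G(a,b)$ consists of the dynamic functions with limits $w(a+)$, $w(b-)$ and $w(t\pm)$ for all $t\in(a,b)$, such that each $w(t)(\cdot)$ is absolutely continuous with $w(t)(-\frac12)=w(t-)$ and $w(t)(\frac12)=w(t+)$. Let $\hat w$ be the ordinary part of $w$ (its values at the times, all but countably many, where $w$ is ordinary), regarded as a class of functions with the same one-sided limits, and $w_c$ its continuous part (all jumps removed, $w_c(a+)=w(a+)$). The space $s\mathbb{BV}(a,b)$ consists of the $w\in s\mathbb G(a,b)$ for which $\hat w$ has bounded variation and $\sum_t \mathrm{var}_J\,w(t)(\cdot)<\infty$, with norm $$\|w\|=|w(a+)|+\bigl(|w_c(a+)|+\mathrm{var}_{(a,b)}w_c\bigr)+\sum_t\mathrm{var}_J\,w(t)(\cdot);$$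 $w\in s\mathbb{BV}^{\rm loc}(\Omega)$ means $w\in s\mathbb{BV}(a,b)$ for all $[a,b]\subset\Omega$. Subscripts $n$ denote $\mathbb R^n$-valued versions. A *dynamic test function* on $\Omega$ is a real-valued dynamic function $\varphi$ with compact support in $\Omega$, with one-sided limits at every $t\in\Omega$, whose dynamic values are regulated on $J$. For $w\in s\mathbb{BV}^{\rm loc}(\Omega)$ the distribution $\dot w$ is $$(\dot w,\varphi)=\int\hat\varphi\,dw_c+\sum_\tau\int_J\varphi(\tau)(s)\,\frac{d}{ds}w(\tau)(s)\,ds ,$$ the product of a dynamic function $k$ and a distribution $v$ is $(kv,\varphi)=(v,k\varphi)$, and a function acts by $\int f\hat\varphi\,dt$. Let $D\subset I\times\mathbb R^n$ be open, $(t_0,x_0)\in D$. Let $f:D\to\mathbb R^n$ satisfy the Carathéodory conditions (measurable in $t$, continuous in $x$, dominated on every compact subset of $D$ by a summable function of $t$) and be Lipschitz in $x$ on $D$ with a constant $K_f$. Let $g(t,x)(\cdot)$, $(t,x)\in D$, be $\mathbb R^{n\times n}$-valued dynamic in $t$, with $g(\cdot,x)\in s\mathbb G(a,b)$ entrywise whenever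 $[a,b]\times\{x\}\subset D$, and Lipschitz in $x$ on $D$, uniformly in $s\in J$, with a constant $K_g$. Let $u\in s\mathbb{BV}_n^{\rm loc}(I)$. A *solution* on an open interval $\Omega\subset I$, $t_0\in\Omega$, of $$\dot x=f(t,x)+g(t,x)\,\dot u,\qquad x(t_0-)=x_0 \tag{1}$$ is an $x\in s\mathbb{BV}_n^{\rm loc}(\Omega)$ with $(t,x(t)(s))\in D$ for all $t\in\Omega$, $s\in J$, with $x(t_0-)=x_0$, which satisfies the equation as an equality of distributions (tested on all dynamic test functions on $\Omega$); here $f(t,x)$ is the function $t\mapsto f(t,\hat x(t))$ and $g(t,x)$ is the dynamic function $t\mapsto g(t,x(t)(s))(s)$. Assume that the limit system at $t_0$, $$\gamma'(s)=g(t_0,\gamma(s))(s)\,\tfrac{d}{ds}u(t_0)(s)\quad\text{for a.e. }s\in J,\qquad \gamma(-\tfrac12)=x_0,$$ has an absolutely continuous solution on $J$ with $(t_0,\gamma(s))\in D$ for all $s\in J$ (this is automatic if $u$ is continuous at $t_0$ or if $D=I\times\mathbb R^n$). **Theorem.** There is $h>0$ with $[t_0-h,t_0+h]\subset I$ such that 1.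 (1) has a solution $x\in s\mathbb{BV}_n(t_0-h,t_0+h)$ on $(t_0-h,t_0+h)$; 2. any solution of (1) on any open interval $\Omega\subset I$ containing $t_0$ coincides with $x$ on $\Omega\cap(t_0-h,t_0+h)$; 3. $x$ depends continuously on $u|_{(t_0-h,t_0+h)}$ in the norm of $s\mathbb{BV}_n(t_0-h,t_0+h)$: there is $r>0$ such that for every $v\in s\mathbb{BV}_n(t_0-h,t_0+h)$ with $\|v-u\|<r$ problem (1) with $v$ in place of $u$ has a solution in $s\mathbb{BV}_n(t_0-h,t_0+h)$ on $(t_0-h,t_0+h)$, and for every such $v$ and every $\varepsilon>0$ there is $\delta>0$ such that, if $v'\in s\mathbb{BV}_n(t_0-h,t_0+h)$, $\|v'-u\|<r$ and $\|v'-v\|<\delta$, then any solutions $y,y'\in s\mathbb{BV}_n(t_0-h,t_0+h)$ for $v,v'$ on $(t_0-h,t_0+h)$ satisfy $\|y'-y\|<\varepsilon$. -/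

import Mathlib

open MeasureTheory Set Filter Topology
open scoped ENNReal

noncomputable section

namespace DynSys

/-- The parameter interval `J = [-1/2, 1/2]` of dynamic values. -/
def J : Set ℝ := Icc (-1 / 2) (1 / 2)

/-- Dynamic functions with values in `E`: `w t s` is the dynamic value of `w` at the time `t`,
evaluated at the parameter `s ∈ J`. They are modelled by total functions; only the values at
times of the interval under consideration and at parameters in `J` matter. -/
abbrev DynFun (E : Type*) := ℝ → ℝ → E

section Spaces

variable {E : Type*} [NormedAddCommGroup E]

/-- `c = w(τ+)`, the right-sided limit of a dynamic function, uniform in the parameter. -/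
def HasRightLimit (w : DynFun E) (τ : ℝ) (c : E) : Prop :=
  ∀ ε > 0, ∃ η > 0, ∀ t ∈ Ioo τ (τ + η), ∀ s ∈ J, ‖w t s - c‖ ≤ ε

/-- `c = w(τ-)`, the left-sided limit of a dynamic function, uniform in the parameter. -/
def HasLeftLimit (w : DynFun E) (τ : ℝ) (c : E) : Prop :=
  ∀ ε > 0, ∃ η > 0, ∀ t ∈ Ioo (τ - η) τ, ∀ s ∈ J, ‖w t s - c‖ ≤ ε

/-- Regulated functions on the closed interval `J`. -/
def IsRegulatedOnJ (p : ℝ → E) : Prop :=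
  (∀ s ∈ Ico (-1 / 2 : ℝ) (1 / 2), ∃ c, Tendsto p (𝓝[>] s) (𝓝 c)) ∧
  (∀ s ∈ Ioc (-1 / 2 : ℝ) (1 / 2), ∃ c, Tendsto p (𝓝[<] s) (𝓝 c))

/-- The ordinary part of a dynamic function. At every time where `w` has an ordinary value, this
is that value. For a regulated dynamic function this is all but countably many times, and the
other values are immaterial in integrals with respect to atomless measures. For `w` in `s𝔾` one
has `w t (-1/2) = w(t-)`, so that `ord w` is the left-continuous representative of its class. -/
def ord (w : DynFun E) : ℝ → E := fun t => w t (-1 / 2)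

/-- The space `s𝔾(a, b)`: one-sided limits everywhere in `[a, b]`, absolutely continuous dynamic
values which join the left limit to the right limit. -/
def MemSG (a b : ℝ) (w : DynFun E) : Prop :=
  (∃ c, HasRightLimit w a c) ∧ (∃ c, HasLeftLimit w b c) ∧
  ∀ t ∈ Ioo a b, AbsolutelyContinuousOnInterval (w t) (-1 / 2) (1 / 2) ∧
    HasLeftLimit w t (w t (-1 / 2)) ∧ HasRightLimit w t (w t (1 / 2))

/-- The total variation on `J` of the dynamic value `w t`. -/
def varJ (w : DynFun E) (t : ℝ) : ℝ≥0∞ := eVariationOn (w t) J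

/-- The space `s𝔹𝕍(a, b)` of dynamic functions of bounded variation. The variation of the class
`ord w`, which ignores values at single points, is the ordinary variation of its left-continuous
representative. Ordinary (constant) dynamic values contribute `0` to the sum. -/
def MemSBV (a b : ℝ) (w : DynFun E) : Prop :=
  MemSG a b w ∧ BoundedVariationOn (ord w) (Ioo a b) ∧ ∑' t : Ioo a b, varJ w t ≠ ∞

/-- The space `s𝔹𝕍^loc(Ω)` for an open interval `Ω`. -/
def MemSBVLoc (Ω : Set ℝ) (w : DynFun E) : Prop :=
  ∀ a b, a < b → Icc a b ⊆ Ω → MemSBV a b w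

/-- The continuous part on `(a, b)` of `ord w`: all jumps are subtracted. -/
def contPart (a : ℝ) (w : DynFun E) : ℝ → E :=
  fun t => ord w t - ∑' τ : Ioo a t, (w τ (1 / 2) - w τ (-1 / 2))

/-- The norm of `s𝔹𝕍(a, b)`:
`|w(a+)| + ‖w_c‖ + ∑ var_J (w t)`, where `‖w_c‖ = |w_c(a+)| + var w_c`. -/
def sbvNorm (a b : ℝ) (w : DynFun E) : ℝ≥0∞ :=
  ‖Function.rightLim (ord w) a‖ₑ +
  (‖Function.rightLim (contPart a w) a‖ₑ + eVariationOn (contPart a w) (Ioo a b)) +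
  ∑' t : Ioo a b, varJ w t

end Spaces

/-- Dynamic test functions on the open interval `Ω`: regulated dynamic functions with compact
support in `Ω`. -/
def IsTestFunction (Ω : Set ℝ) (φ : DynFun ℝ) : Prop :=
  (∀ t ∈ Ω, IsRegulatedOnJ (φ t) ∧ (∃ c, HasLeftLimit φ t c) ∧ ∃ c, HasRightLimit φ t c) ∧
  ∃ K, IsCompact K ∧ K ⊆ Ω ∧ ∀ t ∈ Ω \ K, ∀ s ∈ J, φ t s = 0

open scoped Classical in
/-- The Lebesgue-Stieltjes integral of `φ` over the open interval `(a, b)` with respect to a real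
function `F` of bounded variation on `(a, b)`. -/
def stieltjesIntegral (a b : ℝ) (φ F : ℝ → ℝ) : ℝ :=
  if hF : BoundedVariationOn ((Ioo a b).indicator F) univ then
    (hF.vectorMeasure.restrict (Ioo a b)).integral φ (ContinuousLinearMap.lsmul ℝ ℝ)
  else 0

/-- The value on the test function `φ` of the distributional derivative of `w`:
`(ẇ, φ) = ∫ φ̂ dw_c + ∑_τ ∫_J φ(τ)(s) (w(τ)(s))'_s ds`, where `φ` is supported in `(a, b)` and `w`
is in `s𝔹𝕍(a, b)`. Times `τ` at which `w` is continuous contribute `0` to the sum. -/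
def derivPairing (a b : ℝ) (w φ : DynFun ℝ) : ℝ :=
  stieltjesIntegral a b (ord φ) (contPart a w) +
  ∑' τ : Ioo a b, ∫ s in (-1 / 2 : ℝ)..(1 / 2), φ τ s * deriv (w τ) s

section Equation

variable {n : ℕ}

/-- The Caratheodory conditions on `D`: measurable in `t`, continuous in `x`, and dominated on each
compact subset of `D` by a summable function of `t`. -/
def IsCaratheodory (D : Set (ℝ × (Fin n → ℝ))) (f : ℝ → (Fin n → ℝ) → (Fin n → ℝ)) : Prop :=
  (∀ x, AEMeasurable (fun t => f t x) (volume.restrict {t | (t, x) ∈ D})) ∧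
  (∀ᵐ t, ContinuousOn (f t) {x | (t, x) ∈ D}) ∧
  ∀ K ⊆ D, IsCompact K →
    ∃ m : ℝ → ℝ, Integrable m ∧ ∀ᵐ t, ∀ x, (t, x) ∈ K → ‖f t x‖ ≤ m t

/-- `g` belongs to `s𝔾` in `t`: for each `x` the matrix-valued dynamic function `t ↦ g(t, x)(·)` is
in `s𝔾(a, b)` whenever `[a, b] × {x} ⊆ D`. Here `g t x s i j` is the `(i, j)` entry. -/
def IsSGInTime (D : Set (ℝ × (Fin n → ℝ)))
    (g : ℝ → (Fin n → ℝ) → ℝ → (Fin n → Fin n → ℝ)) : Prop :=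
  ∀ x a b, a < b → (∀ t ∈ Icc a b, (t, x) ∈ D) → MemSG a b (fun t s => g t x s)

/-- `γ` solves in `D` the limit system at the time `τ` started at `y`:
`γ'(s) = g(τ, γ(s))(s) (u(τ)(s))'_s` for almost every `s ∈ J`, `γ(-1/2) = y`. -/
def IsLimitSolution (D : Set (ℝ × (Fin n → ℝ)))
    (g : ℝ → (Fin n → ℝ) → ℝ → (Fin n → Fin n → ℝ)) (u : DynFun (Fin n → ℝ))
    (τ : ℝ) (y : Fin n → ℝ) (γ : ℝ → (Fin n → ℝ)) : Prop :=
  AbsolutelyContinuousOnInterval γ (-1 / 2) (1 / 2) ∧ γ (-1 / 2) = y ∧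
  (∀ s ∈ J, (τ, γ s) ∈ D) ∧
  ∀ᵐ s ∂(volume.restrict J),
    HasDerivAt γ (fun i => ∑ j, g τ (γ s) s i j * deriv (fun r => u τ r j) s) s

/-- `x` is a solution on the open interval `Ω` of `ẋ = f(t, x) + g(t, x) u̇`, `x(t₀-) = x₀`.
The equation is one between distributions on `Ω` and is tested, componentwise, on every dynamic
test function `φ`, in a compact subinterval `[a, b]` of `Ω` whose interior contains the support.
The product of a dynamic function and a distribution is given by `(g v, φ) = (v, g φ)`. -/
def IsSolution (D : Set (ℝ × (Fin n → ℝ))) (f : ℝ → (Fin n → ℝ) → (Fin n → ℝ))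
    (g : ℝ → (Fin n → ℝ) → ℝ → (Fin n → Fin n → ℝ)) (u : DynFun (Fin n → ℝ))
    (t₀ : ℝ) (x₀ : Fin n → ℝ) (Ω : Set ℝ) (x : DynFun (Fin n → ℝ)) : Prop :=
  MemSBVLoc Ω x ∧ (∀ t ∈ Ω, ∀ s ∈ J, (t, x t s) ∈ D) ∧ HasLeftLimit x t₀ x₀ ∧
  ∀ a b, a < b → Icc a b ⊆ Ω → ∀ φ, IsTestFunction (Ioo a b) φ → ∀ i : Fin n,
    derivPairing a b (fun t s => x t s i) φ =
      (∫ t in Ioo a b, f t (ord x t) i * ord φ t) +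
      ∑ j, derivPairing a b (fun t s => u t s j) (fun t s => g t (x t s) s i j * φ t s)

end Equation

end DynSys

end

/-! Order the pairs (t, s), with t a time and s ∈ J, lexicographically (`dynTime`, `seg`). Along
this axis the jumps of a function w in s𝔹𝕍 are spread out over the fibres {τ} × J, and w becomes an
indefinite integral of an L¹ density θ (`HasDensity`) with respect to a `baseMeasure`: a finite
atomless measure ν on the points (t, -1/2), plus Lebesgue measure on the fibres over a countable set
C of times. Conversely, all such indefinite integrals lie in s𝔹𝕍 (`MemSBV.exists_hasDensity_pi`,
`HasDensity.memSBV`). The density can be chosen with L¹ norm at most n times the norm of w, and the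
norm of w is at most twice the supremum of the ordinary values plus twice the L¹ norm of the density
(`HasDensity.sbvNorm_le`). By the Radon-Nikodym theorem, several functions and Lebesgue time fit
under one base measure (`exists_common_density`).

In these terms the distributional derivative of w is integration against θ dμ
(`HasDensity.derivPairing_eq`). Indicators of segments are dynamic test functions, so the equation
is equivalent to the integral equation x(q) - x(p) = ∫ over [p, q) of F(r, x(r)) dμ(r), where F = ρ
f + g θ and ρ is the density of Lebesgue measure (`IsSolution.sub_eq`, `isSolution_of_hasDensity`).
F is Lipschitz in x with an integrable constant κ (`lipField`).

For small h the mass of κ off the time t₀ is small, but on the fibre over t₀ it need not be small,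
because u may jump there. An exponential weight W which grows only along that fibre absorbs this
mass: the integral of κ W from (t₀, -1/2) to q is at most W(q)/2 (`integral_mul_weight_le`). Hence
successive approximations contract by 1/2 (`exists_hasDensity_field`), and Gronwall's inequality
holds (`le_of_le_add_integral`).

The iteration starts from `limitPath`, which rests at x₀ before t₀, follows γ during t₀ and rests at
γ(1/2) afterwards. Its defect consists of the contribution of f, of the control off t₀ and of the
change of the control. All three are small for small h and for controls near u, so the iterates stay
in a compact tube inside D around γ, where g is bounded (`exists_solution`).

An arbitrary solution y need not stay in that tube, but the comparison with the constructed x uses a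
bound of g along x only. Equal controls give uniqueness. Different controls give first a uniform
estimate and then, on integrating the difference of the right-hand sides, an estimate of the norm
(`IsSolution.sbvNorm_sub_le`). All constants are fixed in `exists_local_frame`, for all controls
near u and before any common base measure is chosen; this makes δ independent of the second control.
-/

noncomputable section

set_option linter.unusedSectionVars false

namespace DynSys

/-! ### Dynamic time: lexicographic segments and base measures -/

/-- Dynamic time over the interval `(a, b)`. -/
def dynTime (a b : ℝ) : Set (ℝ × ℝ) := Ioo a b ×ˢ J

/-- The half-open segment `[p, q)` of dynamic time, in the lexicographic order. -/
def seg (p q : ℝ × ℝ) : Set (ℝ × ℝ) := {r | r.2 ∈ J ∧ toLex p ≤ toLex r ∧ toLex r < toLex q}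

/-- The measure on dynamic time which consists of an ordinary part `ν` and of Lebesgue measure on
the dynamic values at the times in `C`. -/
def baseMeasure (ν : Measure ℝ) (C : Set ℝ) : Measure (ℝ × ℝ) :=
  ν.map (fun t => (t, (-1 / 2 : ℝ))) +
    Measure.sum (fun τ : C => (volume.restrict J).map (fun s => ((τ : ℝ), s)))

theorem measurableSet_J : MeasurableSet J := measurableSet_Icc

theorem left_mem_J : (-1 / 2 : ℝ) ∈ J := by constructor <;> norm_num

theorem right_mem_J : (1 / 2 : ℝ) ∈ J := by constructor <;> norm_num

theorem measurableSet_dynTime (a b : ℝ) : MeasurableSet (dynTime a b) :=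
  measurableSet_Ioo.prod measurableSet_J

theorem mem_seg {p q r : ℝ × ℝ} :
    r ∈ seg p q ↔ r.2 ∈ J ∧ (p.1 < r.1 ∨ p.1 = r.1 ∧ p.2 ≤ r.2) ∧
      (r.1 < q.1 ∨ r.1 = q.1 ∧ r.2 < q.2) := by
  simp [seg, Prod.Lex.toLex_le_toLex, Prod.Lex.toLex_lt_toLex]

theorem measurableSet_before : MeasurableSet {z : (ℝ × ℝ) × (ℝ × ℝ) | toLex z.1 < toLex z.2} := by
  have : {z : (ℝ × ℝ) × (ℝ × ℝ) | toLex z.1 < toLex z.2} =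
      {z | z.1.1 < z.2.1} ∪ ({z | z.1.1 = z.2.1} ∩ {z | z.1.2 < z.2.2}) := by
    ext z; simp [Prod.Lex.toLex_lt_toLex]
  rw [this]
  exact (measurableSet_lt (by fun_prop) (by fun_prop)).union
    ((measurableSet_eq_fun (by fun_prop) (by fun_prop)).inter
      (measurableSet_lt (by fun_prop) (by fun_prop)))

theorem measurableSet_seg_pair :
    MeasurableSet {z : ((ℝ × ℝ) × (ℝ × ℝ)) × (ℝ × ℝ) | z.2 ∈ seg z.1.1 z.1.2} := by
  have : {z : ((ℝ × ℝ) × (ℝ × ℝ)) × (ℝ × ℝ) | z.2 ∈ seg z.1.1 z.1.2} =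
      (fun z : ((ℝ × ℝ) × (ℝ × ℝ)) × (ℝ × ℝ) => z.2.2) ⁻¹' J ∩
      (((fun z : ((ℝ × ℝ) × (ℝ × ℝ)) × (ℝ × ℝ) => (z.2, z.1.1)) ⁻¹'
        {z : (ℝ × ℝ) × (ℝ × ℝ) | toLex z.1 < toLex z.2})ᶜ ∩
      ((fun z : ((ℝ × ℝ) × (ℝ × ℝ)) × (ℝ × ℝ) => (z.2, z.1.2)) ⁻¹'
        {z : (ℝ × ℝ) × (ℝ × ℝ) | toLex z.1 < toLex z.2})) := by
    ext z; simp [seg]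
  rw [this]
  exact (measurableSet_preimage (by fun_prop) measurableSet_J).inter
    ((measurableSet_preimage (by fun_prop) measurableSet_before).compl.inter
    (measurableSet_preimage (by fun_prop) measurableSet_before))

theorem measurableSet_seg (p q : ℝ × ℝ) : MeasurableSet (seg p q) :=
  measurableSet_preimage (f := fun r : ℝ × ℝ => ((p, q), r)) (by fun_prop) measurableSet_seg_pair

theorem seg_union {p q r : ℝ × ℝ} (h : toLex p ≤ toLex q) (h' : toLex q ≤ toLex r) :
    seg p r = seg p q ∪ seg q r := by
  ext z
  simp only [seg, mem_ofPred_eq, mem_union]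
  constructor
  · rintro ⟨h1, h2, h3⟩
    rcases lt_or_ge (toLex z) (toLex q) with h4 | h4
    · exact Or.inl ⟨h1, h2, h4⟩
    · exact Or.inr ⟨h1, h4, h3⟩
  · rintro (⟨h1, h2, h3⟩ | ⟨h1, h2, h3⟩)
    · exact ⟨h1, h2, h3.trans_le h'⟩
    · exact ⟨h1, h.trans h2, h3⟩

theorem seg_disjoint (p q r : ℝ × ℝ) : Disjoint (seg p q) (seg q r) := by
  rw [Set.disjoint_left]
  rintro z ⟨_, _, h⟩ ⟨_, h', _⟩
  exact absurd h h'.not_gt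

theorem seg_eq_empty {p q : ℝ × ℝ} (h : toLex q ≤ toLex p) : seg p q = ∅ := by
  ext z
  simp only [seg, mem_ofPred_eq, mem_empty_iff_false, iff_false, not_and, not_lt]
  exact fun _ h1 => h.trans h1

theorem seg_subset_dynTime {a b : ℝ} {p q : ℝ × ℝ} (hp : p ∈ dynTime a b) (hq : q ∈ dynTime a b) :
    seg p q ⊆ dynTime a b := by
  intro r hr
  rw [mem_seg] at hr
  obtain ⟨h1, h2, h3⟩ := hr
  refine ⟨⟨?_, ?_⟩, h1⟩
  · have := hp.1.1
    rcases h2 with h2 | h2 <;> linarith [h2]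
  · have := hq.1.2
    rcases h3 with h3 | h3 <;> linarith [h3]

/-- Embeddings, unlike mere measurable maps, let integrals over the image be pulled back for
arbitrary integrands. Densities here are only almost everywhere measurable. -/
theorem measurableEmbedding_left : MeasurableEmbedding (fun t : ℝ => (t, (-1 / 2 : ℝ))) :=
  measurableEmbedding_prod_mk_right _

theorem measurableEmbedding_right (τ : ℝ) : MeasurableEmbedding (fun s : ℝ => (τ, s)) :=
  measurableEmbedding_prodMk_left _

section Base

variable {ν : Measure ℝ} {C : Set ℝ}

theorem lintegral_baseMeasure (F : ℝ × ℝ → ℝ≥0∞) :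
    ∫⁻ p, F p ∂(baseMeasure ν C) =
      ∫⁻ t, F (t, -1 / 2) ∂ν + ∑' τ : C, ∫⁻ s in J, F (τ, s) := by
  rw [baseMeasure, lintegral_add_measure, lintegral_sum_measure,
    measurableEmbedding_left.lintegral_map]
  simp_rw [(measurableEmbedding_right _).lintegral_map]

theorem baseMeasure_apply {S : Set (ℝ × ℝ)} (hS : MeasurableSet S) :
    baseMeasure ν C S = ν {t | (t, -1 / 2) ∈ S} + ∑' τ : C, volume {s | s ∈ J ∧ ((τ : ℝ), s) ∈ S} := by
  rw [baseMeasure, Measure.add_apply, Measure.sum_apply _ hS,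
    measurableEmbedding_left.map_apply]
  simp_rw [(measurableEmbedding_right _).map_apply]
  congr 1
  refine tsum_congr fun τ => ?_
  rw [Measure.restrict_apply' measurableSet_J, inter_comm]
  rfl

theorem aestronglyMeasurable_baseMeasure [Countable C] {E : Type*} [TopologicalSpace E]
    [TopologicalSpace.PseudoMetrizableSpace E] {F : ℝ × ℝ → E} :
    AEStronglyMeasurable F (baseMeasure ν C) ↔ AEStronglyMeasurable (fun t => F (t, -1 / 2)) ν ∧
      ∀ τ ∈ C, AEStronglyMeasurable (fun s => F (τ, s)) (volume.restrict J) := by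
  rw [baseMeasure, aestronglyMeasurable_add_measure_iff, aestronglyMeasurable_sum_measure_iff,
    measurableEmbedding_left.aestronglyMeasurable_map_iff]
  simp_rw [(measurableEmbedding_right _).aestronglyMeasurable_map_iff]
  exact and_congr Iff.rfl ⟨fun h τ hτ => h ⟨τ, hτ⟩, fun h τ => h τ τ.2⟩

theorem Integrable.baseMeasure_left {E : Type*} [NormedAddCommGroup E] {F : ℝ × ℝ → E}
    (hF : Integrable F (baseMeasure ν C)) : Integrable (fun t => F (t, -1 / 2)) ν :=
  (measurableEmbedding_left.integrable_map_iff).1 (hF.mono_measure (Measure.le_add_right le_rfl))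

theorem Integrable.baseMeasure_right {E : Type*} [NormedAddCommGroup E] {F : ℝ × ℝ → E}
    (hF : Integrable F (baseMeasure ν C)) {τ : ℝ} (hτ : τ ∈ C) :
    IntegrableOn (fun s => F (τ, s)) J :=
  ((measurableEmbedding_right τ).integrable_map_iff).1
    (hF.mono_measure (le_trans (Measure.le_sum (fun τ : C => (volume.restrict J).map
      (fun s => ((τ : ℝ), s))) ⟨τ, hτ⟩) (Measure.le_add_left le_rfl)))

theorem hasSum_baseMeasure {E : Type*} [NormedAddCommGroup E] [NormedSpace ℝ E]
    {F : ℝ × ℝ → E} (hF : Integrable F (baseMeasure ν C)) :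
    HasSum (fun τ : C => ∫ s in J, F (τ, s))
      (∫ p, F p ∂(baseMeasure ν C) - ∫ t, F (t, -1 / 2) ∂ν) := by
  have h1 := hF.mono_measure ((Measure.le_add_right le_rfl) :
    ν.map (fun t => (t, (-1 / 2 : ℝ))) ≤ baseMeasure ν C)
  have h2 := hF.mono_measure ((Measure.le_add_left le_rfl) :
    Measure.sum (fun τ : C => (volume.restrict J).map (fun s => ((τ : ℝ), s))) ≤ baseMeasure ν C)
  have := hasSum_integral_measure h2
  simp_rw [(measurableEmbedding_right _).integral_map] at this
  rw [baseMeasure, integral_add_measure h1 h2, measurableEmbedding_left.integral_map,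
    add_sub_cancel_left]
  exact this

/-- The ordinary part does not charge a time, and a fibre carries Lebesgue measure. Consequently the
end points of segments do not matter for integrals. -/
theorem baseMeasure_singleton [NullSingletonClass ν] (p : ℝ × ℝ) : baseMeasure ν C {p} = 0 := by
  rw [baseMeasure_apply (measurableSet_singleton p)]
  have h1 : ν {t | (t, -1 / 2) ∈ ({p} : Set (ℝ × ℝ))} = 0 := by
    refine Set.Subsingleton.measure_zero (fun x hx y hy => ?_) ν
    simp only [mem_singleton_iff, mem_ofPred_eq] at hx hy
    exact congrArg Prod.fst (hx.trans hy.symm)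
  have h2 (τ : C) : volume {s | s ∈ J ∧ ((τ : ℝ), s) ∈ ({p} : Set (ℝ × ℝ))} = 0 := by
    refine Set.Subsingleton.measure_zero (fun x hx y hy => ?_) volume
    simp only [mem_singleton_iff, mem_ofPred_eq] at hx hy
    exact congrArg Prod.snd (hx.2.trans hy.2.symm)
  simp only [h1, h2, tsum_zero, add_zero]

/-- A base measure is absolutely continuous, with a finite density, with respect to any base
measure with a larger ordinary part and more jump times. -/
theorem exists_baseMeasure_eq_withDensity {ν' : Measure ℝ} {C' : Set ℝ} [IsFiniteMeasure ν]
    [IsFiniteMeasure ν'] [NullSingletonClass ν'] (hν : ν ≪ ν') (hC : C ⊆ C') (hC' : C'.Countable) :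
    ∃ ρ : ℝ × ℝ → NNReal, Measurable ρ ∧
      baseMeasure ν C = (baseMeasure ν' C').withDensity (fun p => ρ p) := by
  classical
  have hCm : MeasurableSet C := (hC'.mono hC).measurableSet
  -- On the line s = -1/2 the density is that of ν with respect to ν', elsewhere it is the indicator
  -- of C. The two rules do not interfere: each fibre meets the line in a Lebesgue null set, and the
  -- ordinary part lives on the line.
  refine ⟨fun p => if p.2 = -1 / 2 then (ν.rnDeriv ν' p.1).toNNReal else if p.1 ∈ C then 1 else 0,
    ?_, ?_⟩
  · refine Measurable.ite (measurableSet_eq_fun measurable_snd measurable_const) ?_ ?_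
    · exact (ENNReal.measurable_toNNReal.comp (Measure.measurable_rnDeriv ν ν')).comp measurable_fst
    · exact Measurable.ite (measurable_fst hCm) measurable_const measurable_const
  ext S hS
  rw [withDensity_apply _ hS, ← lintegral_indicator hS, lintegral_baseMeasure, baseMeasure_apply hS]
  congr 1
  · have hS' : MeasurableSet {t : ℝ | (t, (-1 / 2 : ℝ)) ∈ S} :=
      measurableEmbedding_left.measurable hS
    calc ν {t | (t, -1 / 2) ∈ S} = ν'.withDensity (ν.rnDeriv ν') {t | (t, -1 / 2) ∈ S} := by
          rw [Measure.withDensity_rnDeriv_eq ν ν' hν]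
      _ = ∫⁻ t in {t : ℝ | (t, (-1 / 2 : ℝ)) ∈ S}, ν.rnDeriv ν' t ∂ν' := withDensity_apply _ hS'
      _ = ∫⁻ t, {t : ℝ | (t, (-1 / 2 : ℝ)) ∈ S}.indicator (ν.rnDeriv ν') t ∂ν' :=
          (lintegral_indicator hS' _).symm
      _ = _ := by
          refine lintegral_congr_ae ?_
          filter_upwards [Measure.rnDeriv_lt_top ν ν'] with t ht
          by_cases h : (t, (-1 / 2 : ℝ)) ∈ S
          · rw [indicator_of_mem (by exact h), indicator_of_mem h]
            simp [ENNReal.coe_toNNReal ht.ne]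
          · rw [indicator_of_notMem (by exact h), indicator_of_notMem h]
  · have h1 (τ : ℝ) : ∫⁻ s in J, S.indicator (fun p : ℝ × ℝ => ((if p.2 = -1 / 2 then
        (ν.rnDeriv ν' p.1).toNNReal else if p.1 ∈ C then 1 else 0 : NNReal) : ℝ≥0∞)) (τ, s) =
        C.indicator (fun τ => volume {s | s ∈ J ∧ ((τ : ℝ), s) ∈ S}) τ := by
      have hSτ : MeasurableSet {s : ℝ | s ∈ J ∧ (τ, s) ∈ S} :=
        measurableSet_J.inter ((measurableEmbedding_right τ).measurable hS)
      by_cases hτ : τ ∈ C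
      · rw [indicator_of_mem hτ, ← lintegral_indicator measurableSet_J,
          ← setLIntegral_one, ← lintegral_indicator hSτ]
        refine lintegral_congr_ae ?_
        filter_upwards [Measure.ae_ne volume (-1 / 2 : ℝ)] with s hs
        by_cases h1 : s ∈ J <;> by_cases h2 : (τ, s) ∈ S <;> simp [h1, h2, hs, hτ, indicator]
      · rw [indicator_of_notMem hτ]
        refine (lintegral_congr_ae ?_).trans lintegral_zero
        refine ae_restrict_of_ae ?_
        filter_upwards [Measure.ae_ne volume (-1 / 2 : ℝ)] with s hs
        by_cases h2 : (τ, s) ∈ S <;> simp [h2, hτ, indicator]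
        intro h; exact absurd (by linarith) hs
    simp_rw [h1]
    rw [tsum_subtype C (fun τ => volume {s | s ∈ J ∧ ((τ : ℝ), s) ∈ S}), tsum_subtype C' (C.indicator _),
      indicator_indicator, inter_eq_right.2 hC]

end Base

section SetIntegrals

variable {ν : Measure ℝ} {C : Set ℝ} {E : Type*} [NormedAddCommGroup E]

theorem measurableSet_slice_left {S : Set (ℝ × ℝ)} (hS : MeasurableSet S) :
    MeasurableSet {t : ℝ | (t, (-1 / 2 : ℝ)) ∈ S} :=
  measurableEmbedding_left.measurable hS

theorem measurableSet_slice_right {S : Set (ℝ × ℝ)} (hS : MeasurableSet S) (τ : ℝ) :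
    MeasurableSet {s : ℝ | s ∈ J ∧ (τ, s) ∈ S} :=
  measurableSet_J.inter ((measurableEmbedding_right τ).measurable hS)

theorem setLIntegral_baseMeasure {S : Set (ℝ × ℝ)} (hS : MeasurableSet S) (F : ℝ × ℝ → ℝ≥0∞) :
    ∫⁻ p in S, F p ∂(baseMeasure ν C) =
      ∫⁻ t in {t | (t, -1 / 2) ∈ S}, F (t, -1 / 2) ∂ν +
        ∑' τ : C, ∫⁻ s in {s | s ∈ J ∧ ((τ : ℝ), s) ∈ S}, F (τ, s) := by
  rw [← lintegral_indicator hS, lintegral_baseMeasure,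
    ← lintegral_indicator (measurableSet_slice_left hS)]
  congr 1
  refine tsum_congr fun τ => ?_
  rw [← lintegral_indicator measurableSet_J, ← lintegral_indicator (measurableSet_slice_right hS _)]
  refine lintegral_congr fun s => ?_
  by_cases h1 : s ∈ J <;> by_cases h2 : ((τ : ℝ), s) ∈ S <;> simp [h1, h2, indicator]

theorem IntegrableOn.baseMeasure_left {F : ℝ × ℝ → E} {S : Set (ℝ × ℝ)} (hS : MeasurableSet S)
    (hF : IntegrableOn F S (baseMeasure ν C)) :
    IntegrableOn (fun t => F (t, -1 / 2)) {t | (t, -1 / 2) ∈ S} ν := by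
  rw [← integrable_indicator_iff hS] at hF
  have := Integrable.baseMeasure_left hF
  rw [← integrable_indicator_iff (measurableSet_slice_left hS)]
  exact this

theorem IntegrableOn.baseMeasure_right {F : ℝ × ℝ → E} {S : Set (ℝ × ℝ)} (hS : MeasurableSet S)
    (hF : IntegrableOn F S (baseMeasure ν C)) {τ : ℝ} (hτ : τ ∈ C) :
    IntegrableOn (fun s => F (τ, s)) {s | s ∈ J ∧ (τ, s) ∈ S} := by
  rw [← integrable_indicator_iff hS] at hF
  have := Integrable.baseMeasure_right hF hτ
  rw [← integrable_indicator_iff measurableSet_J] at this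
  rw [← integrable_indicator_iff (measurableSet_slice_right hS _)]
  refine this.congr (Eventually.of_forall fun s => ?_)
  by_cases h1 : s ∈ J <;> by_cases h2 : ((τ : ℝ), s) ∈ S <;> simp [h1, h2, indicator]

theorem hasSum_setIntegral_baseMeasure [NormedSpace ℝ E] {F : ℝ × ℝ → E} {S : Set (ℝ × ℝ)}
    (hS : MeasurableSet S) (hF : IntegrableOn F S (baseMeasure ν C)) :
    HasSum (fun τ : C => ∫ s in {s | s ∈ J ∧ ((τ : ℝ), s) ∈ S}, F (τ, s))
      (∫ p in S, F p ∂(baseMeasure ν C) - ∫ t in {t | (t, -1 / 2) ∈ S}, F (t, -1 / 2) ∂ν) := by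
  rw [← integrable_indicator_iff hS] at hF
  have := hasSum_baseMeasure hF
  rw [integral_indicator hS] at this
  rw [← integral_indicator (measurableSet_slice_left hS)]
  convert this using 2 with τ
  · rw [← integral_indicator measurableSet_J, ← integral_indicator (measurableSet_slice_right hS _)]
    refine integral_congr_ae (Eventually.of_forall fun s => ?_)
    by_cases h1 : s ∈ J <;> by_cases h2 : ((τ : ℝ), s) ∈ S <;> simp [h1, h2, indicator]
  · rfl

end SetIntegrals

/-- A sum of an increment estimate over a partition. -/
theorem eVariationOn_le_measure_univ {E : Type*} [PseudoEMetricSpace E] (Λ : Measure ℝ) {F : ℝ → E}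
    {s : Set ℝ} (h : ∀ x ∈ s, ∀ y ∈ s, x ≤ y → edist (F y) (F x) ≤ Λ (Ico x y)) :
    eVariationOn F s ≤ Λ univ := by
  refine iSup_le fun p => ?_
  obtain ⟨n, u, hu, hus⟩ := p
  have (n : ℕ) : ∑ i ∈ Finset.range n, edist (F (u (i + 1))) (F (u i)) ≤ Λ (Ico (u 0) (u n)) := by
    induction n with
    | zero => simp
    | succ n ih =>
      rw [Finset.sum_range_succ, ← Ico_union_Ico_eq_Ico (hu (Nat.zero_le n)) (hu (Nat.le_succ n)),
        measure_union (Ico_disjoint_Ico_same) measurableSet_Ico]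
      exact add_le_add ih (h _ (hus _) _ (hus _) (hu (Nat.le_succ n)))
  exact (this n).trans (measure_mono (subset_univ _))

/-- The shrinking intervals omit τ, so their intersection is empty even if Λ has an atom at τ. This
is why one-sided limits exist although a single time may carry a large mass. -/
theorem tendsto_measure_Ioo_right (Λ : Measure ℝ) [IsFiniteMeasure Λ] (τ : ℝ) :
    Tendsto (fun η => Λ (Ioo τ (τ + η))) (𝓝[>] 0) (𝓝 0) := by
  have := tendsto_measure_biInter_gt (μ := Λ) (s := fun η => Ioo τ (τ + η)) (a := 0)
    (fun r _ => measurableSet_Ioo.nullMeasurableSet)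
    (fun i j _ hij => Ioo_subset_Ioo_right (by linarith)) ⟨1, one_pos, measure_ne_top _ _⟩
  have h0 : ⋂ r > (0 : ℝ), Ioo τ (τ + r) = ∅ := by
    ext x
    simp only [mem_iInter, mem_Ioo, mem_empty_iff_false, iff_false, not_forall]
    by_contra! h
    have h1 := (h 1 one_pos).1
    have := (h (x - τ) (by linarith)).2
    linarith
  rw [h0, measure_empty] at this
  exact this

theorem tendsto_measure_Ioo_left (Λ : Measure ℝ) [IsFiniteMeasure Λ] (τ : ℝ) :
    Tendsto (fun η => Λ (Ioo (τ - η) τ)) (𝓝[>] 0) (𝓝 0) := by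
  have := tendsto_measure_biInter_gt (μ := Λ) (s := fun η => Ioo (τ - η) τ) (a := 0)
    (fun r _ => measurableSet_Ioo.nullMeasurableSet)
    (fun i j _ hij => Ioo_subset_Ioo_left (by linarith)) ⟨1, one_pos, measure_ne_top _ _⟩
  have h0 : ⋂ r > (0 : ℝ), Ioo (τ - r) τ = ∅ := by
    ext x
    simp only [mem_iInter, mem_Ioo, mem_empty_iff_false, iff_false, not_forall]
    by_contra! h
    have h1 := (h 1 one_pos).2
    have := (h (τ - x) (by linarith)).1
    linarith
  rw [h0, measure_empty] at this
  exact this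

/-! ### Indefinite integrals over dynamic time -/

/-- `w` is an indefinite integral over dynamic time, with density `θ` with respect to `μ`. -/
structure HasDensity {E : Type*} [NormedAddCommGroup E] [NormedSpace ℝ E] (a b : ℝ)
    (μ : Measure (ℝ × ℝ)) (θ : ℝ × ℝ → E) (w : DynFun E) : Prop where
  integrableOn : IntegrableOn θ (dynTime a b) μ
  sub_eq : ∀ p ∈ dynTime a b, ∀ q ∈ dynTime a b, toLex p ≤ toLex q →
    w q.1 q.2 - w p.1 p.2 = ∫ r in seg p q, θ r ∂μ

namespace HasDensity

variable {E : Type*} [NormedAddCommGroup E] [NormedSpace ℝ E] {a b : ℝ} {μ : Measure (ℝ × ℝ)}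
  {θ θ' : ℝ × ℝ → E} {w w' : DynFun E}

theorem integrableOn_seg (h : HasDensity a b μ θ w) {p q : ℝ × ℝ} (hp : p ∈ dynTime a b)
    (hq : q ∈ dynTime a b) : IntegrableOn θ (seg p q) μ :=
  h.integrableOn.mono_set (seg_subset_dynTime hp hq)

theorem mono (h : HasDensity a b μ θ w) {a' b' : ℝ} (ha : a ≤ a') (hb : b' ≤ b) :
    HasDensity a' b' μ θ w := by
  have hsub : dynTime a' b' ⊆ dynTime a b := prod_mono (Ioo_subset_Ioo ha hb) subset_rfl
  exact ⟨h.integrableOn.mono_set hsub, fun p hp q hq => h.sub_eq p (hsub hp) q (hsub hq)⟩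

theorem add (h : HasDensity a b μ θ w) (h' : HasDensity a b μ θ' w') :
    HasDensity a b μ (fun p => θ p + θ' p) (w + w') := by
  refine ⟨h.integrableOn.add h'.integrableOn, fun p hp q hq hpq => ?_⟩
  rw [integral_add (h.integrableOn_seg hp hq) (h'.integrableOn_seg hp hq), ← h.sub_eq p hp q hq hpq,
    ← h'.sub_eq p hp q hq hpq]
  simp only [Pi.add_apply]
  abel

theorem sub (h : HasDensity a b μ θ w) (h' : HasDensity a b μ θ' w') :
    HasDensity a b μ (fun p => θ p - θ' p) (w - w') := by
  refine ⟨h.integrableOn.sub h'.integrableOn, fun p hp q hq hpq => ?_⟩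
  rw [integral_sub (h.integrableOn_seg hp hq) (h'.integrableOn_seg hp hq), ← h.sub_eq p hp q hq hpq,
    ← h'.sub_eq p hp q hq hpq]
  simp only [Pi.sub_apply]
  abel

theorem apply {n : ℕ} {θ : ℝ × ℝ → (Fin n → ℝ)} {w : DynFun (Fin n → ℝ)}
    (h : HasDensity a b μ θ w) (i : Fin n) :
    HasDensity a b μ (fun p => θ p i) (fun t s => w t s i) := by
  refine ⟨h.integrableOn.eval i, fun p hp q hq hpq => ?_⟩
  have := congrFun (h.sub_eq p hp q hq hpq) i
  rw [eval_integral (fun i => (h.integrableOn_seg hp hq).eval i)] at this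
  exact this

theorem pi {n : ℕ} {θ : ℝ × ℝ → (Fin n → ℝ)} {w : DynFun (Fin n → ℝ)}
    (h : ∀ i, HasDensity a b μ (fun p => θ p i) (fun t s => w t s i)) :
    HasDensity a b μ θ w := by
  refine ⟨Integrable.of_eval fun i => (h i).integrableOn, fun p hp q hq hpq => ?_⟩
  ext i
  rw [eval_integral (fun i => (h i).integrableOn_seg hp hq)]
  exact (h i).sub_eq p hp q hq hpq

theorem of_withDensity {ρ : ℝ × ℝ → NNReal} (hρ : Measurable ρ)
    (h : HasDensity a b (μ.withDensity fun p => ρ p) θ w) :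
    HasDensity a b μ (fun p => ρ p • θ p) w := by
  refine ⟨?_, fun p hp q hq hpq => ?_⟩
  · have := h.integrableOn
    rw [IntegrableOn, restrict_withDensity (measurableSet_dynTime a b),
      integrable_withDensity_iff_integrable_smul hρ] at this
    exact this
  · rw [h.sub_eq p hp q hq hpq, restrict_withDensity (measurableSet_seg p q),
      integral_withDensity_eq_integral_smul hρ]

/-- The distribution over time of the mass of a density. -/
def mass (a b : ℝ) (μ : Measure (ℝ × ℝ)) (θ : ℝ × ℝ → E) : Measure ℝ :=
  ((μ.restrict (dynTime a b)).withDensity fun p => ‖θ p‖ₑ).map Prod.fst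

theorem mass_apply {S : Set ℝ} (hS : MeasurableSet S) :
    mass a b μ θ S = ∫⁻ p in Prod.fst ⁻¹' S ∩ dynTime a b, ‖θ p‖ₑ ∂μ := by
  rw [mass, Measure.map_apply measurable_fst hS, withDensity_apply _ (measurable_fst hS),
    Measure.restrict_restrict (measurable_fst hS)]

theorem isFiniteMeasure_mass (h : IntegrableOn θ (dynTime a b) μ) :
    IsFiniteMeasure (mass a b μ θ) := by
  have : IsFiniteMeasure ((μ.restrict (dynTime a b)).withDensity fun p => ‖θ p‖ₑ) :=
    isFiniteMeasure_withDensity h.2.ne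
  unfold mass
  infer_instance

theorem enorm_sub_le (h : HasDensity a b μ θ w) {p q : ℝ × ℝ} (hp : p ∈ dynTime a b)
    (hq : q ∈ dynTime a b) (hpq : toLex p ≤ toLex q) :
    ‖w q.1 q.2 - w p.1 p.2‖ₑ ≤ ∫⁻ r in seg p q, ‖θ r‖ₑ ∂μ := by
  rw [h.sub_eq p hp q hq hpq]
  exact enorm_integral_le_lintegral_enorm _

/-- The segment ends before (t, -1/2), the first point of the time t, so nothing of the fibre over t
is met. This gives the left limit at t. -/
theorem enorm_sub_le_Ico (h : HasDensity a b μ θ w) {p : ℝ × ℝ} (hp : p ∈ dynTime a b) {t : ℝ}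
    (ht : t ∈ Ioo a b) (hpt : p.1 < t) :
    ‖ord w t - w p.1 p.2‖ₑ ≤ mass a b μ θ (Ico p.1 t) := by
  have hq : (t, (-1 / 2 : ℝ)) ∈ dynTime a b := ⟨ht, left_mem_J⟩
  refine (h.enorm_sub_le hp hq (Prod.Lex.toLex_le_toLex.2 (Or.inl hpt))).trans ?_
  rw [mass_apply measurableSet_Ico]
  refine lintegral_mono_set fun r hr => ⟨?_, seg_subset_dynTime hp hq hr⟩
  rw [mem_seg] at hr
  obtain ⟨h1, h2, h3⟩ := hr
  refine ⟨by rcases h2 with h2 | h2 <;> linarith [h2], ?_⟩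
  rcases h3 with h3 | h3
  · exact h3
  · have := h1.1
    have h4 : r.2 < -1 / 2 := h3.2
    linarith

theorem enorm_sub_le_Icc (h : HasDensity a b μ θ w) {p q : ℝ × ℝ} (hp : p ∈ dynTime a b)
    (hq : q ∈ dynTime a b) (hpq : toLex p ≤ toLex q) :
    ‖w q.1 q.2 - w p.1 p.2‖ₑ ≤ mass a b μ θ (Icc p.1 q.1) := by
  refine (h.enorm_sub_le hp hq hpq).trans ?_
  rw [mass_apply measurableSet_Icc]
  refine lintegral_mono_set fun r hr => ⟨?_, seg_subset_dynTime hp hq hr⟩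
  rw [mem_seg] at hr
  obtain ⟨h1, h2, h3⟩ := hr
  exact ⟨by rcases h2 with h2 | h2 <;> linarith [h2], by rcases h3 with h3 | h3 <;> linarith [h3]⟩

/-- The segment starts at the last point of the time t, so it meets the fibre over t in one point,
which is null. This gives the right limit at t. -/
theorem enorm_sub_le_Ioc (h : HasDensity a b μ θ w) (hμ : ∀ p, μ {p} = 0) {q : ℝ × ℝ} {t : ℝ}
    (ht : t ∈ Ioo a b) (hq : q ∈ dynTime a b) (hqt : t < q.1) :
    ‖w q.1 q.2 - w t (1 / 2)‖ₑ ≤ mass a b μ θ (Ioc t q.1) := by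
  have hp : (t, (1 / 2 : ℝ)) ∈ dynTime a b := ⟨ht, right_mem_J⟩
  refine (h.enorm_sub_le hp hq (Prod.Lex.toLex_le_toLex.2 (Or.inl hqt))).trans ?_
  rw [mass_apply measurableSet_Ioc]
  have hsub : seg (t, 1 / 2) q ⊆ {(t, 1 / 2)} ∪ (Prod.fst ⁻¹' Ioc t q.1 ∩ dynTime a b) := by
    intro r hr
    have hr' := seg_subset_dynTime hp hq hr
    rw [mem_seg] at hr
    obtain ⟨h1, h2, h3⟩ := hr
    rcases h2 with h2 | h2
    · exact Or.inr ⟨⟨h2, by rcases h3 with h3 | h3 <;> linarith [h3]⟩, hr'⟩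
    · left
      have h4 : r.2 ≤ 1 / 2 := h1.2
      have h5 : 1 / 2 ≤ r.2 := h2.2
      exact Prod.ext h2.1.symm (le_antisymm h4 h5)
  refine (lintegral_mono_set hsub).trans ((lintegral_union_le _ _ _).trans ?_)
  rw [setLIntegral_measure_zero _ _ (hμ _), zero_add]

end HasDensity

section Segments

variable {E : Type*} [NormedAddCommGroup E] [NormedSpace ℝ E]
  {ν : Measure ℝ} [NullSingletonClass ν] {C : Set ℝ} {θ : ℝ × ℝ → E}

-- Inside one time the ordinary part sees a single point, which is null. What remains is Lebesgue
-- measure on the fibre, if the time belongs to C.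
open scoped Classical in
theorem setIntegral_seg_right {τ s s' : ℝ} (hs : s ∈ J) (hs' : s' ∈ J)
    (hθ : IntegrableOn θ (seg (τ, s) (τ, s')) (baseMeasure ν C)) :
    ∫ p in seg (τ, s) (τ, s'), θ p ∂(baseMeasure ν C) =
      if τ ∈ C then ∫ r in Ico s s', θ (τ, r) else 0 := by
  have h1 := hasSum_setIntegral_baseMeasure (measurableSet_seg (τ, s) (τ, s')) hθ
  have h2 : ∫ t in {t | (t, -1 / 2) ∈ seg (τ, s) (τ, s')}, θ (t, -1 / 2) ∂ν = 0 := by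
    refine setIntegral_measure_zero _ (measure_mono_null (t := {τ}) ?_ (measure_singleton τ))
    intro t ht
    have ht' := mem_seg.1 ht
    obtain ⟨-, h2, h3⟩ := ht'
    simp only at h2 h3
    exact le_antisymm (by rcases h3 with h3 | h3 <;> linarith [h3])
      (by rcases h2 with h2 | h2 <;> linarith [h2])
  rw [h2, sub_zero] at h1
  rw [← h1.tsum_eq]
  have h3 (τ' : ℝ) : {r | r ∈ J ∧ (τ', r) ∈ seg (τ, s) (τ, s')} =
      if τ' = τ then Ico s s' else ∅ := by
    ext r
    rw [mem_ofPred_eq, mem_seg]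
    by_cases hr : τ' = τ
    · subst hr
      simp only [lt_self_iff_false, true_and, false_or, if_true, mem_Ico]
      refine ⟨fun hr => hr.2.2, fun hr => ⟨?_, ?_, hr⟩⟩
      all_goals exact ⟨hs.1.trans hr.1, hr.2.le.trans hs'.2⟩
    · simp only [hr, false_and, or_false, if_false, mem_empty_iff_false, iff_false]
      rintro ⟨-, -, h1, h2⟩
      rcases h1 with h1 | h1
      · exact absurd h1 h2.le.not_gt
      · exact hr h1.1.symm
  simp_rw [h3]
  split_ifs with hτC
  · rw [tsum_eq_single (⟨τ, hτC⟩ : C)]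
    · simp
    · rintro ⟨τ', hτ'⟩ hne
      have : τ' ≠ τ := fun h => hne (Subtype.ext h)
      simp [this]
  · refine (tsum_congr fun τ' => ?_).trans tsum_zero
    have : (τ' : ℝ) ≠ τ := fun h => hτC (h ▸ τ'.2)
    simp [this]

-- A segment between initial points of two times consists of whole fibres, so the integral splits
-- into the ordinary part and a sum of complete jumps over the half-open interval of times.
open scoped Classical in
theorem setIntegral_seg_left {t t' : ℝ}
    (hθ : IntegrableOn θ (seg (t, -1 / 2) (t', -1 / 2)) (baseMeasure ν C)) :
    ∫ p in seg (t, -1 / 2) (t', -1 / 2), θ p ∂(baseMeasure ν C) =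
      ∫ r in Ico t t', θ (r, -1 / 2) ∂ν +
        ∑' τ, (Ico t t').indicator (fun τ => if τ ∈ C then ∫ s in J, θ (τ, s) else 0) τ := by
  have h1 := (hasSum_setIntegral_baseMeasure (measurableSet_seg (t, -1 / 2) (t', -1 / 2))
    hθ).tsum_eq
  have hslice : {r : ℝ | (r, (-1 / 2 : ℝ)) ∈ seg (t, -1 / 2) (t', -1 / 2)} = Ico t t' := by
    ext r
    rw [mem_ofPred_eq, mem_seg]
    simp only [left_mem_J, le_refl, and_true, lt_self_iff_false, and_false, or_false, true_and,
      mem_Ico, ← le_iff_lt_or_eq]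
  have hslice' (τ : ℝ) : {s : ℝ | s ∈ J ∧ (τ, s) ∈ seg (t, -1 / 2) (t', -1 / 2)} =
      {s | s ∈ J ∧ τ ∈ Ico t t'} := by
    ext s
    rw [mem_ofPred_eq, mem_seg]
    simp only [mem_ofPred_eq, mem_Ico]
    constructor
    · rintro ⟨hs, -, h2, h3⟩
      refine ⟨hs, by rcases h2 with h2 | h2 <;> linarith [h2], ?_⟩
      rcases h3 with h3 | h3
      · exact h3
      · linarith [hs.1, h3.2]
    · rintro ⟨hs, h2, h3⟩
      refine ⟨hs, hs, ?_, Or.inl h3⟩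
      rcases h2.lt_or_eq with h | h
      · exact Or.inl h
      · exact Or.inr ⟨h, hs.1⟩
  rw [hslice] at h1
  simp_rw [hslice'] at h1
  rw [tsum_subtype C (fun τ => ∫ s in {s | s ∈ J ∧ τ ∈ Ico t t'}, θ (τ, s))] at h1
  rw [← sub_eq_iff_eq_add', ← h1]
  refine tsum_congr fun τ => ?_
  by_cases hτ : τ ∈ Ico t t'
  · rw [indicator_of_mem hτ]
    simp [indicator, hτ]
  · rw [indicator_of_notMem hτ]
    simp [indicator, hτ]

end Segments

/-! ### Limits, variation and norm of an indefinite integral -/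

namespace HasDensity

section General

variable {E : Type*} [NormedAddCommGroup E] [NormedSpace ℝ E] {a b : ℝ} {μ : Measure (ℝ × ℝ)}
  {θ : ℝ × ℝ → E} {w : DynFun E}

theorem eVariationOn_ord_le (h : HasDensity a b μ θ w) :
    eVariationOn (ord w) (Ioo a b) ≤ ∫⁻ p in dynTime a b, ‖θ p‖ₑ ∂μ := by
  have h1 : eVariationOn (ord w) (Ioo a b) ≤ mass a b μ θ univ := by
    refine eVariationOn_le_measure_univ _ fun x hx y hy hxy => ?_
    rcases hxy.eq_or_lt with rfl | hxy
    · simp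
    · rw [edist_eq_enorm_sub]
      exact h.enorm_sub_le_Ico (p := (x, -1 / 2)) ⟨hx, left_mem_J⟩ hy hxy
  rw [mass_apply MeasurableSet.univ] at h1
  simpa using h1

theorem boundedVariationOn_ord (h : HasDensity a b μ θ w) :
    BoundedVariationOn (ord w) (Ioo a b) :=
  ne_top_of_le_ne_top h.integrableOn.2.ne h.eVariationOn_ord_le

theorem norm_sub_le_of_mass (h : HasDensity a b μ θ w) {p q : ℝ × ℝ} (hp : p ∈ dynTime a b)
    (hq : q ∈ dynTime a b) {S : Set ℝ} (hS : Icc p.1 q.1 ⊆ S) (hS' : Icc q.1 p.1 ⊆ S) {ε : ℝ}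
    (hε : 0 ≤ ε) (hm : mass a b μ θ S ≤ ENNReal.ofReal ε) :
    ‖w q.1 q.2 - w p.1 p.2‖ ≤ ε := by
  rw [← ENNReal.ofReal_le_ofReal_iff hε, ofReal_norm]
  refine le_trans ?_ hm
  rcases le_total (toLex p) (toLex q) with hpq | hpq
  · exact (h.enorm_sub_le_Icc hp hq hpq).trans (measure_mono hS)
  · rw [← enorm_neg, neg_sub]
    exact (h.enorm_sub_le_Icc hq hp hpq).trans (measure_mono hS')

theorem exists_mass_le_right (h : HasDensity a b μ θ w) (τ : ℝ) {ε : ℝ} (hε : 0 < ε) :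
    ∃ η > 0, mass a b μ θ (Ioo τ (τ + η)) ≤ ENNReal.ofReal ε := by
  have := isFiniteMeasure_mass h.integrableOn
  have h1 := (tendsto_measure_Ioo_right (mass a b μ θ) τ).eventually
    (eventually_le_nhds (b := ENNReal.ofReal ε) (by simpa using hε))
  obtain ⟨η, hη, hη'⟩ := (h1.and self_mem_nhdsWithin).exists
  exact ⟨η, hη', hη⟩

theorem exists_mass_le_left (h : HasDensity a b μ θ w) (τ : ℝ) {ε : ℝ} (hε : 0 < ε) :
    ∃ η > 0, mass a b μ θ (Ioo (τ - η) τ) ≤ ENNReal.ofReal ε := by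
  have := isFiniteMeasure_mass h.integrableOn
  have h1 := (tendsto_measure_Ioo_left (mass a b μ θ) τ).eventually
    (eventually_le_nhds (b := ENNReal.ofReal ε) (by simpa using hε))
  obtain ⟨η, hη, hη'⟩ := (h1.and self_mem_nhdsWithin).exists
  exact ⟨η, hη', hη⟩

/-- Bounded variation of the ordinary part provides the limit along s = -1/2. The small mass of the
times just after a makes it uniform in s. -/
theorem exists_hasRightLimit [CompleteSpace E] (h : HasDensity a b μ θ w) (hab : a < b) :
    ∃ c, HasRightLimit w a c := by
  obtain ⟨l, hl⟩ := h.boundedVariationOn_ord.exists_tendsto_right a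
  have h0 : Ioo a b ∩ Ioi a = Ioo a b := inter_eq_left.2 fun x hx => hx.1
  rw [h0] at hl
  refine ⟨l, fun ε hε => ?_⟩
  obtain ⟨η, hη, hm⟩ := h.exists_mass_le_right a hε
  refine ⟨min η (b - a), lt_min hη (by linarith), fun t ht s hs => ?_⟩
  have ht' : t < a + η := ht.2.trans_le (by linarith [min_le_left η (b - a)])
  have htb : t < b := ht.2.trans_le (by linarith [min_le_right η (b - a)])
  have hne : (𝓝[Ioo a b] a).NeBot := left_nhdsWithin_Ioo_neBot hab
  have hlim : Tendsto (fun r => ‖w t s - ord w r‖) (𝓝[Ioo a b] a) (𝓝 ‖w t s - l‖) :=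
    (tendsto_const_nhds.sub hl).norm
  refine le_of_tendsto hlim ?_
  have h2 : ∀ᶠ r in 𝓝[Ioo a b] a, r < a + η :=
    nhdsWithin_le_nhds (Iio_mem_nhds (by linarith))
  filter_upwards [self_mem_nhdsWithin, h2] with r hr hr2
  refine h.norm_sub_le_of_mass (p := (r, -1 / 2)) (q := (t, s)) ⟨hr, left_mem_J⟩
    ⟨⟨ht.1, htb⟩, hs⟩ (S := Ioo a (a + η)) ?_ ?_ hε.le hm
  · exact fun x hx => ⟨hr.1.trans_le hx.1, hx.2.trans_lt ht'⟩
  · exact fun x hx => ⟨ht.1.trans_le hx.1, hx.2.trans_lt hr2⟩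

theorem exists_hasLeftLimit [CompleteSpace E] (h : HasDensity a b μ θ w) (hab : a < b) :
    ∃ c, HasLeftLimit w b c := by
  obtain ⟨l, hl⟩ := h.boundedVariationOn_ord.exists_tendsto_left b
  have h0 : Ioo a b ∩ Iio b = Ioo a b := inter_eq_left.2 fun x hx => hx.2
  rw [h0] at hl
  refine ⟨l, fun ε hε => ?_⟩
  obtain ⟨η, hη, hm⟩ := h.exists_mass_le_left b hε
  refine ⟨min η (b - a), lt_min hη (by linarith), fun t ht s hs => ?_⟩
  have ht' : b - η < t := lt_of_le_of_lt (by linarith [min_le_left η (b - a)]) ht.1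
  have htb : a < t := lt_of_le_of_lt (by linarith [min_le_right η (b - a)]) ht.1
  have hne : (𝓝[Ioo a b] b).NeBot := right_nhdsWithin_Ioo_neBot hab
  have hlim : Tendsto (fun r => ‖w t s - ord w r‖) (𝓝[Ioo a b] b) (𝓝 ‖w t s - l‖) :=
    (tendsto_const_nhds.sub hl).norm
  refine le_of_tendsto hlim ?_
  have h2 : ∀ᶠ r in 𝓝[Ioo a b] b, b - η < r :=
    nhdsWithin_le_nhds (Ioi_mem_nhds (by linarith))
  filter_upwards [self_mem_nhdsWithin, h2] with r hr hr2
  refine h.norm_sub_le_of_mass (p := (r, -1 / 2)) (q := (t, s)) ⟨hr, left_mem_J⟩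
    ⟨⟨htb, ht.2⟩, hs⟩ (S := Ioo (b - η) b) ?_ ?_ hε.le hm
  · exact fun x hx => ⟨hr2.trans_le hx.1, hx.2.trans_lt ht.2⟩
  · exact fun x hx => ⟨ht'.trans_le hx.1, hx.2.trans_lt hr.2⟩

theorem hasLeftLimit (h : HasDensity a b μ θ w) {t : ℝ} (ht : t ∈ Ioo a b) :
    HasLeftLimit w t (w t (-1 / 2)) := by
  intro ε hε
  obtain ⟨η, hη, hm⟩ := h.exists_mass_le_left t hε
  refine ⟨min η (t - a), lt_min hη (by linarith [ht.1]), fun r hr s hs => ?_⟩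
  have hr' : t - η < r := lt_of_le_of_lt (by linarith [min_le_left η (t - a)]) hr.1
  have hra : a < r := lt_of_le_of_lt (by linarith [min_le_right η (t - a)]) hr.1
  rw [← ENNReal.ofReal_le_ofReal_iff hε.le, ofReal_norm, ← enorm_neg, neg_sub]
  refine ((h.enorm_sub_le_Ico (p := (r, s)) ⟨⟨hra, hr.2.trans ht.2⟩, hs⟩ ht hr.2).trans
    (measure_mono ?_)).trans hm
  exact fun x hx => ⟨hr'.trans_le hx.1, hx.2⟩

theorem hasRightLimit (h : HasDensity a b μ θ w) (hμ : ∀ p, μ {p} = 0) {t : ℝ}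
    (ht : t ∈ Ioo a b) : HasRightLimit w t (w t (1 / 2)) := by
  intro ε hε
  obtain ⟨η, hη, hm⟩ := h.exists_mass_le_right t hε
  refine ⟨min η (b - t), lt_min hη (by linarith [ht.2]), fun r hr s hs => ?_⟩
  have hr' : r < t + η := hr.2.trans_le (by linarith [min_le_left η (b - t)])
  have hrb : r < b := hr.2.trans_le (by linarith [min_le_right η (b - t)])
  rw [← ENNReal.ofReal_le_ofReal_iff hε.le, ofReal_norm]
  refine ((h.enorm_sub_le_Ioc hμ (q := (r, s)) ht ⟨⟨ht.1.trans hr.1, hrb⟩, hs⟩ hr.1).trans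
    (measure_mono ?_)).trans hm
  exact fun x hx => ⟨hx.1, hx.2.trans_lt hr'⟩

end General

section Base

variable {E : Type*} [NormedAddCommGroup E] [NormedSpace ℝ E] {a b : ℝ}
  {ν : Measure ℝ} [IsFiniteMeasure ν] [NullSingletonClass ν] {C : Set ℝ}
  {θ : ℝ × ℝ → E} {w : DynFun E}

theorem integrableOn_left (h : HasDensity a b (baseMeasure ν C) θ w) :
    IntegrableOn (fun t => θ (t, -1 / 2)) (Ioo a b) ν := by
  refine (IntegrableOn.baseMeasure_left (measurableSet_dynTime a b) h.integrableOn).mono_set ?_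
  exact fun t ht => ⟨ht, left_mem_J⟩

theorem integrableOn_right (h : HasDensity a b (baseMeasure ν C) θ w) {τ : ℝ} (hτ : τ ∈ C)
    (hτ' : τ ∈ Ioo a b) : IntegrableOn (fun s => θ (τ, s)) J := by
  refine (IntegrableOn.baseMeasure_right (measurableSet_dynTime a b) h.integrableOn hτ).mono_set ?_
  exact fun t ht => ⟨ht, hτ', ht⟩

open scoped Classical in
theorem sub_eq_integral (h : HasDensity a b (baseMeasure ν C) θ w) {τ : ℝ} (hτ : τ ∈ Ioo a b)
    {s s' : ℝ} (hs : s ∈ J) (hs' : s' ∈ J) (hss : s ≤ s') :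
    w τ s' - w τ s = if τ ∈ C then ∫ r in Ico s s', θ (τ, r) else 0 := by
  have hp : (τ, s) ∈ dynTime a b := ⟨hτ, hs⟩
  have hq : (τ, s') ∈ dynTime a b := ⟨hτ, hs'⟩
  rw [← setIntegral_seg_right hs hs' (h.integrableOn_seg hp hq)]
  exact h.sub_eq _ hp _ hq (Prod.Lex.toLex_le_toLex.2 (Or.inr ⟨rfl, hss⟩))

theorem eq_of_notMem (h : HasDensity a b (baseMeasure ν C) θ w) {τ : ℝ} (hτ : τ ∈ Ioo a b)
    (hC : τ ∉ C) {s s' : ℝ} (hs : s ∈ J) (hs' : s' ∈ J) : w τ s' = w τ s := by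
  rcases le_total s s' with hss | hss
  · simpa [hC, sub_eq_zero] using h.sub_eq_integral hτ hs hs' hss
  · exact (by simpa [hC, sub_eq_zero] using h.sub_eq_integral hτ hs' hs hss : w τ s = w τ s').symm

theorem varJ_le (h : HasDensity a b (baseMeasure ν C) θ w) {τ : ℝ} (hτ : τ ∈ Ioo a b)
    (hC : τ ∈ C) : varJ w τ ≤ ∫⁻ s in J, ‖θ (τ, s)‖ₑ := by
  have : varJ w τ ≤ ((volume.restrict J).withDensity fun s => ‖θ (τ, s)‖ₑ) univ := by
    refine eVariationOn_le_measure_univ _ fun x hx y hy hxy => ?_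
    rw [edist_eq_enorm_sub, h.sub_eq_integral hτ hx hy hxy, if_pos hC,
      withDensity_apply _ measurableSet_Ico, Measure.restrict_restrict measurableSet_Ico,
      inter_eq_left.2 (show Ico x y ⊆ J from fun r hr => ⟨hx.1.trans hr.1, hr.2.le.trans hy.2⟩)]
    exact enorm_integral_le_lintegral_enorm _
  simpa using this

theorem varJ_eq_zero (h : HasDensity a b (baseMeasure ν C) θ w) {τ : ℝ} (hτ : τ ∈ Ioo a b)
    (hC : τ ∉ C) : varJ w τ = 0 := by
  refine eVariationOn.constant_on ?_
  rintro _ ⟨s, hs, rfl⟩ _ ⟨s', hs', rfl⟩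
  exact h.eq_of_notMem hτ hC hs' hs

theorem lintegral_add_tsum_varJ_le (h : HasDensity a b (baseMeasure ν C) θ w) :
    ∫⁻ t in Ioo a b, ‖θ (t, -1 / 2)‖ₑ ∂ν + ∑' τ : Ioo a b, varJ w τ ≤
      ∫⁻ p in dynTime a b, ‖θ p‖ₑ ∂(baseMeasure ν C) := by
  rw [setLIntegral_baseMeasure (measurableSet_dynTime a b)]
  refine add_le_add (lintegral_mono_set fun t ht => ⟨ht, left_mem_J⟩) ?_
  rw [tsum_subtype (Ioo a b) (varJ w), tsum_subtype C (fun τ => ∫⁻ s in {s | s ∈ J ∧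
    (τ, s) ∈ dynTime a b}, ‖θ (τ, s)‖ₑ)]
  refine ENNReal.tsum_le_tsum fun τ => ?_
  by_cases hτ : τ ∈ Ioo a b
  · rw [indicator_of_mem hτ]
    by_cases hC : τ ∈ C
    · rw [indicator_of_mem hC]
      exact (h.varJ_le hτ hC).trans (lintegral_mono_set fun s hs => ⟨hs, hτ, hs⟩)
    · rw [h.varJ_eq_zero hτ hC]
      exact zero_le
  · rw [indicator_of_notMem hτ]
    exact zero_le

/-- The increments on a fibre are dominated by those of the primitive of ‖θ‖, a real function which
is absolutely continuous. Over times outside C the value is constant. -/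
theorem absolutelyContinuousOnInterval (h : HasDensity a b (baseMeasure ν C) θ w) {τ : ℝ}
    (hτ : τ ∈ Ioo a b) : AbsolutelyContinuousOnInterval (w τ) (-1 / 2) (1 / 2) := by
  have huIcc : uIcc (-1 / 2 : ℝ) (1 / 2) = J := uIcc_of_le (by norm_num)
  obtain ⟨k, hk, hwk⟩ : ∃ k : ℝ → ℝ, IntervalIntegrable k volume (-1 / 2) (1 / 2) ∧
      ∀ s ∈ J, ∀ s' ∈ J, dist (w τ s) (w τ s') ≤
        dist (∫ r in (-1 / 2 : ℝ)..s, k r) (∫ r in (-1 / 2 : ℝ)..s', k r) := by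
    by_cases hC : τ ∈ C
    · have hint : IntervalIntegrable (fun r => ‖θ (τ, r)‖) volume (-1 / 2) (1 / 2) := by
        rw [intervalIntegrable_iff, uIoc_of_le (by norm_num)]
        exact IntegrableOn.mono_set (h.integrableOn_right hC hτ).norm Ioc_subset_Icc_self
      have hsub {x y : ℝ} (hx : x ∈ J) (hy : y ∈ J) :
          IntervalIntegrable (fun r => ‖θ (τ, r)‖) volume x y :=
        hint.mono_set (by rw [huIcc]; exact ordConnected_Icc.uIcc_subset hx hy)
      refine ⟨fun r => ‖θ (τ, r)‖, hint, ?_⟩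
      have key : ∀ s ∈ J, ∀ s' ∈ J, s ≤ s' → dist (w τ s) (w τ s') ≤
          dist (∫ r in (-1 / 2 : ℝ)..s, ‖θ (τ, r)‖) (∫ r in (-1 / 2 : ℝ)..s', ‖θ (τ, r)‖) := by
        intro s hs s' hs' hss
        rw [dist_comm, dist_eq_norm, h.sub_eq_integral hτ hs hs' hss, if_pos hC, dist_comm,
          Real.dist_eq, intervalIntegral.integral_interval_sub_left (hsub left_mem_J hs')
            (hsub left_mem_J hs), intervalIntegral.integral_of_le hss,
          ← integral_Ico_eq_integral_Ioc]
        exact (norm_integral_le_integral_norm _).trans (le_abs_self _)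
      intro s hs s' hs'
      rcases le_total s s' with hss | hss
      · exact key s hs s' hs' hss
      · rw [dist_comm, dist_comm (∫ r in (-1 / 2 : ℝ)..s, ‖θ (τ, r)‖)]
        exact key s' hs' s hs hss
    · refine ⟨fun _ => 0, by simp, fun s hs s' hs' => ?_⟩
      rw [h.eq_of_notMem hτ hC hs' hs]
      simp
  have hAC := hk.absolutelyContinuousOnInterval_intervalIntegral (c := -1 / 2)
    (by rw [huIcc]; exact left_mem_J)
  rw [absolutelyContinuousOnInterval_iff] at hAC ⊢
  intro ε hε
  obtain ⟨δ, hδ, hE⟩ := hAC ε hε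
  refine ⟨δ, hδ, fun E hEd hEs => lt_of_le_of_lt (Finset.sum_le_sum fun i hi => ?_) (hE E hEd hEs)⟩
  have := hEd.1 i (by simpa using hi)
  rw [huIcc] at this
  exact hwk _ this.1 _ this.2

theorem memSG [CompleteSpace E] (h : HasDensity a b (baseMeasure ν C) θ w) (hab : a < b) :
    MemSG a b w :=
  ⟨h.exists_hasRightLimit hab, h.exists_hasLeftLimit hab, fun _ ht =>
    ⟨h.absolutelyContinuousOnInterval ht, h.hasLeftLimit ht,
      h.hasRightLimit baseMeasure_singleton ht⟩⟩

theorem memSBV [CompleteSpace E] (h : HasDensity a b (baseMeasure ν C) θ w) (hab : a < b) :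
    MemSBV a b w :=
  ⟨h.memSG hab, h.boundedVariationOn_ord, ne_top_of_le_ne_top h.integrableOn.2.ne
    (le_add_self.trans h.lintegral_add_tsum_varJ_le)⟩

end Base

end HasDensity

/-- The jumps of a dynamic function at the times of an interval. -/
def jump {E : Type*} [NormedAddCommGroup E] (w : DynFun E) (τ : ℝ) : E := w τ (1 / 2) - w τ (-1 / 2)

theorem contPart_eq {E : Type*} [NormedAddCommGroup E] (a : ℝ) (w : DynFun E) (t : ℝ) :
    contPart a w t = ord w t - ∑' τ, (Ioo a t).indicator (jump w) τ := by
  rw [contPart, ← tsum_subtype]; rfl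

namespace HasDensity

variable {E : Type*} [NormedAddCommGroup E] [NormedSpace ℝ E] [CompleteSpace E] {a b : ℝ}
  {ν : Measure ℝ} [IsFiniteMeasure ν] [NullSingletonClass ν] {C : Set ℝ}
  {θ : ℝ × ℝ → E} {w : DynFun E}

open scoped Classical in
theorem jump_eq (h : HasDensity a b (baseMeasure ν C) θ w) {τ : ℝ} (hτ : τ ∈ Ioo a b) :
    jump w τ = if τ ∈ C then ∫ s in J, θ (τ, s) else 0 := by
  rw [jump, h.sub_eq_integral hτ left_mem_J right_mem_J (by norm_num), J,
    integral_Icc_eq_integral_Ico]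

theorem summable_norm_jump (h : HasDensity a b (baseMeasure ν C) θ w) :
    Summable ((Ioo a b).indicator fun τ => ‖jump w τ‖) := by
  have h1 : Summable (C.indicator fun τ => ∫ s in {s | s ∈ J ∧ (τ, s) ∈ dynTime a b},
      ‖θ (τ, s)‖) :=
    summable_subtype_iff_indicator.1
      (hasSum_setIntegral_baseMeasure (measurableSet_dynTime a b)
        (h.integrableOn : IntegrableOn θ _ _).norm).summable
  refine Summable.of_nonneg_of_le (fun τ => indicator_nonneg (fun _ _ => norm_nonneg _) _)
    (fun τ => ?_) h1
  by_cases hτ : τ ∈ Ioo a b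
  · rw [indicator_of_mem hτ, h.jump_eq hτ]
    have : {s | s ∈ J ∧ (τ, s) ∈ dynTime a b} = J := by
      ext s; exact ⟨fun hs => hs.1, fun hs => ⟨hs, hτ, hs⟩⟩
    split_ifs with hC
    · rw [indicator_of_mem hC, this]
      exact norm_integral_le_integral_norm _
    · rw [indicator_of_notMem hC, norm_zero]
  · rw [indicator_of_notMem hτ]
    exact indicator_nonneg (fun _ _ => integral_nonneg fun _ => norm_nonneg _) _

theorem summable_norm_indicator_jump (h : HasDensity a b (baseMeasure ν C) θ w) {S : Set ℝ}
    (hS : S ⊆ Ioo a b) : Summable fun τ => ‖S.indicator (jump w) τ‖ := by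
  refine Summable.of_nonneg_of_le (fun _ => norm_nonneg _) (fun τ => ?_) h.summable_norm_jump
  rw [norm_indicator_eq_indicator_norm]
  exact indicator_le_indicator_of_subset hS (fun _ => norm_nonneg _) _

theorem summable_jump (h : HasDensity a b (baseMeasure ν C) θ w) {S : Set ℝ} (hS : S ⊆ Ioo a b) :
    Summable (S.indicator (jump w)) :=
  (h.summable_norm_indicator_jump hS).of_norm

theorem ord_sub_ord (h : HasDensity a b (baseMeasure ν C) θ w) {t t' : ℝ} (ht : t ∈ Ioo a b)
    (ht' : t' ∈ Ioo a b) (htt : t ≤ t') :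
    ord w t' - ord w t = ∫ r in Ico t t', θ (r, -1 / 2) ∂ν + ∑' τ, (Ico t t').indicator (jump w) τ := by
  have hp : (t, (-1 / 2 : ℝ)) ∈ dynTime a b := ⟨ht, left_mem_J⟩
  have hq : (t', (-1 / 2 : ℝ)) ∈ dynTime a b := ⟨ht', left_mem_J⟩
  have hpq : toLex (t, (-1 / 2 : ℝ)) ≤ toLex (t', (-1 / 2 : ℝ)) := by
    rw [Prod.Lex.toLex_le_toLex]
    rcases htt.lt_or_eq with h | h
    · exact Or.inl h
    · exact Or.inr ⟨h, le_rfl⟩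
  have h1 := setIntegral_seg_left (h.integrableOn_seg hp hq)
  rw [← h.sub_eq _ hp _ hq hpq] at h1
  refine h1.trans (congrArg _ (tsum_congr fun τ => ?_))
  refine congrFun (indicator_congr fun τ hτ => ?_) τ
  rw [h.jump_eq ⟨ht.1.trans_le hτ.1, hτ.2.trans ht'.2⟩]

/-- Between t and t' the jump sum of `contPart` grows by the jumps in [t, t'), which are exactly
those in the segment between the initial points. Only the ordinary part of the integral survives. -/
theorem contPart_sub (h : HasDensity a b (baseMeasure ν C) θ w) {t t' : ℝ} (ht : t ∈ Ioo a b)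
    (ht' : t' ∈ Ioo a b) (htt : t ≤ t') :
    contPart a w t' - contPart a w t = ∫ r in Ico t t', θ (r, -1 / 2) ∂ν := by
  have h1 : ∀ τ, (Ioo a t').indicator (jump w) τ =
      (Ioo a t).indicator (jump w) τ + (Ico t t').indicator (jump w) τ := by
    intro τ
    rw [← Ioo_union_Ico_eq_Ioo ht.1 htt, indicator_union_of_disjoint]
    rw [Set.disjoint_left]
    exact fun x hx hx' => absurd hx.2 hx'.1.not_gt
  rw [contPart_eq, contPart_eq, tsum_congr h1, Summable.tsum_add
    (h.summable_jump (Ioo_subset_Ioo_right ht.2.le))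
    (h.summable_jump fun x hx => ⟨ht.1.trans_le hx.1, hx.2.trans ht'.2⟩)]
  have := h.ord_sub_ord ht ht' htt
  rw [sub_eq_iff_eq_add] at this
  rw [this]
  abel

theorem eVariationOn_contPart_le (h : HasDensity a b (baseMeasure ν C) θ w) :
    eVariationOn (contPart a w) (Ioo a b) ≤ ∫⁻ t in Ioo a b, ‖θ (t, -1 / 2)‖ₑ ∂ν := by
  have : eVariationOn (contPart a w) (Ioo a b) ≤
      ((ν.restrict (Ioo a b)).withDensity fun t => ‖θ (t, -1 / 2)‖ₑ) univ := by
    refine eVariationOn_le_measure_univ _ fun x hx y hy hxy => ?_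
    rw [edist_eq_enorm_sub, h.contPart_sub hx hy hxy,
      withDensity_apply _ measurableSet_Ico, Measure.restrict_restrict measurableSet_Ico,
      inter_eq_left.2 (show Ico x y ⊆ Ioo a b from fun r hr => ⟨hx.1.trans_le hr.1, hr.2.trans hy.2⟩)]
    exact enorm_integral_le_lintegral_enorm _
  simpa using this

theorem boundedVariationOn_contPart (h : HasDensity a b (baseMeasure ν C) θ w) :
    BoundedVariationOn (contPart a w) (Ioo a b) :=
  ne_top_of_le_ne_top (h.integrableOn_left).2.ne h.eVariationOn_contPart_le

theorem tsum_norm_jump_le (h : HasDensity a b (baseMeasure ν C) θ w) :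
    ENNReal.ofReal (∑' τ, (Ioo a b).indicator (fun τ => ‖jump w τ‖) τ) ≤
      ∑' τ : Ioo a b, varJ w τ := by
  rw [ENNReal.ofReal_tsum_of_nonneg (fun τ => indicator_nonneg (fun _ _ => norm_nonneg _) _)
    h.summable_norm_jump, tsum_subtype (Ioo a b) (varJ w)]
  refine ENNReal.tsum_le_tsum fun τ => ?_
  by_cases hτ : τ ∈ Ioo a b
  · rw [indicator_of_mem hτ, indicator_of_mem hτ, ofReal_norm, jump, ← edist_eq_enorm_sub]
    exact eVariationOn.edist_le _ right_mem_J left_mem_J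
  · simp [indicator_of_notMem hτ]

theorem enorm_rightLim_le {F : ℝ → E} (hab : a < b) (hF : BoundedVariationOn F (Ioo a b))
    {M : ℝ≥0∞} (hM : ∀ t ∈ Ioo a b, ‖F t‖ₑ ≤ M) : ‖Function.rightLim F a‖ₑ ≤ M := by
  obtain ⟨l, hl⟩ := hF.exists_tendsto_right a
  have h0 : Ioo a b ∩ Ioi a = Ioo a b := inter_eq_left.2 fun x hx => hx.1
  rw [h0, nhdsWithin_Ioo_eq_nhdsGT hab] at hl
  rw [rightLim_eq_of_tendsto hl]
  refine le_of_tendsto hl.enorm ?_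
  filter_upwards [Ioo_mem_nhdsGT hab] with t ht using hM t ht

/-- The continuous part is bounded by the values of w plus the sum of the jumps. This crude bound of
its right limit at a counts the jumps a second time, whence the factor 2 of the integral. -/
theorem sbvNorm_le (h : HasDensity a b (baseMeasure ν C) θ w) (hab : a < b) {M : ℝ≥0∞}
    (hM : ∀ t ∈ Ioo a b, ‖ord w t‖ₑ ≤ M) :
    sbvNorm a b w ≤ 2 * M + 2 * ∫⁻ p in dynTime a b, ‖θ p‖ₑ ∂(baseMeasure ν C) := by
  set T := ∑' τ : Ioo a b, varJ w τ
  have h1 : ∀ t ∈ Ioo a b, ‖contPart a w t‖ₑ ≤ M + T := by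
    intro t ht
    rw [contPart_eq]
    refine _root_.enorm_sub_le.trans (add_le_add (hM t ht) (le_trans ?_ h.tsum_norm_jump_le))
    rw [← ofReal_norm]
    refine ENNReal.ofReal_le_ofReal ((norm_tsum_le_tsum_norm ?_).trans ?_)
    · exact (h.summable_norm_indicator_jump (Ioo_subset_Ioo_right ht.2.le))
    · refine Summable.tsum_le_tsum (fun τ => ?_)
        (h.summable_norm_indicator_jump (Ioo_subset_Ioo_right ht.2.le)) h.summable_norm_jump
      rw [norm_indicator_eq_indicator_norm]
      exact indicator_le_indicator_of_subset (Ioo_subset_Ioo_right ht.2.le)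
        (fun _ => norm_nonneg _) _
  have h2 := enorm_rightLim_le hab h.boundedVariationOn_ord hM
  have h3 := enorm_rightLim_le hab h.boundedVariationOn_contPart h1
  have h4 := h.eVariationOn_contPart_le
  have h5 := h.lintegral_add_tsum_varJ_le
  rw [sbvNorm]
  calc _ ≤ M + ((M + T) + ∫⁻ t in Ioo a b, ‖θ (t, -1 / 2)‖ₑ ∂ν) + T := by gcongr
    _ ≤ 2 * M + 2 * (∫⁻ t in Ioo a b, ‖θ (t, -1 / 2)‖ₑ ∂ν + T) := by
      rw [two_mul, two_mul]
      calc _ = M + M + (∫⁻ t in Ioo a b, ‖θ (t, -1 / 2)‖ₑ ∂ν + T + T) := by ring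
        _ ≤ _ := by
          gcongr
          exact le_add_self
    _ ≤ _ := by gcongr

end HasDensity

/-! ### The distributional derivative as integration against a density -/

theorem integral_withDensityᵥ {N : Measure ℝ} {k φ : ℝ → ℝ} (hk : Integrable k N)
    (hφ : AEStronglyMeasurable φ N) (hφk : Integrable (fun t => φ t * k t) N) :
    (N.withDensityᵥ k).integral φ (ContinuousLinearMap.lsmul ℝ ℝ) = ∫ t, φ t * k t ∂N := by
  -- Multiplication of reals commutes, so the pairing may be flipped into the form in which
  -- integrals against the positive and the negative part are available.
  have hB : (ContinuousLinearMap.lsmul ℝ ℝ : ℝ →L[ℝ] ℝ →L[ℝ] ℝ) =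
      (ContinuousLinearMap.lsmul ℝ ℝ).flip := by
    ext; simp
  have key {l : ℝ → ℝ} (hl : Integrable l N) (hlk : ∀ t, |max (l t) 0| ≤ |k t|) :
      Integrable φ (N.withDensity fun t => ENNReal.ofReal (l t)) ∧
      ∫ t, φ t ∂(N.withDensity fun t => ENNReal.ofReal (l t)) = ∫ t, φ t * max (l t) 0 ∂N := by
    have hm : AEMeasurable (fun t => (l t).toNNReal) N := hl.1.aemeasurable.real_toNNReal
    constructor
    · refine (integrable_withDensity_iff_integrable_smul₀ hm).2 (hφk.mono ?_ ?_)
      · exact (hm.coe_nnreal_real.aestronglyMeasurable.mul hφ)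
      · refine Eventually.of_forall fun t => ?_
        simp only [NNReal.smul_def, Real.coe_toNNReal', smul_eq_mul, norm_mul, Real.norm_eq_abs]
        rw [mul_comm]
        exact mul_le_mul_of_nonneg_left (hlk t) (abs_nonneg _)
    · refine (integral_withDensity_eq_integral_smul₀ hm φ).trans (integral_congr_ae ?_)
      refine Eventually.of_forall fun t => ?_
      simp only [NNReal.smul_def, Real.coe_toNNReal', smul_eq_mul]
      ring
  have h1 := key hk fun t => by
    rcases le_total (k t) 0 with h | h <;> simp [h]
  have h2 := key hk.neg fun t => by
    rcases le_total (k t) 0 with h | h <;> simp [h]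
  have := isFiniteMeasure_withDensity_ofReal hk.2
  have := isFiniteMeasure_withDensity_ofReal hk.neg.2
  rw [withDensityᵥ_eq_withDensity_pos_part_sub_withDensity_neg_part hk, hB]
  rw [VectorMeasure.integral_sub_vectorMeasure]
  · have e1 := VectorMeasure.integral_toSignedMeasure
      (μ := N.withDensity fun t => ENNReal.ofReal (k t)) (f := φ)
    have e2 := VectorMeasure.integral_toSignedMeasure
      (μ := N.withDensity fun t => ENNReal.ofReal (-k t)) (f := φ)
    refine (congrArg₂ (· - ·) e1 e2).trans ?_
    rw [h1.2]
    have h3 := h2.2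
    simp only [Pi.neg_apply] at h3
    rw [h3, ← integral_sub]
    · refine integral_congr_ae (Eventually.of_forall fun t => ?_)
      simp only
      rcases le_total (k t) 0 with h | h <;> simp [h]
    · refine hφk.mono (hφ.mul (hk.1.aemeasurable.max aemeasurable_const).aestronglyMeasurable) ?_
      refine Eventually.of_forall fun t => ?_
      rcases le_total (k t) 0 with h | h <;> simp [h]
      positivity
    · refine hφk.mono (hφ.mul (hk.1.aemeasurable.neg.max aemeasurable_const).aestronglyMeasurable) ?_
      refine Eventually.of_forall fun t => ?_
      rcases le_total (k t) 0 with h | h <;> simp [h]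
      positivity
  · rw [VectorMeasure.Integrable, Measure.variation_toSignedMeasure]
    exact h1.1
  · rw [VectorMeasure.Integrable, Measure.variation_toSignedMeasure]
    exact h2.1

/-- Cutting off a function of bounded variation outside an interval. -/
theorem boundedVariationOn_indicator {a b : ℝ} {F : ℝ → ℝ}
    (hF : BoundedVariationOn F (Ioo a b)) : BoundedVariationOn ((Ioo a b).indicator F) univ := by
  rcases le_or_gt b a with hab | hab
  · rw [Ioo_eq_empty hab.not_gt, indicator_empty]
    refine ne_top_of_le_ne_top ENNReal.zero_ne_top (eVariationOn.constant_on ?_).le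
    rintro _ ⟨x, -, rfl⟩ _ ⟨y, -, rfl⟩
    rfl
  have hm : (a + b) / 2 ∈ Ioo a b := ⟨by linarith, by linarith⟩
  set m := (a + b) / 2
  set v := (eVariationOn F (Ioo a b)).toReal
  set V := variationOnFromTo F (Ioo a b) m
  have hV (t : ℝ) : |V t| ≤ v := variationOnFromTo.abs_le_eVariationOn hF
  have hv : 0 ≤ v := ENNReal.toReal_nonneg
  set c := |F m| + v
  have hFc {t : ℝ} (ht : t ∈ Ioo a b) : |F t| ≤ c := by
    have := hF.dist_le ht hm
    rw [Real.dist_eq] at this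
    have h2 := abs_sub_abs_le_abs_sub (F t) (F m)
    simp only [c, v]
    linarith
  have hinc {x y : ℝ} (hx : x ∈ Ioo a b) (hy : y ∈ Ioo a b) (hxy : x ≤ y) :
      |F y - F x| ≤ V y - V x :=
    variationOnFromTo.abs_sub_le_sub_of_le hF.locallyBoundedVariationOn hm hx hy hxy
  -- A monotone majorant of the increments: inside the interval it follows the variation function,
  -- and since |V| ≤ v it steps up by at least c at a and at b, where cutting off F creates jumps of
  -- size at most c.
  set M : ℝ → ℝ := fun t => if t ≤ a then -v else if t < b then V t + c else v + 2 * c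
  have hc : 0 ≤ c := by positivity
  have key : ∀ x y, x ≤ y → |(Ioo a b).indicator F y - (Ioo a b).indicator F x| ≤ M y - M x := by
    intro x y hxy
    have hVx := abs_le.1 (hV x)
    have hVy := abs_le.1 (hV y)
    by_cases hx : x ≤ a
    · rw [indicator_of_notMem (show x ∉ Ioo a b from fun h => absurd h.1 hx.not_gt), sub_zero]
      by_cases hy : y ≤ a
      · rw [indicator_of_notMem (show y ∉ Ioo a b from fun h => absurd h.1 hy.not_gt)]
        simp [M, hx, hy]
      · by_cases hyb : y < b
        · have hy' : y ∈ Ioo a b := ⟨not_le.1 hy, hyb⟩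
          rw [indicator_of_mem hy']
          simp only [M, hx, hy, hyb, if_true, if_false]
          linarith [hFc hy']
        · rw [indicator_of_notMem (show y ∉ Ioo a b from fun h => hyb h.2)]
          simp only [M, hx, hy, hyb, if_true, if_false, abs_zero]
          linarith
    · have hy : ¬ y ≤ a := fun h => hx (hxy.trans h)
      by_cases hyb : y < b
      · have hx' : x ∈ Ioo a b := ⟨not_le.1 hx, hxy.trans_lt hyb⟩
        have hy' : y ∈ Ioo a b := ⟨not_le.1 hy, hyb⟩
        rw [indicator_of_mem hy', indicator_of_mem hx']
        simp only [M, hx, hy, hyb, hx'.2, if_true, if_false]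
        linarith [hinc hx' hy' hxy]
      · rw [indicator_of_notMem (show y ∉ Ioo a b from fun h => hyb h.2), zero_sub, abs_neg]
        by_cases hxb : x < b
        · have hx' : x ∈ Ioo a b := ⟨not_le.1 hx, hxb⟩
          rw [indicator_of_mem hx']
          simp only [M, hx, hy, hyb, hxb, if_true, if_false]
          linarith [hFc hx']
        · rw [indicator_of_notMem (show x ∉ Ioo a b from fun h => hxb h.2)]
          simp [M, hx, hy, hyb, hxb]
  have hmono : Monotone M := fun x y hxy => by linarith [(abs_nonneg _).trans (key x y hxy)]
  have hMb : BoundedVariationOn M univ := by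
    refine (hmono.monotoneOn univ).boundedVariationOn (C := v + 2 * c) fun x _ => ?_
    have := abs_le.1 (hV x)
    rw [abs_le]
    simp only [M]
    split_ifs <;> constructor <;> linarith
  refine ne_top_of_le_ne_top hMb (iSup_mono fun p => Finset.sum_le_sum fun i _ => ?_)
  rw [edist_dist, edist_dist, Real.dist_eq, Real.dist_eq]
  exact ENNReal.ofReal_le_ofReal ((key _ _ (p.2.2.1 (Nat.le_succ i))).trans (le_abs_self _))

/-- The measure of a function of bounded variation with a continuous primitive. -/
theorem stieltjesIntegral_eq {a b : ℝ} (hab : a < b) {ν : Measure ℝ} [IsFiniteMeasure ν]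
    [NullSingletonClass ν] {k F φ : ℝ → ℝ} (hk : IntegrableOn k (Ioo a b) ν)
    (hBV : BoundedVariationOn F (Ioo a b))
    (hF : ∀ t ∈ Ioo a b, ∀ t' ∈ Ioo a b, t ≤ t' → F t' - F t = ∫ r in Ico t t', k r ∂ν)
    (hφ : AEStronglyMeasurable φ (ν.restrict (Ioo a b)))
    (hφk : IntegrableOn (fun t => φ t * k t) (Ioo a b) ν) :
    stieltjesIntegral a b φ F = ∫ t in Ioo a b, φ t * k t ∂ν := by
  have hBV' := boundedVariationOn_indicator hBV
  rw [stieltjesIntegral, dif_pos hBV', ← integral_withDensityᵥ hk hφ hφk]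
  congr 1
  set N := ν.restrict (Ioo a b)
  have hkN : ∀ x y, IntervalIntegrable k N x y := fun x y =>
    MeasureTheory.Integrable.intervalIntegrable (μ := N) hk
  set G : ℝ → ℝ := fun t => ∫ r in a..t, k r ∂N
  have hG : Continuous G := intervalIntegral.continuous_primitive hkN a
  -- On the interval F differs from the continuous primitive G by a constant, so the one-sided
  -- limits of the cut-off function at interior points and at the ends can be read off from G.
  have hc : ∀ t ∈ Ioo a b, F t = (F ((a + b) / 2) - G ((a + b) / 2)) + G t := by
    have hm : (a + b) / 2 ∈ Ioo a b := ⟨by linarith, by linarith⟩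
    have key : ∀ t ∈ Ioo a b, ∀ t' ∈ Ioo a b, t ≤ t' → F t' - F t = G t' - G t := by
      intro t ht t' ht' htt
      rw [hF t ht t' ht' htt, intervalIntegral.integral_interval_sub_left (hkN _ _) (hkN _ _),
        intervalIntegral.integral_of_le htt, ← integral_Ico_eq_integral_Ioc,
        Measure.restrict_restrict measurableSet_Ico, inter_eq_left.2
        (show Ico t t' ⊆ Ioo a b from fun r hr => ⟨ht.1.trans_le hr.1, hr.2.trans ht'.2⟩)]
    intro t ht
    rcases le_total t ((a + b) / 2) with h | h
    · linarith [key t ht _ hm h]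
    · linarith [key _ hm t ht h]
  -- The mass of Ioo a d involves the right limit at a and the left limit at d. Hence d = b is
  -- allowed, and the jumps caused by the cut-off do not enter.
  have hleft {d : ℝ} (hd : d ∈ Ioc a b) : Function.leftLim ((Ioo a b).indicator F) d =
      (F ((a + b) / 2) - G ((a + b) / 2)) + G d := by
    refine leftLim_eq_of_tendsto ?_
    refine Tendsto.congr' ?_ ((tendsto_const_nhds.add hG.continuousAt).mono_left nhdsWithin_le_nhds)
    filter_upwards [Ioo_mem_nhdsLT hd.1] with t ht
    have : t ∈ Ioo a b := ⟨ht.1, ht.2.trans_le hd.2⟩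
    rw [indicator_of_mem this, hc t this]
  have hright : Function.rightLim ((Ioo a b).indicator F) a =
      (F ((a + b) / 2) - G ((a + b) / 2)) + G a := by
    refine rightLim_eq_of_tendsto ?_
    refine Tendsto.congr' ?_ ((tendsto_const_nhds.add hG.continuousAt).mono_left nhdsWithin_le_nhds)
    filter_upwards [Ioo_mem_nhdsGT hab] with t ht
    rw [indicator_of_mem ht, hc t ht]
  have hGa : G a = 0 := intervalIntegral.integral_same
  have main {d : ℝ} (hd : d ∈ Ioc a b) : hBV'.vectorMeasure (Ioo a d) = ∫ t in Ioo a d, k t ∂ν := by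
    rw [hBV'.vectorMeasure_Ioo hd.1, hleft hd, hright, hGa]
    have : G d = ∫ t in Ioo a d, k t ∂ν := by
      simp only [G]
      rw [intervalIntegral.integral_of_le hd.1.le, integral_Ioc_eq_integral_Ioo,
        Measure.restrict_restrict measurableSet_Ioo, inter_eq_left.2 (Ioo_subset_Ioo_right hd.2)]
    rw [this]
    ring
  -- Rays form a generating π-system, and a ray meets the interval in another interval starting at
  -- a, for which `main` applies.
  refine VectorMeasure.ext_of_generateFrom (range Iio) ?_ ?_ isPiSystem_Iio ?_
  · rintro _ ⟨y, rfl⟩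
    rw [VectorMeasure.restrict_apply _ measurableSet_Ioo measurableSet_Iio,
      withDensityᵥ_apply hk measurableSet_Iio, Measure.restrict_restrict measurableSet_Iio]
    have h1 : Iio y ∩ Ioo a b = Ioo a (min y b) := by
      ext x; simp only [mem_inter_iff, mem_Iio, mem_Ioo, lt_min_iff]; tauto
    rw [h1]
    rcases lt_or_ge a (min y b) with h2 | h2
    · exact main ⟨h2, min_le_right _ _⟩
    · simp [Ioo_eq_empty h2.not_gt]
  · rw [← borel_eq_generateFrom_Iio]
    exact BorelSpace.measurable_eq
  · rw [VectorMeasure.restrict_apply _ measurableSet_Ioo MeasurableSet.univ,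
      withDensityᵥ_apply hk MeasurableSet.univ, Measure.restrict_restrict MeasurableSet.univ,
      univ_inter]
    exact main ⟨hab, le_rfl⟩

namespace HasDensity

variable {a b : ℝ} {ν : Measure ℝ} [IsFiniteMeasure ν] [NullSingletonClass ν] {C : Set ℝ}
  {θ : ℝ × ℝ → ℝ} {w : DynFun ℝ}

theorem deriv_ae_eq (h : HasDensity a b (baseMeasure ν C) θ w) {τ : ℝ} (hτ : τ ∈ Ioo a b)
    (hC : τ ∈ C) : ∀ᵐ s ∂(volume.restrict J), HasDerivAt (w τ) (θ (τ, s)) s := by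
  have hint : IntervalIntegrable (fun r => θ (τ, r)) volume (-1 / 2) (1 / 2) := by
    rw [intervalIntegrable_iff, uIoc_of_le (by norm_num)]
    exact IntegrableOn.mono_set (h.integrableOn_right hC hτ) Ioc_subset_Icc_self
  have huIcc : uIcc (-1 / 2 : ℝ) (1 / 2) = J := uIcc_of_le (by norm_num)
  rw [ae_restrict_iff' measurableSet_J]
  filter_upwards [hint.ae_hasDerivAt_integral, Measure.ae_ne volume (-1 / 2 : ℝ),
    Measure.ae_ne volume (1 / 2 : ℝ)] with s hs h1 h2 hsJ
  have h3 := hs (by rwa [huIcc]) (-1 / 2) (by rw [huIcc]; exact left_mem_J)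
  have h4 := h3.const_add (w τ (-1 / 2))
  refine h4.congr_of_eventuallyEq ?_
  have h5 : Ioo (-1 / 2 : ℝ) (1 / 2) ∈ 𝓝 s :=
    Ioo_mem_nhds (lt_of_le_of_ne hsJ.1 (Ne.symm h1)) (lt_of_le_of_ne hsJ.2 h2)
  filter_upwards [h5] with r hr
  have := h.sub_eq_integral hτ left_mem_J (Ioo_subset_Icc_self hr) hr.1.le
  rw [if_pos hC, integral_Ico_eq_integral_Ioc, ← intervalIntegral.integral_of_le hr.1.le] at this
  linarith

/-- The Stieltjes integral sees the density on ordinary times, and on the fibres over C the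
derivative of w is the density almost everywhere. Over the other times w is constant, so the sum
over all times reduces to C. -/
theorem derivPairing_eq (h : HasDensity a b (baseMeasure ν C) θ w) (hab : a < b) {φ : DynFun ℝ}
    (hφ : AEStronglyMeasurable (fun t => φ t (-1 / 2)) (ν.restrict (Ioo a b)))
    (hφθ : IntegrableOn (fun p => φ p.1 p.2 * θ p) (dynTime a b) (baseMeasure ν C)) :
    derivPairing a b w φ = ∫ p in dynTime a b, φ p.1 p.2 * θ p ∂(baseMeasure ν C) := by
  have hS : {t : ℝ | (t, (-1 / 2 : ℝ)) ∈ dynTime a b} = Ioo a b := by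
    ext t; exact ⟨fun ht => ht.1, fun ht => ⟨ht, left_mem_J⟩⟩
  have h1 := hasSum_setIntegral_baseMeasure (measurableSet_dynTime a b) hφθ
  have h2 := IntegrableOn.baseMeasure_left (measurableSet_dynTime a b) hφθ
  rw [hS] at h1 h2
  have h3 := stieltjesIntegral_eq (φ := ord φ) hab h.integrableOn_left h.boundedVariationOn_contPart
    (fun t ht t' ht' htt => h.contPart_sub ht ht' htt) hφ h2
  have h4 : ∑' τ : Ioo a b, ∫ s in (-1 / 2 : ℝ)..(1 / 2), φ τ s * deriv (w τ) s =
      ∑' τ : C, ∫ s in {s | s ∈ J ∧ ((τ : ℝ), s) ∈ dynTime a b}, φ τ s * θ (τ, s) := by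
    rw [tsum_subtype (Ioo a b) (fun τ => ∫ s in (-1 / 2 : ℝ)..(1 / 2), φ τ s * deriv (w τ) s),
      tsum_subtype C (fun τ => ∫ s in {s | s ∈ J ∧ (τ, s) ∈ dynTime a b}, φ τ s * θ (τ, s))]
    refine tsum_congr fun τ => ?_
    by_cases hτ : τ ∈ Ioo a b
    · have hJ : {s | s ∈ J ∧ (τ, s) ∈ dynTime a b} = J := by
        ext s; exact ⟨fun hs => hs.1, fun hs => ⟨hs, hτ, hs⟩⟩
      rw [indicator_of_mem hτ, intervalIntegral.integral_of_le (by norm_num),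
        ← integral_Icc_eq_integral_Ioc]
      by_cases hC : τ ∈ C
      · rw [indicator_of_mem hC, hJ]
        refine integral_congr_ae ?_
        filter_upwards [h.deriv_ae_eq hτ hC] with s hs
        rw [hs.deriv]
      · rw [indicator_of_notMem hC]
        refine (integral_congr_ae ?_).trans (integral_zero _ _)
        refine (ae_restrict_iff' measurableSet_Icc).2 ?_
        filter_upwards [Measure.ae_ne volume (-1 / 2 : ℝ),
          Measure.ae_ne volume (1 / 2 : ℝ)] with s h1 h2 hsJ
        have h5 : Ioo (-1 / 2 : ℝ) (1 / 2) ∈ 𝓝 s :=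
          Ioo_mem_nhds (lt_of_le_of_ne hsJ.1 (Ne.symm h1)) (lt_of_le_of_ne hsJ.2 h2)
        have h6 : w τ =ᶠ[𝓝 s] fun _ => w τ (-1 / 2) := by
          filter_upwards [h5] with r hr
          exact h.eq_of_notMem hτ hC left_mem_J (Ioo_subset_Icc_self hr)
        rw [h6.deriv_eq]
        simp
    · rw [indicator_of_notMem hτ]
      have hJ : {s | s ∈ J ∧ (τ, s) ∈ dynTime a b} = ∅ := by
        ext s; exact ⟨fun hs => hτ hs.2.1, fun hs => hs.elim⟩
      simp [indicator, hJ]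
  rw [derivPairing, h3, h4, h1.tsum_eq]
  simp only [ord]
  abel

end HasDensity

/-! ### Every function of s𝔹𝕍 has a density -/

theorem aestronglyMeasurable_restrict_baseMeasure {ν : Measure ℝ} {C : Set ℝ} [Countable C]
    {E : Type*} [NormedAddCommGroup E] {F : ℝ × ℝ → E} {S : Set (ℝ × ℝ)} (hS : MeasurableSet S)
    (h1 : AEStronglyMeasurable (fun t => F (t, -1 / 2)) (ν.restrict {t | (t, -1 / 2) ∈ S}))
    (h2 : ∀ τ ∈ C, AEStronglyMeasurable (fun s => F (τ, s))
      (volume.restrict {s | s ∈ J ∧ (τ, s) ∈ S})) :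
    AEStronglyMeasurable F ((baseMeasure ν C).restrict S) := by
  rw [← aestronglyMeasurable_indicator_iff hS, aestronglyMeasurable_baseMeasure]
  rw [← aestronglyMeasurable_indicator_iff (measurableSet_slice_left hS)] at h1
  refine ⟨h1, fun τ hτ => ?_⟩
  have h3 := h2 τ hτ
  rw [← aestronglyMeasurable_indicator_iff (measurableSet_slice_right hS τ)] at h3
  rw [← aestronglyMeasurable_indicator_iff measurableSet_J]
  refine h3.congr (Eventually.of_forall fun s => ?_)
  by_cases h4 : s ∈ J <;> by_cases h5 : (τ, s) ∈ S <;> simp [h4, h5, indicator]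

theorem eVariationOn_le_of_le {E : Type*} [NormedAddCommGroup E] {F : ℝ → E} {M : ℝ → ℝ}
    {s : Set ℝ} (h : ∀ x ∈ s, ∀ y ∈ s, x ≤ y → ‖F y - F x‖ ≤ M y - M x) :
    eVariationOn F s ≤ eVariationOn M s := by
  refine iSup_mono fun p => Finset.sum_le_sum fun i _ => ?_
  rw [edist_dist, edist_dist, dist_eq_norm, Real.dist_eq]
  exact ENNReal.ofReal_le_ofReal
    ((h _ (p.2.2.2 i) _ (p.2.2.2 (i + 1)) (p.2.2.1 (Nat.le_succ i))).trans (le_abs_self _))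

theorem eVariationOn_sub_le {E : Type*} [NormedAddCommGroup E] (F G : ℝ → E) (s : Set ℝ) :
    eVariationOn (fun t => F t - G t) s ≤ eVariationOn F s + eVariationOn G s := by
  refine iSup_le fun p => ?_
  calc _ ≤ ∑ i ∈ Finset.range p.1, (edist (F (p.2.1 (i + 1))) (F (p.2.1 i)) +
        edist (G (p.2.1 (i + 1))) (G (p.2.1 i))) := by
        refine Finset.sum_le_sum fun i _ => ?_
        simp only [edist_eq_enorm_sub]
        rw [sub_sub_sub_comm]
        exact enorm_sub_le
    _ ≤ _ := by
        rw [Finset.sum_add_distrib]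
        exact add_le_add (eVariationOn.sum_le p.2.2.1 p.2.2.2)
          (eVariationOn.sum_le p.2.2.1 p.2.2.2)

/-- The Stieltjes measure on an interval of a bounded continuous monotone function. -/
theorem exists_measure_of_monotoneOn {a b : ℝ} {P : ℝ → ℝ} (hP : MonotoneOn P (Ioo a b))
    (hc : ContinuousOn P (Ioo a b)) {M : ℝ} (hM : ∀ t ∈ Ioo a b, |P t| ≤ M) :
    ∃ ν : Measure ℝ, IsFiniteMeasure ν ∧ NullSingletonClass ν ∧ ν (Ioo a b)ᶜ = 0 ∧
      ∀ x ∈ Ioo a b, ∀ y ∈ Ioo a b, x ≤ y → ν (Ico x y) = ENNReal.ofReal (P y - P x) := by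
  -- A Stieltjes measure needs a monotone function on the whole line. Restriction to the open
  -- interval discards possible atoms of the extension at a and b.
  obtain ⟨g, hg, hPg⟩ := hP.exists_monotone_extension
    (by exact ⟨-M, by rintro _ ⟨t, ht, rfl⟩; exact (abs_le.1 (hM t ht)).1⟩)
    (by exact ⟨M, by rintro _ ⟨t, ht, rfl⟩; exact (abs_le.1 (hM t ht)).2⟩)
  set G := hg.stieltjesFunction
  have hgc (t : ℝ) (ht : t ∈ Ioo a b) : ContinuousAt g t := by
    refine (hc.continuousAt (isOpen_Ioo.mem_nhds ht)).congr ?_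
    filter_upwards [isOpen_Ioo.mem_nhds ht] with r hr using hPg hr
  have hG (t : ℝ) (ht : t ∈ Ioo a b) : G t = P t := by
    rw [hPg ht]
    exact rightLim_eq_of_tendsto ((hgc t ht).mono_left nhdsWithin_le_nhds)
  have hGl (t : ℝ) (ht : t ∈ Ioo a b) : Function.leftLim G t = P t := by
    refine leftLim_eq_of_tendsto ?_
    refine Tendsto.congr' ?_ ((hc.continuousAt (isOpen_Ioo.mem_nhds ht)).mono_left
      nhdsWithin_le_nhds)
    filter_upwards [nhdsWithin_le_nhds (isOpen_Ioo.mem_nhds ht)] with r hr using (hG r hr).symm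
  refine ⟨G.measure.restrict (Ioo a b), ?_, ?_, ?_, ?_⟩
  · refine ⟨?_⟩
    rw [Measure.restrict_apply_univ]
    exact (measure_mono Ioo_subset_Icc_self).trans_lt isCompact_Icc.measure_lt_top
  · refine ⟨fun x => ?_⟩
    by_cases hx : x ∈ Ioo a b
    · refine measure_mono_null (t := {x}) subset_rfl ?_
      refine le_antisymm ((Measure.restrict_apply_le _ _).trans ?_) zero_le
      rw [StieltjesFunction.measure_singleton, hG x hx, hGl x hx]
      simp
    · rw [Measure.restrict_apply (measurableSet_singleton x), singleton_inter_eq_empty.2 hx,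
        measure_empty]
  · rw [Measure.restrict_apply measurableSet_Ioo.compl]; simp
  · intro x hx y hy hxy
    rw [Measure.restrict_apply measurableSet_Ico, inter_eq_left.2
      (show Ico x y ⊆ Ioo a b from fun r hr => ⟨hx.1.trans_le hr.1, hr.2.trans hy.2⟩),
      StieltjesFunction.measure_Ico, hGl x hx, hGl y hy]

/-- A continuous function of bounded variation is an indefinite integral with respect to a finite
atomless measure. -/
theorem exists_density_of_boundedVariationOn {a b : ℝ} (hab : a < b) {F : ℝ → ℝ}
    (hF : BoundedVariationOn F (Ioo a b)) (hc : ContinuousOn F (Ioo a b)) :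
    ∃ (ν : Measure ℝ) (k : ℝ → ℝ), IsFiniteMeasure ν ∧ NullSingletonClass ν ∧ Integrable k ν ∧
      (∀ x ∈ Ioo a b, ∀ y ∈ Ioo a b, x ≤ y → F y - F x = ∫ r in Ico x y, k r ∂ν) ∧
      ∫⁻ t, ‖k t‖ₑ ∂ν ≤ eVariationOn F (Ioo a b) := by
  have hm : (a + b) / 2 ∈ Ioo a b := ⟨by linarith, by linarith⟩
  set m := (a + b) / 2
  set v := (eVariationOn F (Ioo a b)).toReal
  set V := variationOnFromTo F (Ioo a b) m
  have hLV := hF.locallyBoundedVariationOn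
  have hV (t : ℝ) : |V t| ≤ v := variationOnFromTo.abs_le_eVariationOn hF
  have hFb {t : ℝ} (ht : t ∈ Ioo a b) : |F t| ≤ |F m| + v := by
    have := hF.dist_le ht hm
    rw [Real.dist_eq] at this
    have h2 := abs_sub_abs_le_abs_sub (F t) (F m)
    linarith
  have hVc : ContinuousOn V (Ioo a b) := by
    intro t ht
    refine ContinuousAt.continuousWithinAt ?_
    have hFt := hc.continuousAt (isOpen_Ioo.mem_nhds ht)
    rw [continuousAt_iff_continuous_left'_right']
    constructor
    · have := variationOnFromTo.tendsto_left hm ht hLV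
        (hFt.mono_left (nhdsWithin_le_nhds (s := Ioo a b ∩ Iio t)))
      rwa [dist_self, sub_zero, nhdsWithin_inter_of_mem (nhdsWithin_le_nhds
        (isOpen_Ioo.mem_nhds ht))] at this
    · have := variationOnFromTo.tendsto_right hm ht hLV
        (hFt.mono_left (nhdsWithin_le_nhds (s := Ioo a b ∩ Ioi t)))
      rwa [dist_self, add_zero, nhdsWithin_inter_of_mem (nhdsWithin_le_nhds
        (isOpen_Ioo.mem_nhds ht))] at this
  have hP := variationOnFromTo.add_self_monotoneOn hLV hm
  have hQ := variationOnFromTo.sub_self_monotoneOn hLV hm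
  -- The positive and negative variations (V ± F)/2 are continuous, since V is continuous where F
  -- is. Their sum is V, so ν₁ + ν₂ has total mass at most the variation of F, and the final bound
  -- needs no constant.
  obtain ⟨ν₁, hν₁, hn₁, hs₁, hI₁⟩ := exists_measure_of_monotoneOn (a := a) (b := b)
    (P := fun t => (V t + F t) / 2) (M := v + |F m| + v)
    (fun x hx y hy hxy => by have := hP hx hy hxy; simp only [Pi.add_apply] at this; linarith)
    ((hVc.add hc).div_const 2) (fun t ht => by
      have := abs_le.1 (hV t); have := abs_le.1 (hFb ht)
      rw [abs_le]; constructor <;> linarith [abs_nonneg (F m)])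
  obtain ⟨ν₂, hν₂, hn₂, hs₂, hI₂⟩ := exists_measure_of_monotoneOn (a := a) (b := b)
    (P := fun t => (V t - F t) / 2) (M := v + |F m| + v)
    (fun x hx y hy hxy => by have := hQ hx hy hxy; simp only [Pi.sub_apply] at this; linarith)
    ((hVc.sub hc).div_const 2) (fun t ht => by
      have := abs_le.1 (hV t); have := abs_le.1 (hFb ht)
      rw [abs_le]; constructor <;> linarith [abs_nonneg (F m)])
  have hac₁ : ν₁ ≪ ν₁ + ν₂ := Measure.AbsolutelyContinuous.add_right (Measure.AbsolutelyContinuous.refl _) _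
  have hac₂ : ν₂ ≪ ν₁ + ν₂ := by
    rw [add_comm]
    exact Measure.AbsolutelyContinuous.add_right (Measure.AbsolutelyContinuous.refl _) _
  have hi₁ : Integrable (fun t => (ν₁.rnDeriv (ν₁ + ν₂) t).toReal) (ν₁ + ν₂) :=
    Measure.integrable_toReal_rnDeriv
  have hi₂ : Integrable (fun t => (ν₂.rnDeriv (ν₁ + ν₂) t).toReal) (ν₁ + ν₂) :=
    Measure.integrable_toReal_rnDeriv
  have hmono {x y : ℝ} (hx : x ∈ Ioo a b) (hy : y ∈ Ioo a b) (hxy : x ≤ y) :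
      0 ≤ (V y + F y) / 2 - (V x + F x) / 2 ∧ 0 ≤ (V y - F y) / 2 - (V x - F x) / 2 := by
    have h1 := hP hx hy hxy
    have h2 := hQ hx hy hxy
    simp only [Pi.add_apply, Pi.sub_apply] at h1 h2
    constructor <;> linarith
  refine ⟨ν₁ + ν₂, fun t => (ν₁.rnDeriv (ν₁ + ν₂) t).toReal - (ν₂.rnDeriv (ν₁ + ν₂) t).toReal,
    inferInstance, ⟨fun x => by simp⟩, hi₁.sub hi₂, ?_, ?_⟩
  · intro x hx y hy hxy
    rw [integral_sub hi₁.integrableOn hi₂.integrableOn, Measure.setIntegral_toReal_rnDeriv hac₁,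
      Measure.setIntegral_toReal_rnDeriv hac₂, Measure.real, Measure.real, hI₁ x hx y hy hxy,
      hI₂ x hx y hy hxy, ENNReal.toReal_ofReal (hmono hx hy hxy).1,
      ENNReal.toReal_ofReal (hmono hx hy hxy).2]
    ring
  · calc ∫⁻ t, ‖(ν₁.rnDeriv (ν₁ + ν₂) t).toReal - (ν₂.rnDeriv (ν₁ + ν₂) t).toReal‖ₑ ∂(ν₁ + ν₂)
        ≤ ∫⁻ t, (ν₁.rnDeriv (ν₁ + ν₂) t + ν₂.rnDeriv (ν₁ + ν₂) t) ∂(ν₁ + ν₂) := by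
          refine lintegral_mono fun t => enorm_sub_le.trans (add_le_add ?_ ?_)
          · rw [Real.enorm_eq_ofReal ENNReal.toReal_nonneg]; exact ENNReal.ofReal_toReal_le
          · rw [Real.enorm_eq_ofReal ENNReal.toReal_nonneg]; exact ENNReal.ofReal_toReal_le
      _ = ν₁ univ + ν₂ univ := by
          rw [lintegral_add_left (Measure.measurable_rnDeriv _ _), Measure.lintegral_rnDeriv hac₁,
            Measure.lintegral_rnDeriv hac₂]
      _ = (ν₁ + ν₂) (Ioo a b) := by
          have h1 : ν₁ univ = ν₁ (Ioo a b) := by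
            rw [← measure_add_measure_compl (measurableSet_Ioo (a := a) (b := b)), hs₁, add_zero]
          have h2 : ν₂ univ = ν₂ (Ioo a b) := by
            rw [← measure_add_measure_compl (measurableSet_Ioo (a := a) (b := b)), hs₂, add_zero]
          rw [h1, h2]; rfl
      _ ≤ eVariationOn F (Ioo a b) := by
          -- The measures are known on half-open intervals with end points inside (a, b); the whole
          -- interval is an increasing union of such.
          obtain ⟨u, hu, hua, hul⟩ := exists_seq_strictAnti_tendsto' hm.1
          obtain ⟨z, hz, hzb, hzl⟩ := exists_seq_strictMono_tendsto' hm.2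
          have hU : Ioo a b = ⋃ n, Ico (u n) (z n) := by
            ext x
            simp only [mem_iUnion]
            constructor
            · intro hx
              obtain ⟨n, h1, h2⟩ := ((hul.eventually (Iio_mem_nhds hx.1)).and
                (hzl.eventually (Ioi_mem_nhds hx.2))).exists
              exact ⟨n, le_of_lt h1, h2⟩
            · rintro ⟨n, hn⟩
              exact ⟨(hua n).1.trans_le hn.1, hn.2.trans (hzb n).2⟩
          have hmon : Monotone fun n => Ico (u n) (z n) := fun i j hij =>
            Ico_subset_Ico (hu.antitone hij) (hz.monotone hij)
          rw [hU, hmon.measure_iUnion]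
          refine iSup_le fun n => ?_
          have hun : u n ∈ Ioo a b := ⟨(hua n).1, (hua n).2.trans hm.2⟩
          have hzn : z n ∈ Ioo a b := ⟨hm.1.trans (hzb n).1, (hzb n).2⟩
          have huz : u n ≤ z n := (hua n).2.le.trans (hzb n).1.le
          rw [Measure.add_apply, hI₁ _ hun _ hzn huz, hI₂ _ hun _ hzn huz,
            ← ENNReal.ofReal_add (hmono hun hzn huz).1 (hmono hun hzn huz).2]
          have : (V (z n) + F (z n)) / 2 - (V (u n) + F (u n)) / 2 +
              ((V (z n) - F (z n)) / 2 - (V (u n) - F (u n)) / 2) =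
              variationOnFromTo F (Ioo a b) (u n) (z n) := by
            rw [← variationOnFromTo.sub_right hLV hm hzn hun]
            ring
          rw [this, ← hU, variationOnFromTo.eq_of_le _ _ huz]
          exact ENNReal.ofReal_toReal_le.trans (eVariationOn.mono _ inter_subset_left)

/-- Write f as a difference of monotone functions whose increments add up to the variation. The
integral of the derivative of a monotone function is at most its increment. -/
theorem lintegral_enorm_deriv_le {f : ℝ → ℝ} {a b : ℝ} (hab : a ≤ b)
    (hf : BoundedVariationOn f (Icc a b)) :
    ∫⁻ s in Icc a b, ‖deriv f s‖ₑ ≤ eVariationOn f (Icc a b) := by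
  obtain ⟨p, q, hp, hq, hpq, hvar⟩ := hf.locallyBoundedVariationOn.exists_monotoneOn_sub_monotoneOn'
  have hvar' := hvar a (left_mem_Icc.2 hab) b (right_mem_Icc.2 hab)
  rw [variationOnFromTo.eq_of_le _ _ hab, inter_self] at hvar'
  have hu : uIcc a b = Icc a b := uIcc_of_le hab
  have hip := (hu ▸ hp : MonotoneOn p (uIcc a b)).intervalIntegrable_deriv
  have hiq := (hu ▸ hq : MonotoneOn q (uIcc a b)).intervalIntegrable_deriv
  have h1 := (hu ▸ hp : MonotoneOn p (uIcc a b)).intervalIntegral_deriv_mem_uIcc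
  have h2 := (hu ▸ hq : MonotoneOn q (uIcc a b)).intervalIntegral_deriv_mem_uIcc
  rw [uIcc_of_le (sub_nonneg.2 (hp (left_mem_Icc.2 hab) (right_mem_Icc.2 hab) hab))] at h1
  rw [uIcc_of_le (sub_nonneg.2 (hq (left_mem_Icc.2 hab) (right_mem_Icc.2 hab) hab))] at h2
  have hd {r : ℝ → ℝ} (hr : MonotoneOn r (Icc a b)) : ∀ᵐ x ∂(volume.restrict (Ioo a b)),
      DifferentiableAt ℝ r x ∧ 0 ≤ deriv r x := by
    rw [ae_restrict_iff' measurableSet_Ioo]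
    filter_upwards [hr.ae_differentiableWithinAt_of_mem] with x hx hx'
    have hn : Icc a b ∈ 𝓝 x := Icc_mem_nhds hx'.1 hx'.2
    refine ⟨(hx (Ioo_subset_Icc_self hx')).differentiableAt hn, ?_⟩
    rw [← derivWithin_of_mem_nhds hn]
    exact hr.derivWithin_nonneg
  have hfin : ∫⁻ s in Icc a b, ‖deriv f s‖ₑ ≤
      ENNReal.ofReal (∫ s in Ioo a b, (deriv p s + deriv q s)) := by
    rw [setLIntegral_congr Ioo_ae_eq_Icc.symm, ofReal_integral_eq_lintegral_ofReal]
    · refine lintegral_mono_ae ?_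
      filter_upwards [hd hp, hd hq] with x hx hy
      rw [Real.enorm_eq_ofReal_abs, hpq, deriv_sub hx.1 hy.1]
      refine ENNReal.ofReal_le_ofReal ((abs_sub _ _).trans ?_)
      rw [abs_of_nonneg hx.2, abs_of_nonneg hy.2]
    · rw [intervalIntegrable_iff_integrableOn_Ioo_of_le hab] at hip hiq
      exact hip.add hiq
    · filter_upwards [hd hp, hd hq] with x hx hy using add_nonneg hx.2 hy.2
  refine hfin.trans ?_
  have h3 : ∫ s in Ioo a b, (deriv p s + deriv q s) = (∫ s in a..b, deriv p s) + ∫ s in a..b, deriv q s := by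
    rw [intervalIntegral.integral_of_le hab, intervalIntegral.integral_of_le hab,
      integral_Ioc_eq_integral_Ioo, integral_Ioc_eq_integral_Ioo]
    rw [intervalIntegrable_iff_integrableOn_Ioo_of_le hab] at hip hiq
    exact integral_add hip hiq
  rw [h3]
  refine le_trans (ENNReal.ofReal_le_ofReal ?_) ENNReal.ofReal_toReal_le
  rw [← hvar']
  linarith [h1.2, h2.2]

theorem enorm_jump_le {E : Type*} [NormedAddCommGroup E] (w : DynFun E) (τ : ℝ) :
    ‖jump w τ‖ₑ ≤ varJ w τ := by
  rw [jump, ← edist_eq_enorm_sub]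
  exact eVariationOn.edist_le _ right_mem_J left_mem_J

section Real

variable {a b : ℝ} {w : DynFun ℝ}

theorem tendsto_ord_left {E : Type*} [NormedAddCommGroup E] {w : DynFun E} {t : ℝ} {c : E}
    (h : HasLeftLimit w t c) {s : ℝ} (hs : s ∈ J) : Tendsto (fun r => w r s) (𝓝[<] t) (𝓝 c) := by
  rw [Metric.tendsto_nhds]
  intro ε hε
  obtain ⟨η, hη, h1⟩ := h (ε / 2) (half_pos hε)
  filter_upwards [Ioo_mem_nhdsLT (show t - η < t by linarith)] with r hr
  rw [dist_eq_norm]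
  exact (h1 r hr s hs).trans_lt (half_lt_self hε)

theorem tendsto_ord_right {E : Type*} [NormedAddCommGroup E] {w : DynFun E} {t : ℝ} {c : E}
    (h : HasRightLimit w t c) {s : ℝ} (hs : s ∈ J) : Tendsto (fun r => w r s) (𝓝[>] t) (𝓝 c) := by
  rw [Metric.tendsto_nhds]
  intro ε hε
  obtain ⟨η, hη, h1⟩ := h (ε / 2) (half_pos hε)
  filter_upwards [Ioo_mem_nhdsGT (show t < t + η by linarith)] with r hr
  rw [dist_eq_norm]
  exact (h1 r hr s hs).trans_lt (half_lt_self hε)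

namespace MemSBV

theorem summable_norm_jump {E : Type*} [NormedAddCommGroup E] {w : DynFun E}
    (h : MemSBV a b w) : Summable ((Ioo a b).indicator fun τ => ‖jump w τ‖) := by
  rw [← summable_subtype_iff_indicator]
  refine Summable.of_nonneg_of_le (f := fun τ : Ioo a b => (varJ w τ).toReal)
    (fun τ => norm_nonneg _) (fun τ => ?_) (ENNReal.summable_toReal h.2.2)
  rw [← ENNReal.ofReal_le_iff_le_toReal (ENNReal.ne_top_of_tsum_ne_top h.2.2 τ)]
  exact (ofReal_norm _).trans_le (enorm_jump_le w τ)

theorem summable_jump {E : Type*} [NormedAddCommGroup E] [CompleteSpace E] {w : DynFun E}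
    (h : MemSBV a b w) {S : Set ℝ} (hS : S ⊆ Ioo a b) :
    Summable (S.indicator (jump w)) := by
  refine Summable.of_norm (h.summable_norm_jump.of_nonneg_of_le (fun _ => norm_nonneg _)
    fun τ => ?_)
  rw [norm_indicator_eq_indicator_norm]
  exact indicator_le_indicator_of_subset hS (fun _ => norm_nonneg _) τ

theorem contPart_sub (h : MemSBV a b w) {t t' : ℝ} (ht : t ∈ Ioo a b)
    (ht' : t' ∈ Ioo a b) (htt : t ≤ t') :
    contPart a w t' - contPart a w t =
      ord w t' - ord w t - ∑' τ, (Ico t t').indicator (jump w) τ := by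
  have h1 : ∀ τ, (Ioo a t').indicator (jump w) τ =
      (Ioo a t).indicator (jump w) τ + (Ico t t').indicator (jump w) τ := by
    intro τ
    rw [← Ioo_union_Ico_eq_Ioo ht.1 htt, indicator_union_of_disjoint]
    rw [Set.disjoint_left]
    exact fun x hx hx' => absurd hx.2 hx'.1.not_gt
  rw [contPart_eq, contPart_eq, tsum_congr h1, Summable.tsum_add
    (h.summable_jump (Ioo_subset_Ioo_right ht.2.le))
    (h.summable_jump fun x hx => ⟨ht.1.trans_le hx.1, hx.2.trans ht'.2⟩)]
  ring

/-- Dominated convergence, with the summable norms of the jumps as majorant: it suffices that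
membership of each single time is eventually decided. -/
theorem tendsto_tsum_jump (h : MemSBV a b w) {S : ℝ → Set ℝ} {T : Set ℝ} {l : Filter ℝ}
    (hS : ∀ᶠ r in l, S r ⊆ Ioo a b) (hT : ∀ τ, ∀ᶠ r in l, τ ∈ S r ↔ τ ∈ T) :
    Tendsto (fun r => ∑' τ, (S r).indicator (jump w) τ) l (𝓝 (∑' τ, T.indicator (jump w) τ)) := by
  refine tendsto_tsum_of_dominated_convergence h.summable_norm_jump (fun τ => ?_) ?_
  · refine tendsto_const_nhds.congr' ?_
    filter_upwards [hT τ] with r hr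
    by_cases h1 : τ ∈ T
    · rw [indicator_of_mem h1, indicator_of_mem (hr.2 h1)]
    · rw [indicator_of_notMem h1, indicator_of_notMem (fun h2 => h1 (hr.1 h2))]
  · filter_upwards [hS] with r hr τ
    rw [norm_indicator_eq_indicator_norm]
    exact indicator_le_indicator_of_subset hr (fun _ => norm_nonneg _) τ

/-- From the left, the sum tends to the sum over times before t and w tends to its value at s =
-1/2. From the right, the jump at t enters both the limit of w and the sum, and cancels. -/
theorem continuousOn_contPart (h : MemSBV a b w) : ContinuousOn (contPart a w) (Ioo a b) := by
  intro t ht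
  refine ContinuousAt.continuousWithinAt ?_
  obtain ⟨-, hl, hr⟩ := h.1.2.2 t ht
  have hF : contPart a w = fun t => ord w t - ∑' τ, (Ioo a t).indicator (jump w) τ :=
    funext (contPart_eq a w)
  rw [continuousAt_iff_continuous_left'_right']
  constructor
  · rw [ContinuousWithinAt, hF]
    refine (tendsto_ord_left hl left_mem_J).sub (h.tendsto_tsum_jump ?_ fun τ => ?_)
    · filter_upwards [self_mem_nhdsWithin] with r hr
      exact Ioo_subset_Ioo_right (le_of_lt ((show r < t from hr).trans ht.2))
    · by_cases h1 : τ < t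
      · filter_upwards [Ioo_mem_nhdsLT h1] with r hr
        simp [hr.1, h1]
      · filter_upwards [self_mem_nhdsWithin] with r hr
        have : ¬ τ < r := fun h2 => h1 (h2.trans hr)
        simp [h1, this]
  · rw [ContinuousWithinAt, hF]
    have h1 : ord w t - ∑' τ, (Ioo a t).indicator (jump w) τ =
        w t (1 / 2) - ∑' τ, (Ioc a t).indicator (jump w) τ := by
      have h2 : ∀ τ, (Ioc a t).indicator (jump w) τ = (Ioo a t).indicator (jump w) τ +
          ({t} : Set ℝ).indicator (jump w) τ := by
        intro τ
        rw [← Ioo_union_right ht.1, indicator_union_of_disjoint (by simp)]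
      rw [tsum_congr h2, Summable.tsum_add (h.summable_jump (Ioo_subset_Ioo_right ht.2.le))
        (h.summable_jump (singleton_subset_iff.2 ht)), tsum_eq_single (f := ({t} : Set ℝ).indicator (jump w)) t
          (fun τ hτ => indicator_of_notMem (show τ ∉ ({t} : Set ℝ) from hτ) _),
        indicator_of_mem (mem_singleton t), jump, ord]
      ring
    show Tendsto _ _ (𝓝 (ord w t - ∑' τ, (Ioo a t).indicator (jump w) τ))
    rw [h1]
    refine (tendsto_ord_right hr left_mem_J).sub (h.tendsto_tsum_jump ?_ fun τ => ?_)
    · filter_upwards [Ioo_mem_nhdsGT ht.2] with r hr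
      exact Ioo_subset_Ioo_right hr.2.le
    · by_cases h1 : τ ≤ t
      · filter_upwards [self_mem_nhdsWithin] with r hr
        have : τ < r := h1.trans_lt hr
        simp [h1, this]
      · filter_upwards [Ioo_mem_nhdsGT (not_le.1 h1)] with r hr
        simp [h1, hr.2.le]

/-- The increments of the jump sum are dominated by those of M, the sum of the norms of the jumps,
which is monotone and bounded. -/
theorem boundedVariationOn_contPart (h : MemSBV a b w) :
    BoundedVariationOn (contPart a w) (Ioo a b) := by
  set M : ℝ → ℝ := fun t => ∑' τ, (Ioo a t).indicator (fun τ => ‖jump w τ‖) τ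
  have hs {S : Set ℝ} (hS : S ⊆ Ioo a b) : Summable (S.indicator fun τ => ‖jump w τ‖) := by
    simpa only [norm_indicator_eq_indicator_norm] using (h.summable_jump hS).norm
  have hMmono : MonotoneOn M (Ioo a b) := fun x hx y hy hxy =>
    Summable.tsum_le_tsum (fun τ => indicator_le_indicator_of_subset (Ioo_subset_Ioo_right hxy)
      (fun _ => norm_nonneg _) τ) (hs (Ioo_subset_Ioo_right hx.2.le))
      (hs (Ioo_subset_Ioo_right hy.2.le))
  have hM0 : ∀ t, 0 ≤ M t := fun t => tsum_nonneg fun τ => indicator_nonneg (fun _ _ => norm_nonneg _) τ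
  have hMb : ∀ t ∈ Ioo a b, M t ≤ ∑' τ, (Ioo a b).indicator (fun τ => ‖jump w τ‖) τ := fun t ht =>
    Summable.tsum_le_tsum (fun τ => indicator_le_indicator_of_subset
      (Ioo_subset_Ioo_right ht.2.le) (fun _ => norm_nonneg _) τ)
      (hs (Ioo_subset_Ioo_right ht.2.le)) (hs subset_rfl)
  have hMv : eVariationOn M (Ioo a b) ≠ ∞ := by
    set B := ∑' τ, (Ioo a b).indicator (fun τ => ‖jump w τ‖) τ
    refine ne_top_of_le_ne_top (ENNReal.ofReal_ne_top (r := B)) (iSup_le fun p => ?_)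
    have hm : MonotoneOn M (Icc (p.2.1 0) (p.2.1 p.1)) := hMmono.mono fun x hx =>
      ⟨(p.2.2.2 0).1.trans_le hx.1, hx.2.trans_lt (p.2.2.2 p.1).2⟩
    have := hm.eVariationOn_eq (left_mem_Icc.2 (p.2.2.1 (Nat.zero_le _)))
      (right_mem_Icc.2 (p.2.2.1 (Nat.zero_le _)))
    rw [inter_self] at this
    refine (eVariationOn.sum_le_of_monotoneOn_Iic (s := Icc (p.2.1 0) (p.2.1 p.1))
      (p.2.2.1.monotoneOn _) fun i hi => ⟨p.2.2.1 (Nat.zero_le _), p.2.2.1 hi⟩).trans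
      (this.trans_le (ENNReal.ofReal_le_ofReal ?_))
    linarith [hMb _ (p.2.2.2 p.1), hM0 (p.2.1 0)]
  have h1 := eVariationOn_sub_le (ord w) (fun t => ∑' τ, (Ioo a t).indicator (jump w) τ) (Ioo a b)
  rw [← funext (contPart_eq a w)] at h1
  refine ne_top_of_le_ne_top (ENNReal.add_ne_top.2 ⟨h.2.1, ne_top_of_le_ne_top hMv ?_⟩) h1
  refine eVariationOn_le_of_le fun x hx y hy hxy => ?_
  have hsub : ∀ {E : Type} [NormedAddCommGroup E] (f : ℝ → E) (τ : ℝ), (Ioo a y).indicator f τ -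
      (Ioo a x).indicator f τ = (Ico x y).indicator f τ := by
    intro E _ f τ
    rw [← Ioo_union_Ico_eq_Ioo hx.1 hxy, indicator_union_of_disjoint]
    · simp
    · rw [Set.disjoint_left]
      exact fun z hz hz' => absurd hz.2 hz'.1.not_gt
  have hx1 : Ioo a x ⊆ Ioo a b := Ioo_subset_Ioo_right hx.2.le
  have hy1 : Ioo a y ⊆ Ioo a b := Ioo_subset_Ioo_right hy.2.le
  have hxy1 : Ico x y ⊆ Ioo a b := fun z hz => ⟨hx.1.trans_le hz.1, hz.2.trans hy.2⟩
  have e1 : ∑' τ, (Ioo a y).indicator (jump w) τ - ∑' τ, (Ioo a x).indicator (jump w) τ =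
      ∑' τ, (Ico x y).indicator (jump w) τ := by
    rw [← (h.summable_jump hy1).tsum_sub (h.summable_jump hx1)]
    exact tsum_congr (hsub _)
  have e2 : M y - M x = ∑' τ, (Ico x y).indicator (fun τ => ‖jump w τ‖) τ := by
    rw [← (hs hy1).tsum_sub (hs hx1)]
    exact tsum_congr (hsub _)
  rw [e1, e2]
  refine (norm_tsum_le_tsum_norm (h.summable_jump hxy1).norm).trans_eq (tsum_congr fun τ => ?_)
  rw [norm_indicator_eq_indicator_norm]

end MemSBV

end Real

variable {a b : ℝ} {w : DynFun ℝ}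

theorem toLex_left_le {t s : ℝ} (hs : s ∈ J) : toLex (t, (-1 / 2 : ℝ)) ≤ toLex (t, s) := by
  rw [Prod.Lex.toLex_le_toLex]
  exact Or.inr ⟨rfl, hs.1⟩

/-- To have a density, it suffices to be the indefinite integral of it within each time and between
the initial points of any two times. -/
theorem HasDensity.of_left {E : Type*} [NormedAddCommGroup E] [NormedSpace ℝ E]
    {μ : Measure (ℝ × ℝ)} {θ : ℝ × ℝ → E} {w : DynFun E} (hθ : IntegrableOn θ (dynTime a b) μ)
    (h1 : ∀ t ∈ Ioo a b, ∀ s ∈ J, w t s - w t (-1 / 2) = ∫ r in seg (t, -1 / 2) (t, s), θ r ∂μ)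
    (h2 : ∀ t ∈ Ioo a b, ∀ t' ∈ Ioo a b, t ≤ t' →
      ord w t' - ord w t = ∫ r in seg (t, -1 / 2) (t', -1 / 2), θ r ∂μ) :
    HasDensity a b μ θ w := by
  refine ⟨hθ, fun p hp q hq hpq => ?_⟩
  obtain ⟨t, s⟩ := p
  obtain ⟨t', s'⟩ := q
  have htt : t ≤ t' := by
    rw [Prod.Lex.toLex_le_toLex] at hpq
    rcases hpq with h | h
    exacts [h.le, h.1.le]
  have hp0 : (t, (-1 / 2 : ℝ)) ∈ dynTime a b := ⟨hp.1, left_mem_J⟩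
  have hq0 : (t', (-1 / 2 : ℝ)) ∈ dynTime a b := ⟨hq.1, left_mem_J⟩
  have e (p q r : ℝ × ℝ) (hp : p ∈ dynTime a b) (hq : q ∈ dynTime a b) (hr : r ∈ dynTime a b)
      (hpq : toLex p ≤ toLex q) (hqr : toLex q ≤ toLex r) :
      ∫ z in seg p r, θ z ∂μ = ∫ z in seg p q, θ z ∂μ + ∫ z in seg q r, θ z ∂μ := by
    rw [seg_union hpq hqr, setIntegral_union (seg_disjoint _ _ _) (measurableSet_seg _ _)
      (hθ.mono_set (seg_subset_dynTime hp hq)) (hθ.mono_set (seg_subset_dynTime hq hr))]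
  have l0 : toLex (t, (-1 / 2 : ℝ)) ≤ toLex (t', (-1 / 2 : ℝ)) := by
    rw [Prod.Lex.toLex_le_toLex]
    rcases htt.lt_or_eq with h | h
    exacts [Or.inl h, Or.inr ⟨h, le_rfl⟩]
  have e1 := e _ _ _ hp0 hp hq (toLex_left_le hp.2) hpq
  have e2 := e _ _ _ hp0 hq0 hq l0 (toLex_left_le hq.2)
  have e3 := h1 t hp.1 s hp.2
  have e4 := h1 t' hq.1 s' hq.2
  have e5 := h2 t hp.1 t' hq.1 htt
  rw [e1, ← e3, ← e4, ← e5] at e2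
  simp only [ord] at e2
  rw [← eq_sub_iff_add_eq'] at e2
  rw [e2]
  abel

/-- The continuous part supplies ν and the density on ordinary times, the derivatives of the
absolutely continuous dynamic values supply it on the fibres. Only countably many dynamic values are
not constant, since their variations are summable. -/
theorem MemSBV.exists_hasDensity (h : MemSBV a b w) (hab : a < b) :
    ∃ (ν : Measure ℝ) (C : Set ℝ) (θ : ℝ × ℝ → ℝ), IsFiniteMeasure ν ∧ NullSingletonClass ν ∧
      C.Countable ∧ HasDensity a b (baseMeasure ν C) θ w ∧
      ∫⁻ p in dynTime a b, ‖θ p‖ₑ ∂(baseMeasure ν C) ≤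
        eVariationOn (contPart a w) (Ioo a b) + ∑' t : Ioo a b, varJ w t := by
  obtain ⟨ν, k, hν, hν', hk, hFk, hkF⟩ := exists_density_of_boundedVariationOn hab
    h.boundedVariationOn_contPart h.continuousOn_contPart
  set C : Set ℝ := {τ | τ ∈ Ioo a b ∧ varJ w τ ≠ 0}
  have hC : C.Countable := by
    have := (Summable.countable_support_ennreal h.2.2).image (Subtype.val : Ioo a b → ℝ)
    exact this.mono fun τ hτ => (mem_image _ _ _).2 ⟨⟨τ, hτ.1⟩, hτ.2, rfl⟩
  have : Countable C := hC
  -- The point s = -1/2 is reserved for the ordinary density; for the derivative on a fibre it is a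
  -- null set.
  set θ : ℝ × ℝ → ℝ := fun p => if p.2 = -1 / 2 then k p.1 else deriv (w p.1) p.2
  have hJ : J = uIcc (-1 / 2 : ℝ) (1 / 2) := (uIcc_of_le (by norm_num)).symm
  have hBV (τ : ℝ) (hτ : τ ∈ Ioo a b) : BoundedVariationOn (w τ) J := by
    rw [hJ]; exact (h.1.2.2 τ hτ).1.boundedVariationOn
  have hae (τ : ℝ) : ∀ᵐ s ∂(volume.restrict J), θ (τ, s) = deriv (w τ) s := by
    have : ∀ᵐ s : ℝ ∂(volume.restrict J), s ≠ -1 / 2 := by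
      rw [ae_iff]; simp
    filter_upwards [this] with s hs
    simp [θ, hs]
  have hd (τ : ℝ) (hτ : τ ∈ Ioo a b) : ∫⁻ s in J, ‖θ (τ, s)‖ₑ ≤ varJ w τ := by
    rw [lintegral_congr_ae ((hae τ).mono fun s hs => by rw [hs])]
    exact lintegral_enorm_deriv_le (by norm_num) (hBV τ hτ)
  have hsl : {t : ℝ | (t, (-1 / 2 : ℝ)) ∈ dynTime a b} = Ioo a b := by
    ext t; simp [dynTime, left_mem_J]
  have hsr (τ : ℝ) (hτ : τ ∈ C) : {s : ℝ | s ∈ J ∧ (τ, s) ∈ dynTime a b} = J := by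
    ext s; simp only [dynTime, mem_prod, mem_ofPred_eq]
    exact ⟨fun h => h.1, fun h => ⟨h, hτ.1, h⟩⟩
  have hle : ∫⁻ p in dynTime a b, ‖θ p‖ₑ ∂(baseMeasure ν C) ≤
        eVariationOn (contPart a w) (Ioo a b) + ∑' t : Ioo a b, varJ w t := by
    rw [setLIntegral_baseMeasure (measurableSet_dynTime a b), hsl]
    refine add_le_add ?_ ?_
    · refine (setLIntegral_le_lintegral _ _).trans ((lintegral_mono fun t => ?_).trans hkF)
      simp [θ]
    · calc ∑' τ : C, ∫⁻ s in {s | s ∈ J ∧ ((τ : ℝ), s) ∈ dynTime a b}, ‖θ (τ, s)‖ₑ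
          ≤ ∑' τ : C, varJ w τ := by
            refine ENNReal.tsum_le_tsum fun τ => ?_
            rw [hsr τ τ.2]
            exact hd τ τ.2.1
        _ ≤ ∑' t : Ioo a b, varJ w t :=
            ENNReal.tsum_mono_subtype _ (show C ⊆ Ioo a b from fun τ hτ => hτ.1)
  have hi : IntegrableOn θ (dynTime a b) (baseMeasure ν C) := by
    refine ⟨aestronglyMeasurable_restrict_baseMeasure (measurableSet_dynTime a b) ?_ ?_, ?_⟩
    · simpa [θ] using hk.aestronglyMeasurable.restrict
    · intro τ hτ
      rw [hsr τ hτ]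
      exact (stronglyMeasurable_deriv (w τ)).aestronglyMeasurable.congr ((hae τ).mono fun s hs => hs.symm)
    · exact hle.trans_lt (ENNReal.add_lt_top.2 ⟨lt_top_iff_ne_top.2 h.boundedVariationOn_contPart,
        lt_top_iff_ne_top.2 h.2.2⟩)
  have hF (τ : ℝ) (hτ : τ ∈ Ioo a b) (s : ℝ) (hs : s ∈ J) :
      w τ s - w τ (-1 / 2) = if τ ∈ C then ∫ r in Ico (-1 / 2) s, θ (τ, r) else 0 := by
    split_ifs with hτC
    · have hac := (h.1.2.2 τ hτ).1.mono (c := -1 / 2) (d := s) (by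
        rw [← hJ, uIcc_of_le hs.1]; exact Icc_subset_Icc_right hs.2)
      rw [← hac.integral_deriv_eq_sub, intervalIntegral.integral_of_le hs.1,
        integral_Ioc_eq_integral_Ioo, integral_Ico_eq_integral_Ioo]
      refine integral_congr_ae (ae_restrict_of_ae_restrict_of_subset
        (show Ioo (-1 / 2) s ⊆ J from fun r hr => ⟨hr.1.le, hr.2.le.trans hs.2⟩)
        ((hae τ).mono fun r hr => hr.symm))
    · have : varJ w τ = 0 := by
        by_contra h0; exact hτC ⟨hτ, h0⟩
      have := eVariationOn.edist_le (w τ) hs left_mem_J |>.trans_eq this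
      rw [sub_eq_zero]
      exact edist_eq_zero.1 (le_antisymm this zero_le)
  refine ⟨ν, C, θ, hν, hν', hC, HasDensity.of_left hi ?_ ?_, hle⟩
  · intro t ht s hs
    rw [setIntegral_seg_right left_mem_J hs (hi.mono_set (seg_subset_dynTime ⟨ht, left_mem_J⟩ ⟨ht, hs⟩))]
    convert hF t ht s hs
  · intro t ht t' ht' htt
    rw [setIntegral_seg_left (hi.mono_set (seg_subset_dynTime ⟨ht, left_mem_J⟩ ⟨ht', left_mem_J⟩))]
    have h1 := h.contPart_sub ht ht' htt
    rw [hFk t ht t' ht' htt] at h1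
    have h2 : ∀ r, θ (r, -1 / 2) = k r := fun r => by simp [θ]
    simp only [h2]
    rw [h1, sub_add_eq_add_sub, eq_sub_iff_add_eq]
    refine congrArg _ (tsum_congr fun τ => ?_)
    refine congrFun (indicator_congr fun τ hτ => ?_) τ
    rw [jump, hF τ ⟨ht.1.trans_le hτ.1, hτ.2.trans ht'.2⟩ _ right_mem_J, J,
      integral_Icc_eq_integral_Ico]
    congr

/-! ### Vector-valued functions and change of base measure -/

section Components

variable {a b : ℝ} {n : ℕ} {w : DynFun (Fin n → ℝ)}

theorem HasRightLimit.apply {τ : ℝ} {c : Fin n → ℝ} (h : HasRightLimit w τ c) (i : Fin n) :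
    HasRightLimit (fun t s => w t s i) τ (c i) := by
  intro ε hε
  obtain ⟨η, hη, h1⟩ := h ε hε
  exact ⟨η, hη, fun t ht s hs => (norm_le_pi_norm (w t s - c) i).trans (h1 t ht s hs)⟩

theorem HasLeftLimit.apply {τ : ℝ} {c : Fin n → ℝ} (h : HasLeftLimit w τ c) (i : Fin n) :
    HasLeftLimit (fun t s => w t s i) τ (c i) := by
  intro ε hε
  obtain ⟨η, hη, h1⟩ := h ε hε
  exact ⟨η, hη, fun t ht s hs => (norm_le_pi_norm (w t s - c) i).trans (h1 t ht s hs)⟩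

theorem absolutelyContinuousOnInterval_comp {X Y : Type*} [PseudoMetricSpace X] [PseudoMetricSpace Y]
    {f : ℝ → X} {F : ℝ → Y} {a b K : ℝ} (hK : 0 ≤ K)
    (hf : AbsolutelyContinuousOnInterval f a b)
    (hF : ∀ x ∈ uIcc a b, ∀ y ∈ uIcc a b, dist (F x) (F y) ≤ K * dist (f x) (f y)) :
    AbsolutelyContinuousOnInterval F a b := by
  rw [absolutelyContinuousOnInterval_iff] at hf ⊢
  intro ε hε
  obtain ⟨δ, hδ, h1⟩ := hf (ε / (K + 1)) (by positivity)
  refine ⟨δ, hδ, fun E hE hE' => ?_⟩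
  have h2 := h1 E hE hE'
  calc ∑ i ∈ Finset.range E.1, dist (F (E.2 i).1) (F (E.2 i).2)
      ≤ ∑ i ∈ Finset.range E.1, K * dist (f (E.2 i).1) (f (E.2 i).2) :=
        Finset.sum_le_sum fun i hi => hF _ (hE.1 i hi).1 _ (hE.1 i hi).2
    _ = K * ∑ i ∈ Finset.range E.1, dist (f (E.2 i).1) (f (E.2 i).2) := by rw [Finset.mul_sum]
    _ ≤ K * (ε / (K + 1)) := by gcongr
    _ < ε := by
        rw [mul_div_assoc', div_lt_iff₀ (by positivity)]
        nlinarith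

theorem eVariationOn_apply_le (F : ℝ → Fin n → ℝ) (S : Set ℝ) (i : Fin n) :
    eVariationOn (fun t => F t i) S ≤ eVariationOn F S :=
  iSup_mono fun _ => Finset.sum_le_sum fun _ _ => edist_le_pi_edist _ _ i

theorem MemSG.apply (h : MemSG a b w) (i : Fin n) : MemSG a b (fun t s => w t s i) := by
  obtain ⟨⟨c, hc⟩, ⟨d, hd⟩, h3⟩ := h
  refine ⟨⟨c i, hc.apply i⟩, ⟨d i, hd.apply i⟩, fun t ht => ?_⟩
  obtain ⟨h4, h5, h6⟩ := h3 t ht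
  exact ⟨absolutelyContinuousOnInterval_comp zero_le_one h4 fun x _ y _ => by
    rw [one_mul]; exact dist_le_pi_dist (w t x) (w t y) i, h5.apply i, h6.apply i⟩

theorem MemSBV.apply (h : MemSBV a b w) (i : Fin n) : MemSBV a b (fun t s => w t s i) :=
  ⟨h.1.apply i, ne_top_of_le_ne_top h.2.1 (eVariationOn_apply_le (ord w) _ i),
    ne_top_of_le_ne_top h.2.2 (ENNReal.tsum_le_tsum fun τ => eVariationOn_apply_le (w τ) _ i)⟩

theorem MemSBV.contPart_apply (h : MemSBV a b w) (i : Fin n) {t : ℝ} (ht : t ∈ Ioo a b) :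
    contPart a (fun t s => w t s i) t = contPart a w t i := by
  rw [contPart_eq, contPart_eq, Pi.sub_apply,
    tsum_apply (h.summable_jump (Ioo_subset_Ioo_right ht.2.le))]
  refine congrArg _ (tsum_congr fun τ => ?_)
  by_cases h1 : τ ∈ Ioo a t
  · rw [indicator_of_mem h1, indicator_of_mem h1]; rfl
  · rw [indicator_of_notMem h1, indicator_of_notMem h1]; rfl

theorem MemSBV.apply_le (h : MemSBV a b w) (i : Fin n) :
    eVariationOn (contPart a (fun t s => w t s i)) (Ioo a b) + ∑' t : Ioo a b, varJ (fun t s => w t s i) t ≤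
      sbvNorm a b w := by
  refine add_le_add ?_ (ENNReal.tsum_le_tsum fun τ => eVariationOn_apply_le (w τ) _ i)
  rw [eVariationOn.eq_of_eqOn (f' := fun t => contPart a w t i) fun t ht => h.contPart_apply i ht]
  exact (eVariationOn_apply_le _ _ i).trans (le_add_left (le_add_left le_rfl))

end Components

section Transport

variable {a b : ℝ} {ν ν' : Measure ℝ} {C C' : Set ℝ} {E : Type*} [NormedAddCommGroup E]
  [NormedSpace ℝ E] {θ : ℝ × ℝ → E} {w : DynFun E}

theorem HasDensity.transport [IsFiniteMeasure ν] [IsFiniteMeasure ν'] [NullSingletonClass ν']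
    (h : HasDensity a b (baseMeasure ν C) θ w) (hν : ν ≪ ν') (hC : C ⊆ C') (hC' : C'.Countable) :
    ∃ θ' : ℝ × ℝ → E, HasDensity a b (baseMeasure ν' C') θ' w ∧ ∀ S, MeasurableSet S →
      ∫⁻ p in S, ‖θ' p‖ₑ ∂(baseMeasure ν' C') = ∫⁻ p in S, ‖θ p‖ₑ ∂(baseMeasure ν C) := by
  obtain ⟨ρ, hρ, he⟩ := exists_baseMeasure_eq_withDensity (ν := ν) (C := C) hν hC hC'
  refine ⟨fun p => ρ p • θ p, (he ▸ h).of_withDensity hρ, fun S hS => ?_⟩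
  rw [he, setLIntegral_withDensity_eq_setLIntegral_mul_non_measurable _ hρ.coe_nnreal_ennreal _ hS
    (Eventually.of_forall fun p => ENNReal.coe_lt_top)]
  refine lintegral_congr fun p => ?_
  rw [Pi.mul_apply]
  show ‖(ρ p : ℝ) • θ p‖ₑ = _
  rw [enorm_smul]
  congr 1
  simp

/-- The densities of the components are moved to the sum of their ordinary measures and the union of
their jump times. The factor n comes from bounding the max-norm of the density by the sum over its
components. -/
theorem MemSBV.exists_hasDensity_pi {n : ℕ} {w : DynFun (Fin n → ℝ)} (h : MemSBV a b w)
    (hab : a < b) :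
    ∃ (ν : Measure ℝ) (C : Set ℝ) (θ : ℝ × ℝ → (Fin n → ℝ)), IsFiniteMeasure ν ∧
      NullSingletonClass ν ∧ C.Countable ∧ HasDensity a b (baseMeasure ν C) θ w ∧
      ∫⁻ p in dynTime a b, ‖θ p‖ₑ ∂(baseMeasure ν C) ≤ n * sbvNorm a b w := by
  choose ν C θ hν hν' hC hθ hle using fun i => (h.apply i).exists_hasDensity hab
  have hCc : (⋃ i, C i).Countable := countable_iUnion hC
  have : NullSingletonClass (∑ i, ν i) := ⟨fun x => by
    rw [Measure.finsetSum_apply]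
    exact Finset.sum_eq_zero fun i _ => measure_singleton x⟩
  have hac (i : Fin n) : ν i ≪ ∑ i, ν i := by
    refine Measure.AbsolutelyContinuous.mk fun s _ hs => ?_
    rw [Measure.finsetSum_apply] at hs
    exact (Finset.sum_eq_zero_iff.1 hs) i (Finset.mem_univ i)
  choose θ' hθ' hle' using fun i => (hθ i).transport (hac i) (subset_iUnion C i) hCc
  refine ⟨∑ i, ν i, ⋃ i, C i, fun p i => θ' i p, inferInstance, this, hCc,
    HasDensity.pi hθ', ?_⟩
  calc ∫⁻ p in dynTime a b, ‖fun i => θ' i p‖ₑ ∂(baseMeasure (∑ i, ν i) (⋃ i, C i))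
      ≤ ∫⁻ p in dynTime a b, ∑ i, ‖θ' i p‖ₑ ∂(baseMeasure (∑ i, ν i) (⋃ i, C i)) := by
        refine lintegral_mono fun p => ?_
        rw [← ofReal_norm]
        refine (ENNReal.ofReal_le_ofReal (q := ∑ i, ‖θ' i p‖) ?_).trans_eq ?_
        · exact (pi_norm_le_iff_of_nonneg (Finset.sum_nonneg fun i _ => norm_nonneg _)).2 fun i =>
            Finset.single_le_sum (f := fun i => ‖θ' i p‖) (fun i _ => norm_nonneg _) (Finset.mem_univ i)
        · rw [ENNReal.ofReal_sum_of_nonneg fun i _ => norm_nonneg _]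
          exact Finset.sum_congr rfl fun i _ => ofReal_norm _
    _ = ∑ i, ∫⁻ p in dynTime a b, ‖θ' i p‖ₑ ∂(baseMeasure (∑ i, ν i) (⋃ i, C i)) :=
        lintegral_finsetSum' _ fun i _ => (hθ' i).integrableOn.aestronglyMeasurable.enorm
    _ ≤ ∑ _i : Fin n, sbvNorm a b w := by
        refine Finset.sum_le_sum fun i _ => ?_
        rw [hle' i _ (measurableSet_dynTime a b)]
        exact (hle i).trans (h.apply_le i)
    _ = n * sbvNorm a b w := by simp

end Transport

/-! ### Measurability of superpositions and of functions with one-sided limits -/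

/-- Measurability of the superposition with a function which is measurable in its parameter and
continuous in its argument, on a general domain. -/
theorem aestronglyMeasurable_superposition {X V W : Type*} [MeasurableSpace X]
    [NormedAddCommGroup V] [MeasurableSpace V] [BorelSpace V] [NormedAddCommGroup W]
    {μ : Measure X} {D : Set (X × V)}
    {F : X → V → W} (hD : ∀ ξ, MeasurableSet {p | (p, ξ) ∈ D}) (hDo : ∀ p, IsOpen {ξ | (p, ξ) ∈ D})
    (h1 : ∀ ξ, AEStronglyMeasurable (fun p => F p ξ) (μ.restrict {p | (p, ξ) ∈ D}))
    (h2 : ∀ᵐ p ∂μ, ContinuousOn (F p) {ξ | (p, ξ) ∈ D}) {x : X → V}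
    (hx : AEStronglyMeasurable x μ) (hxD : ∀ᵐ p ∂μ, (p, x p) ∈ D) :
    AEStronglyMeasurable (fun p => F p (x p)) μ := by
  obtain ⟨y, hy, hxy⟩ := hx
  have hyD : ∀ᵐ p ∂μ, (p, y p) ∈ D := by
    filter_upwards [hxD, hxy] with p hp hp' using hp' ▸ hp
  refine AEStronglyMeasurable.congr (f := fun p => F p (y p)) ?_
    (hxy.mono fun p hp => by simp only [hp])
  -- Approximate the argument by simple functions. The approximants may leave the domain, where
  -- nothing is known of F; there the value is replaced by 0, which pointwise happens only finitely
  -- often because the slices of the domain are open.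
  refine aestronglyMeasurable_of_tendsto_ae atTop
    (f := fun k p => {p | (p, hy.approx k p) ∈ D}.indicator (fun p => F p (hy.approx k p)) p)
    (fun k => ?_) ?_
  · set z := hy.approx k
    have hU : (⋃ ξ : z.range, z ⁻¹' {(ξ : V)}) = univ := by
      ext p
      simp only [mem_iUnion, mem_univ, iff_true]
      exact ⟨⟨z p, SimpleFunc.mem_range_self z p⟩, rfl⟩
    rw [← Measure.restrict_univ (μ := μ), ← hU, aestronglyMeasurable_iUnion_iff]
    intro ξ
    have h3 : AEStronglyMeasurable ({p | (p, (ξ : V)) ∈ D}.indicator (fun p => F p ξ)) μ :=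
      (aestronglyMeasurable_indicator_iff (hD ξ)).2 (h1 ξ)
    refine (h3.mono_measure Measure.restrict_le_self).congr ?_
    refine (ae_restrict_iff' (z.measurableSet_preimage _)).2 (Eventually.of_forall fun p hp => ?_)
    have hp' : z p = ξ := hp
    beta_reduce
    by_cases h4 : (p, (ξ : V)) ∈ D
    · rw [indicator_of_mem (show p ∈ {p | (p, (ξ : V)) ∈ D} from h4),
        indicator_of_mem (show p ∈ {p | (p, z p) ∈ D} from by rw [mem_ofPred_eq, hp']; exact h4), hp']
    · rw [indicator_of_notMem (show p ∉ {p | (p, (ξ : V)) ∈ D} from h4),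
        indicator_of_notMem (show p ∉ {p | (p, z p) ∈ D} from by rw [mem_ofPred_eq, hp']; exact h4)]
  · filter_upwards [h2, hyD] with p hp hpD
    have h3 := hy.tendsto_approx p
    have h4 : ∀ᶠ k in atTop, hy.approx k p ∈ {ξ | (p, ξ) ∈ D} :=
      h3.eventually ((hDo p).mem_nhds hpD)
    refine Tendsto.congr' ?_ (((hp.continuousAt ((hDo p).mem_nhds hpD)).tendsto).comp h3)
    filter_upwards [h4] with k hk
    rw [indicator_of_mem (show p ∈ {p | (p, hy.approx k p) ∈ D} from hk)]
    rfl

section OneSided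

variable {W : Type*} [NormedAddCommGroup W] {A : Set ℝ} {G L : ℝ → W}

/-- The left limit is a pointwise limit of samples of G at grid points, and each sample is a
function of an integer part, hence measurable whatever G is. -/
theorem aestronglyMeasurable_leftLimit (hA : IsOpen A)
    (h : ∀ t ∈ A, Tendsto G (𝓝[<] t) (𝓝 (L t))) (ν : Measure ℝ) :
    AEStronglyMeasurable L (ν.restrict A) := by
  -- Subtracting 1 from the ceiling puts the grid point strictly to the left of t, also when t is
  -- itself on the grid.
  set c : ℕ → ℝ → ℝ := fun k t => ((⌈t * (k + 1)⌉ : ℝ) - 1) / (k + 1)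
  have hc (t : ℝ) : Tendsto (fun k => c k t) atTop (𝓝[<] t) := by
    refine tendsto_nhdsWithin_iff.2 ⟨?_, Eventually.of_forall fun k => ?_⟩
    · have h1 : Tendsto (fun k : ℕ => t - 1 / ((k : ℝ) + 1)) atTop (𝓝 t) := by
        simpa using tendsto_const_nhds.sub (tendsto_one_div_add_atTop_nhds_zero_nat (𝕜 := ℝ))
      refine tendsto_of_tendsto_of_tendsto_of_le_of_le h1 tendsto_const_nhds (fun k => ?_) fun k => ?_
      · have hk : (0 : ℝ) < k + 1 := by positivity
        show t - 1 / ((k : ℝ) + 1) ≤ c k t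
        rw [le_div_iff₀ hk, sub_mul, div_mul_cancel₀ _ hk.ne']
        linarith [Int.le_ceil (t * ((k : ℝ) + 1))]
      · have hk : (0 : ℝ) < k + 1 := by positivity
        show c k t ≤ t
        rw [div_le_iff₀ hk]
        linarith [Int.ceil_lt_add_one (t * ((k : ℝ) + 1))]
    · have hk : (0 : ℝ) < k + 1 := by positivity
      show c k t < t
      rw [div_lt_iff₀ hk]
      linarith [Int.ceil_lt_add_one (t * ((k : ℝ) + 1))]
  refine aestronglyMeasurable_of_tendsto_ae atTop (f := fun k t => A.indicator G (c k t))
    (fun k => ?_) ?_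
  · have h1 : StronglyMeasurable (fun z : ℤ => A.indicator G (((z : ℝ) - 1) / (k + 1))) :=
      StronglyMeasurable.of_discrete
    exact (h1.comp_measurable (Int.measurable_ceil.comp
      (measurable_id.mul_const ((k : ℝ) + 1)))).aestronglyMeasurable
  · refine (ae_restrict_iff' hA.measurableSet).2 (Eventually.of_forall fun t ht => ?_)
    refine Tendsto.congr' ?_ ((h t ht).comp (hc t))
    filter_upwards [(hc t).eventually (nhdsWithin_le_nhds (hA.mem_nhds ht))] with k hk
    rw [indicator_of_mem hk]; rfl

/-- A point t where G is further than ε from L is isolated from the left among such points, since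
just before t both G and L are within ε/2 of L(t). A set of points isolated from the left is
countable. -/
theorem countable_ne_leftLimit (h : ∀ t ∈ A, Tendsto G (𝓝[<] t) (𝓝 (L t))) :
    {t | t ∈ A ∧ G t ≠ L t}.Countable := by
  have hsub : {t | t ∈ A ∧ G t ≠ L t} ⊆
      ⋃ k : ℕ, {t | t ∈ A ∧ 1 / ((k : ℝ) + 1) < dist (G t) (L t)} := by
    intro t ht
    obtain ⟨k, hk⟩ := exists_nat_one_div_lt (dist_pos.2 ht.2)
    exact mem_iUnion.2 ⟨k, ht.1, hk⟩
  refine (countable_iUnion fun k => ?_).mono hsub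
  set ε : ℝ := 1 / ((k : ℝ) + 1)
  have hε : 0 < ε := by positivity
  set S := {t | t ∈ A ∧ ε < dist (G t) (L t)}
  refine (countable_setOfPred_isolated_left_within (s := S)).mono
    (show S ⊆ {t | t ∈ S ∧ 𝓝[S ∩ Iio t] t = ⊥} from fun t ht => ⟨ht, ?_⟩)
  have h1 : ∀ᶠ r in 𝓝[<] t, dist (G r) (L t) < ε / 2 :=
    (h t ht.1).eventually (Metric.ball_mem_nhds _ (half_pos hε))
  obtain ⟨l, hl, h2⟩ := mem_nhdsLT_iff_exists_Ioo_subset.1 h1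
  rw [← empty_mem_iff_bot]
  rw [mem_nhdsWithin]
  refine ⟨Ioi l, isOpen_Ioi, hl, ?_⟩
  rintro r ⟨hr1, hr2, hr3⟩
  have h3 : dist (G r) (L t) < ε / 2 := h2 ⟨hr1, hr3⟩
  have h4 : dist (L r) (L t) ≤ ε / 2 := by
    refine le_of_tendsto ((h r hr2.1).dist tendsto_const_nhds) ?_
    filter_upwards [Ioo_mem_nhdsLT (show l < r from hr1)] with z hz
    exact (h2 ⟨hz.1, hz.2.trans hr3⟩ : dist (G z) (L t) < ε / 2).le
  have h5 := dist_triangle_right (G r) (L r) (L t)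
  exact absurd hr2.2 (by linarith)

theorem aestronglyMeasurable_of_leftLimit (hA : IsOpen A)
    (h : ∀ t ∈ A, ∃ c, Tendsto G (𝓝[<] t) (𝓝 c)) (ν : Measure ℝ) [NullSingletonClass ν] :
    AEStronglyMeasurable G (ν.restrict A) := by
  choose! L hL using h
  refine (aestronglyMeasurable_leftLimit hA hL ν).congr ?_
  refine (ae_restrict_iff' hA.measurableSet).2 ?_
  have := (countable_ne_leftLimit hL).measure_zero ν
  filter_upwards [compl_mem_ae_iff.2 this] with t ht ht'
  by_contra h1
  exact ht ⟨ht', fun h2 => h1 h2.symm⟩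

end OneSided

/-! ### Local bounds and compactness -/

/-- The local condition of `s𝔾` at the time `t`. -/
structure SGAt {E : Type*} [NormedAddCommGroup E] (w : DynFun E) (t : ℝ) : Prop where
  ac : AbsolutelyContinuousOnInterval (w t) (-1 / 2) (1 / 2)
  left : HasLeftLimit w t (w t (-1 / 2))
  right : HasRightLimit w t (w t (1 / 2))

section Bounded

variable {E : Type*} [NormedAddCommGroup E] {w : DynFun E} {t : ℝ}

theorem MemSG.sgAt {a b : ℝ} (h : MemSG a b w) (ht : t ∈ Ioo a b) : SGAt w t :=
  ⟨(h.2.2 t ht).1, (h.2.2 t ht).2.1, (h.2.2 t ht).2.2⟩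

theorem SGAt.continuousOn (h : SGAt w t) : ContinuousOn (w t) J := by
  have := h.ac.continuousOn
  rwa [uIcc_of_le (by norm_num)] at this

theorem exists_bound_near {cl cr : E} (hl : HasLeftLimit w t cl) (hr : HasRightLimit w t cr)
    {M : ℝ} (hM : ∀ s ∈ J, ‖w t s‖ ≤ M) :
    ∃ η > 0, ∃ M', ∀ r ∈ Ioo (t - η) (t + η), ∀ s ∈ J, ‖w r s‖ ≤ M' := by
  obtain ⟨η₁, h₁, hl⟩ := hl 1 one_pos
  obtain ⟨η₂, h₂, hr⟩ := hr 1 one_pos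
  refine ⟨min η₁ η₂, lt_min h₁ h₂, max M (max (‖cl‖ + 1) (‖cr‖ + 1)), fun r hr' s hs => ?_⟩
  have e1 := min_le_left η₁ η₂
  have e2 := min_le_right η₁ η₂
  rcases lt_trichotomy r t with h | rfl | h
  · have := hl r ⟨by linarith [hr'.1], h⟩ s hs
    refine le_max_of_le_right (le_max_of_le_left ?_)
    have h3 := norm_sub_norm_le (w r s) cl
    linarith
  · exact le_max_of_le_left (hM s hs)
  · have := hr r ⟨h, by linarith [hr'.2]⟩ s hs
    refine le_max_of_le_right (le_max_of_le_right ?_)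
    have h3 := norm_sub_norm_le (w r s) cr
    linarith

theorem SGAt.exists_bound_near (h : SGAt w t) :
    ∃ η > 0, ∃ M, ∀ r ∈ Ioo (t - η) (t + η), ∀ s ∈ J, ‖w r s‖ ≤ M := by
  obtain ⟨M, hM⟩ := isCompact_Icc.exists_bound_of_continuousOn h.continuousOn
  exact DynSys.exists_bound_near h.left h.right hM

/-- The graph over a compact interval of a dynamic function in `s𝔾` lies in a compact subset of
any open set which contains it. -/
theorem exists_compact_graph {D : Set (ℝ × E)} [ProperSpace E] (hD : IsOpen D) {α β : ℝ}
    (h : ∀ t ∈ Icc α β, SGAt w t) (hw : ∀ t ∈ Icc α β, ∀ s ∈ J, (t, w t s) ∈ D) :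
    ∃ K ⊆ D, IsCompact K ∧ ∀ t ∈ Icc α β, ∀ s ∈ J, (t, w t s) ∈ K := by
  refine isCompact_Icc.induction_on
    (p := fun S => ∃ K ⊆ D, IsCompact K ∧ ∀ t ∈ S, ∀ s ∈ J, (t, w t s) ∈ K) ?_ ?_ ?_ ?_
  · exact ⟨∅, empty_subset _, isCompact_empty, fun t ht => absurd ht (notMem_empty t)⟩
  · rintro S T hST ⟨K, h1, h2, h3⟩
    exact ⟨K, h1, h2, fun t ht => h3 t (hST ht)⟩
  · rintro S T ⟨K, h1, h2, h3⟩ ⟨K', h1', h2', h3'⟩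
    refine ⟨K ∪ K', union_subset h1 h1', h2.union h2', fun t ht s hs => ?_⟩
    rcases ht with ht | ht
    exacts [Or.inl (h3 t ht s hs), Or.inr (h3' t ht s hs)]
  · intro t ht
    have hK : IsCompact ((fun s => (t, w t s)) '' J) :=
      isCompact_Icc.image_of_continuousOn (continuousOn_const.prodMk (h t ht).continuousOn)
    obtain ⟨δ, hδ, h1⟩ := hK.exists_cthickening_subset_open hD (by
      rintro _ ⟨s, hs, rfl⟩; exact hw t ht s hs)
    obtain ⟨η₁, h₁, hl⟩ := (h t ht).left δ hδ
    obtain ⟨η₂, h₂, hr⟩ := (h t ht).right δ hδ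
    have e1 := min_le_left (min η₁ η₂) δ
    have e2 := min_le_right (min η₁ η₂) δ
    have e3 := min_le_left η₁ η₂
    have e4 := min_le_right η₁ η₂
    set η := min (min η₁ η₂) δ
    have hη : 0 < η := lt_min (lt_min h₁ h₂) hδ
    refine ⟨Ioo (t - η) (t + η), mem_nhdsWithin_of_mem_nhds
      (Ioo_mem_nhds (by linarith) (by linarith)), _, h1, hK.cthickening, fun r hr' s hs => ?_⟩
    have hrt : dist r t ≤ δ := by
      rw [Real.dist_eq, abs_le]; constructor <;> linarith [hr'.1, hr'.2]
    rcases lt_trichotomy r t with h | rfl | h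
    · refine Metric.mem_cthickening_of_dist_le _ (t, w t (-1 / 2)) _ _ (mem_image_of_mem _ left_mem_J) ?_
      rw [Prod.dist_eq]
      refine max_le hrt ?_
      rw [dist_eq_norm]
      exact hl r ⟨by linarith [hr'.1], h⟩ s hs
    · exact Metric.self_subset_cthickening _ (mem_image_of_mem _ hs)
    · refine Metric.mem_cthickening_of_dist_le _ (t, w t (1 / 2)) _ _ (mem_image_of_mem _ right_mem_J) ?_
      rw [Prod.dist_eq]
      refine max_le hrt ?_
      rw [dist_eq_norm]
      exact hr r ⟨h, by linarith [hr'.2]⟩ s hs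

/-- Local bounds give a bound on a compact set. -/
theorem exists_bound_of_local {X : Type*} [TopologicalSpace X] {K : Set X} (hK : IsCompact K)
    {P : X → ℝ → Prop} (hP : ∀ x M M', M ≤ M' → P x M → P x M')
    (h : ∀ x ∈ K, ∃ M, ∀ᶠ y in 𝓝[K] x, P y M) : ∃ M, 0 ≤ M ∧ ∀ x ∈ K, P x M := by
  refine hK.induction_on (p := fun S => ∃ M, 0 ≤ M ∧ ∀ x ∈ S, P x M) ?_ ?_ ?_ ?_
  · exact ⟨0, le_rfl, fun t ht => absurd ht (notMem_empty t)⟩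
  · rintro S T hST ⟨M, h0, h1⟩
    exact ⟨M, h0, fun t ht => h1 t (hST ht)⟩
  · rintro S T ⟨M, h0, h1⟩ ⟨M', h0', h1'⟩
    refine ⟨max M M', le_max_of_le_left h0, fun t ht => ?_⟩
    rcases ht with ht | ht
    exacts [hP _ _ _ (le_max_left _ _) (h1 t ht), hP _ _ _ (le_max_right _ _) (h1' t ht)]
  · intro x hx
    obtain ⟨M, hM⟩ := h x hx
    exact ⟨_, hM, max M 0, le_max_right _ _, fun y hy => hP _ _ _ (le_max_left _ _) hy⟩

end Bounded

section Fields

variable {n : ℕ} {D : Set (ℝ × (Fin n → ℝ))} {g : ℝ → (Fin n → ℝ) → ℝ → (Fin n → Fin n → ℝ)}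

theorem exists_Icc_subset_slice {E : Type*} [PseudoMetricSpace E] {D : Set (ℝ × E)} (hD : IsOpen D)
    {t : ℝ} {ξ : E} (h : (t, ξ) ∈ D) :
    ∃ η > 0, ∀ r ∈ Icc (t - η) (t + η), ∀ ζ, dist ζ ξ ≤ η → (r, ζ) ∈ D := by
  obtain ⟨ε, hε, h1⟩ := Metric.nhds_basis_closedBall.mem_iff.1 (hD.mem_nhds h)
  refine ⟨ε, hε, fun r hr ζ hζ => h1 ?_⟩
  rw [Metric.mem_closedBall, Prod.dist_eq]
  refine max_le ?_ hζ
  rw [Real.dist_eq, abs_le]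
  constructor <;> linarith [hr.1, hr.2]

theorem IsSGInTime.sgAt (hD : IsOpen D) (hg : IsSGInTime D g) {t : ℝ} {ξ : Fin n → ℝ}
    (h : (t, ξ) ∈ D) : SGAt (fun t s => g t ξ s) t := by
  obtain ⟨η, hη, h1⟩ := exists_Icc_subset_slice hD h
  exact (hg ξ (t - η) (t + η) (by linarith) fun r hr => h1 r hr ξ (by simpa using hη.le)).sgAt
    ⟨by linarith, by linarith⟩

/-- For a fixed ξ the one-sided limits bound g(·, ξ) near a time, and the Lipschitz condition
carries the bound over to nearby ξ. Compactness makes it uniform. -/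
theorem IsSGInTime.exists_bound (hD : IsOpen D) (hg : IsSGInTime D g) {Kg : ℝ}
    (hgL : ∀ t x y, (t, x) ∈ D → (t, y) ∈ D → ∀ s ∈ J, ‖g t x s - g t y s‖ ≤ Kg * ‖x - y‖)
    {K : Set (ℝ × (Fin n → ℝ))} (hKD : K ⊆ D) (hK : IsCompact K) :
    ∃ G, 0 ≤ G ∧ ∀ p ∈ K, ∀ s ∈ J, ‖g p.1 p.2 s‖ ≤ G := by
  refine exists_bound_of_local hK (fun x M M' h h' s hs => (h' s hs).trans h) fun p hp => ?_
  obtain ⟨t, ξ⟩ := p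
  obtain ⟨η, hη, h1⟩ := exists_Icc_subset_slice hD (hKD hp)
  obtain ⟨η', hη', M, h2⟩ := (hg.sgAt hD (hKD hp)).exists_bound_near
  refine ⟨M + |Kg| * η, mem_nhdsWithin_of_mem_nhds ?_⟩
  filter_upwards [prod_mem_nhds (Ioo_mem_nhds (show t - min η η' < t by linarith [lt_min hη hη'])
    (show t < t + min η η' by linarith [lt_min hη hη'])) (Metric.ball_mem_nhds ξ hη)] with q hq s hs
  have e1 := min_le_left η η'
  have e2 := min_le_right η η'
  have hq1 : q.1 ∈ Icc (t - η) (t + η) := ⟨by linarith [hq.1.1], by linarith [hq.1.2]⟩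
  have hqξ : dist q.2 ξ ≤ η := (Metric.mem_ball.1 hq.2).le
  have h3 := hgL q.1 q.2 ξ (h1 _ hq1 _ hqξ) (h1 _ hq1 _ (by simpa using hη.le)) s hs
  have h4 := h2 q.1 ⟨by linarith [hq.1.1], by linarith [hq.1.2]⟩ s hs
  have h5 : Kg * ‖q.2 - ξ‖ ≤ |Kg| * η := by
    rw [← dist_eq_norm]
    exact mul_le_mul (le_abs_self _) hqξ dist_nonneg (abs_nonneg _)
  have h6 := norm_sub_norm_le (g q.1 q.2 s) (g q.1 ξ s)
  linarith

end Fields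

/-! ### Bounds and measurability of test functions and of the coefficients along a path -/

section Test

theorem IsRegulatedOnJ.exists_bound {p : ℝ → ℝ} (h : IsRegulatedOnJ p) :
    ∃ M, 0 ≤ M ∧ ∀ s ∈ J, ‖p s‖ ≤ M := by
  refine exists_bound_of_local isCompact_Icc (fun x M M' h h' => h'.trans h) fun s hs => ?_
  have hl : ∃ M, ∀ᶠ r in 𝓝[<] s, r ∈ J → ‖p r‖ ≤ M := by
    rcases eq_or_lt_of_le hs.1 with h1 | h1
    · refine ⟨0, ?_⟩
      filter_upwards [self_mem_nhdsWithin] with r hr hr'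
      exact absurd hr'.1 (not_le.2 (h1 ▸ hr))
    · obtain ⟨c, hc⟩ := h.2 s ⟨h1, hs.2⟩
      obtain ⟨M, hM⟩ := hc.norm.isBoundedUnder_le
      exact ⟨M, (eventually_map.1 hM).mono fun r hr _ => hr⟩
  have hr : ∃ M, ∀ᶠ r in 𝓝[>] s, r ∈ J → ‖p r‖ ≤ M := by
    rcases eq_or_lt_of_le hs.2 with h1 | h1
    · refine ⟨0, ?_⟩
      filter_upwards [self_mem_nhdsWithin] with r hr hr'
      exact absurd hr'.2 (not_le.2 (h1 ▸ hr))
    · obtain ⟨c, hc⟩ := h.1 s ⟨hs.1, h1⟩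
      obtain ⟨M, hM⟩ := hc.norm.isBoundedUnder_le
      exact ⟨M, (eventually_map.1 hM).mono fun r hr _ => hr⟩
  obtain ⟨M₁, h₁⟩ := hl
  obtain ⟨M₂, h₂⟩ := hr
  refine ⟨max ‖p s‖ (max M₁ M₂), ?_⟩
  rw [eventually_nhdsWithin_iff] at h₁ h₂ ⊢
  filter_upwards [h₁, h₂] with r hr1 hr2 hrJ
  rcases lt_trichotomy r s with h | rfl | h
  · exact (hr1 h hrJ).trans (le_max_of_le_right (le_max_left _ _))
  · exact le_max_left _ _
  · exact (hr2 h hrJ).trans (le_max_of_le_right (le_max_right _ _))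

variable {α β : ℝ} {φ : DynFun ℝ}

theorem IsTestFunction.exists_bound (h : IsTestFunction (Ioo α β) φ) :
    ∃ M, 0 ≤ M ∧ ∀ t ∈ Ioo α β, ∀ s ∈ J, ‖φ t s‖ ≤ M := by
  obtain ⟨h1, K, hK, hKΩ, h2⟩ := h
  obtain ⟨M, h0, hM⟩ := exists_bound_of_local hK (P := fun t M => ∀ s ∈ J, ‖φ t s‖ ≤ M)
    (fun x M M' h h' s hs => (h' s hs).trans h) (fun t ht => by
      obtain ⟨hr, ⟨cl, hcl⟩, cr, hcr⟩ := h1 t (hKΩ ht)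
      obtain ⟨M, -, hM⟩ := hr.exists_bound
      obtain ⟨η, hη, M', h3⟩ := exists_bound_near hcl hcr hM
      refine ⟨M', mem_nhdsWithin_of_mem_nhds ?_⟩
      filter_upwards [Ioo_mem_nhds (show t - η < t by linarith) (show t < t + η by linarith)]
        with r hr using h3 r hr)
  refine ⟨M, h0, fun t ht s hs => ?_⟩
  by_cases htK : t ∈ K
  · exact hM t htK s hs
  · rw [h2 t ⟨ht, htK⟩ s hs, norm_zero]
    exact h0

/-- Measurability is not part of the definition of a test function. It follows because a function
with left limits differs from its left limit at countably many times only, and these are ν-null. -/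
theorem IsTestFunction.aestronglyMeasurable_left (h : IsTestFunction (Ioo α β) φ) (ν : Measure ℝ)
    [NullSingletonClass ν] : AEStronglyMeasurable (fun t => φ t (-1 / 2)) (ν.restrict (Ioo α β)) := by
  refine aestronglyMeasurable_of_leftLimit isOpen_Ioo (fun t ht => ?_) ν
  obtain ⟨c, hc⟩ := (h.1 t ht).2.1
  exact ⟨c, tendsto_ord_left hc left_mem_J⟩

theorem IsTestFunction.aestronglyMeasurable_right (h : IsTestFunction (Ioo α β) φ) {τ : ℝ}
    (hτ : τ ∈ Ioo α β) : AEStronglyMeasurable (φ τ) (volume.restrict J) := by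
  rw [J, ← restrict_Ioo_eq_restrict_Icc]
  exact aestronglyMeasurable_of_leftLimit isOpen_Ioo
    (fun s hs => (h.1 τ hτ).1.2 s ⟨hs.1, hs.2.le⟩) volume

end Test

section Measurability

variable {ν : Measure ℝ} {C : Set ℝ} {α β : ℝ}

theorem aestronglyMeasurable_dynTime [Countable C] {E : Type*} [NormedAddCommGroup E]
    {F : ℝ × ℝ → E} (h1 : AEStronglyMeasurable (fun t => F (t, -1 / 2)) (ν.restrict (Ioo α β)))
    (h2 : ∀ τ ∈ C, τ ∈ Ioo α β → AEStronglyMeasurable (fun s => F (τ, s)) (volume.restrict J)) :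
    AEStronglyMeasurable F ((baseMeasure ν C).restrict (dynTime α β)) := by
  refine aestronglyMeasurable_restrict_baseMeasure (measurableSet_dynTime α β) ?_ fun τ hτ => ?_
  · have : {t : ℝ | (t, (-1 / 2 : ℝ)) ∈ dynTime α β} = Ioo α β := by
      ext t; simp [dynTime, left_mem_J]
    rwa [this]
  · by_cases h : τ ∈ Ioo α β
    · exact (h2 τ hτ h).mono_measure (Measure.restrict_mono (fun s hs => hs.1) le_rfl)
    · have : {s : ℝ | s ∈ J ∧ (τ, s) ∈ dynTime α β} = ∅ := by
        ext s; simp [dynTime, h]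
      rw [this, Measure.restrict_empty]
      exact aestronglyMeasurable_zero_measure _

theorem baseMeasure_empty : baseMeasure ν ∅ = ν.map (fun t => (t, -1 / 2)) := by
  ext S hS
  rw [baseMeasure_apply hS, Measure.map_apply measurableEmbedding_left.measurable hS]
  simp only [tsum_empty, add_zero]
  rfl

variable {n : ℕ} {D : Set (ℝ × (Fin n → ℝ))} {f : ℝ → (Fin n → ℝ) → (Fin n → ℝ)}
  {g : ℝ → (Fin n → ℝ) → ℝ → (Fin n → Fin n → ℝ)} {x : DynFun (Fin n → ℝ)}

theorem aestronglyMeasurable_ord {E : Type*} [NormedAddCommGroup E] {x : DynFun E}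
    (hx : ∀ t ∈ Ioo α β, SGAt x t) (ν : Measure ℝ) :
    AEStronglyMeasurable (fun t => x t (-1 / 2)) (ν.restrict (Ioo α β)) :=
  aestronglyMeasurable_leftLimit (G := fun t => x t (-1 / 2)) isOpen_Ioo
    (fun t ht => tendsto_ord_left (hx t ht).left left_mem_J) ν

theorem isOpen_slice (hD : IsOpen D) (t : ℝ) : IsOpen {ξ | (t, ξ) ∈ D} :=
  hD.preimage (Continuous.prodMk_right t)

theorem isOpen_slice' (hD : IsOpen D) (ξ : Fin n → ℝ) : IsOpen {t | (t, ξ) ∈ D} :=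
  hD.preimage (Continuous.prodMk_left ξ)

theorem continuousOn_of_norm_sub_le {V W : Type*} [NormedAddCommGroup V] [NormedAddCommGroup W]
    {F : V → W} {S : Set V} {L : ℝ} (h : ∀ x ∈ S, ∀ y ∈ S, ‖F x - F y‖ ≤ L * ‖x - y‖) :
    ContinuousOn F S := by
  refine (LipschitzOnWith.of_dist_le_mul (K := ⟨|L|, abs_nonneg L⟩) fun x hx y hy => ?_).continuousOn
  rw [dist_eq_norm, dist_eq_norm]
  exact (h x hx y hy).trans (mul_le_mul_of_nonneg_right (le_abs_self L) (norm_nonneg _))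

theorem aestronglyMeasurable_f (hD : IsOpen D) (hf : IsCaratheodory D f)
    (hx : ∀ t ∈ Ioo α β, SGAt x t) (hxD : ∀ t ∈ Ioo α β, ∀ s ∈ J, (t, x t s) ∈ D) :
    AEStronglyMeasurable (fun t => f t (x t (-1 / 2))) (volume.restrict (Ioo α β)) := by
  refine aestronglyMeasurable_superposition (D := D) (F := f)
    (fun ξ => (isOpen_slice' hD ξ).measurableSet) (isOpen_slice hD) (fun ξ => ?_)
    (ae_restrict_of_ae hf.2.1) (aestronglyMeasurable_ord hx volume)
    ((ae_restrict_iff' measurableSet_Ioo).2 (Eventually.of_forall fun t ht => hxD t ht _ left_mem_J))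
  exact (hf.1 ξ).aestronglyMeasurable.mono_measure
    (Measure.restrict_mono_measure Measure.restrict_le_self _)

variable {Kg : ℝ}

theorem aestronglyMeasurable_g_left (hD : IsOpen D) (hg : IsSGInTime D g)
    (hgL : ∀ t x y, (t, x) ∈ D → (t, y) ∈ D → ∀ s ∈ J, ‖g t x s - g t y s‖ ≤ Kg * ‖x - y‖)
    (hx : ∀ t ∈ Ioo α β, SGAt x t) (hxD : ∀ t ∈ Ioo α β, ∀ s ∈ J, (t, x t s) ∈ D) (ν : Measure ℝ) :
    AEStronglyMeasurable (fun t => g t (x t (-1 / 2)) (-1 / 2)) (ν.restrict (Ioo α β)) := by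
  refine aestronglyMeasurable_superposition (D := D) (F := fun t ξ => g t ξ (-1 / 2))
    (fun ξ => (isOpen_slice' hD ξ).measurableSet) (isOpen_slice hD) (fun ξ => ?_)
    (Eventually.of_forall fun t => continuousOn_of_norm_sub_le fun ξ hξ ζ hζ =>
      hgL t ξ ζ hξ hζ _ left_mem_J) (aestronglyMeasurable_ord hx ν)
    ((ae_restrict_iff' measurableSet_Ioo).2 (Eventually.of_forall fun t ht => hxD t ht _ left_mem_J))
  exact aestronglyMeasurable_leftLimit (G := fun t => g t ξ (-1 / 2)) (isOpen_slice' hD ξ)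
    (fun t ht => tendsto_ord_left (w := fun t s => g t ξ s) (hg.sgAt hD ht).left left_mem_J) _

/-- On a fibre, s plays the role of time: g(τ, ξ)(s) is continuous in s for each ξ in the slice of
D, and Lipschitz in ξ. -/
theorem aestronglyMeasurable_g_right (hD : IsOpen D) (hg : IsSGInTime D g)
    (hgL : ∀ t x y, (t, x) ∈ D → (t, y) ∈ D → ∀ s ∈ J, ‖g t x s - g t y s‖ ≤ Kg * ‖x - y‖)
    {τ : ℝ} (hx : SGAt x τ) (hxD : ∀ s ∈ J, (τ, x τ s) ∈ D) :
    AEStronglyMeasurable (fun s => g τ (x τ s) s) (volume.restrict J) := by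
  refine aestronglyMeasurable_superposition (D := {q : ℝ × (Fin n → ℝ) | (τ, q.2) ∈ D})
    (F := fun s ξ => g τ ξ s)
    (fun ξ => (measurableSet_setOfPred (p := fun _ : ℝ => (τ, ξ) ∈ D)).2 measurable_const)
    (fun s => isOpen_slice hD τ) (fun ξ => ?_)
    ((ae_restrict_iff' measurableSet_J).2 (Eventually.of_forall fun s hs =>
      continuousOn_of_norm_sub_le fun ξ hξ ζ hζ => hgL τ ξ ζ hξ hζ s hs))
    (hx.continuousOn.aestronglyMeasurable measurableSet_J)
    ((ae_restrict_iff' measurableSet_J).2 (Eventually.of_forall fun s hs => hxD s hs))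
  by_cases h : (τ, ξ) ∈ D
  · exact (((hg.sgAt hD h).continuousOn).aestronglyMeasurable measurableSet_J).restrict
  · have : {p : ℝ | (p, ξ) ∈ {q : ℝ × (Fin n → ℝ) | (τ, q.2) ∈ D}} = ∅ := by
      ext p; simpa using h
    rw [this, Measure.restrict_empty]
    exact aestronglyMeasurable_zero_measure _

end Measurability

/-! ### The right-hand side of the equation as a density -/

section Field

variable {n : ℕ}

theorem norm_sum_mul_le (A : Fin n → Fin n → ℝ) (y : Fin n → ℝ) :
    ‖fun i => ∑ j, A i j * y j‖ ≤ n * (‖A‖ * ‖y‖) := by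
  refine (pi_norm_le_iff_of_nonneg (by positivity)).2 fun i => ?_
  calc ‖∑ j, A i j * y j‖ ≤ ∑ j, ‖A i j * y j‖ := norm_sum_le _ _
    _ ≤ ∑ _j : Fin n, ‖A‖ * ‖y‖ := by
        refine Finset.sum_le_sum fun j _ => ?_
        rw [norm_mul]
        exact mul_le_mul ((norm_le_pi_norm (A i) j).trans (norm_le_pi_norm A i))
          (norm_le_pi_norm y j) (norm_nonneg _) (norm_nonneg _)
    _ = n * (‖A‖ * ‖y‖) := by simp

/-- The right hand side of the equation as a density, where `ρ` is the density of time and `θ` is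
that of the control. -/
def field (f : ℝ → (Fin n → ℝ) → (Fin n → ℝ)) (g : ℝ → (Fin n → ℝ) → ℝ → (Fin n → Fin n → ℝ))
    (ρ : ℝ × ℝ → NNReal) (θ : ℝ × ℝ → (Fin n → ℝ)) (p : ℝ × ℝ) (ξ : Fin n → ℝ) : Fin n → ℝ :=
  (ρ p : ℝ) • f p.1 ξ + fun i => ∑ j, g p.1 ξ p.2 i j * θ p j

/-- The Lipschitz constant of the right hand side. -/
def lipField (n : ℕ) (Kf Kg : ℝ) (ρ : ℝ × ℝ → NNReal) (θ : ℝ × ℝ → (Fin n → ℝ)) (p : ℝ × ℝ) : ℝ :=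
  |Kf| * ρ p + n * |Kg| * ‖θ p‖

variable {D : Set (ℝ × (Fin n → ℝ))} {f : ℝ → (Fin n → ℝ) → (Fin n → ℝ)}
  {g : ℝ → (Fin n → ℝ) → ℝ → (Fin n → Fin n → ℝ)} {Kf Kg : ℝ}
  {ρ : ℝ × ℝ → NNReal} {θ θ' : ℝ × ℝ → (Fin n → ℝ)}

/-- The splitting is asymmetric on purpose: the norm of g is needed at ζ only. In comparisons ζ
belongs to the path in the compact tube, while ξ may belong to an arbitrary solution. -/
theorem norm_field_sub_le
    (hfL : ∀ t x y, (t, x) ∈ D → (t, y) ∈ D → ‖f t x - f t y‖ ≤ Kf * ‖x - y‖)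
    (hgL : ∀ t x y, (t, x) ∈ D → (t, y) ∈ D → ∀ s ∈ J, ‖g t x s - g t y s‖ ≤ Kg * ‖x - y‖)
    {p : ℝ × ℝ} (hp : p.2 ∈ J) {ξ ζ : Fin n → ℝ} (hξ : (p.1, ξ) ∈ D) (hζ : (p.1, ζ) ∈ D) :
    ‖field f g ρ θ p ξ - field f g ρ θ' p ζ‖ ≤
      lipField n Kf Kg ρ θ p * ‖ξ - ζ‖ + n * (‖g p.1 ζ p.2‖ * ‖θ p - θ' p‖) := by
  have e : field f g ρ θ p ξ - field f g ρ θ' p ζ = (ρ p : ℝ) • (f p.1 ξ - f p.1 ζ) +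
      (fun i => ∑ j, (g p.1 ξ p.2 - g p.1 ζ p.2) i j * θ p j) +
      fun i => ∑ j, g p.1 ζ p.2 i j * (θ p - θ' p) j := by
    ext i
    simp only [field, Pi.sub_apply, Pi.add_apply, Pi.smul_apply, smul_eq_mul, sub_mul, mul_sub,
      Finset.sum_sub_distrib]
    ring
  have hρ : (0 : ℝ) ≤ ρ p := (ρ p).2
  have h1 : ‖(ρ p : ℝ) • (f p.1 ξ - f p.1 ζ)‖ ≤ |Kf| * ρ p * ‖ξ - ζ‖ := by
    rw [norm_smul, Real.norm_of_nonneg hρ]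
    have := (hfL p.1 ξ ζ hξ hζ).trans (mul_le_mul_of_nonneg_right (le_abs_self Kf) (norm_nonneg _))
    nlinarith
  have h2 := norm_sum_mul_le (g p.1 ξ p.2 - g p.1 ζ p.2) (θ p)
  have h3 := norm_sum_mul_le (g p.1 ζ p.2) (θ p - θ' p)
  have h4 : ‖g p.1 ξ p.2 - g p.1 ζ p.2‖ * ‖θ p‖ ≤ |Kg| * ‖ξ - ζ‖ * ‖θ p‖ :=
    mul_le_mul_of_nonneg_right ((hgL p.1 ξ ζ hξ hζ p.2 hp).trans
      (mul_le_mul_of_nonneg_right (le_abs_self Kg) (norm_nonneg _))) (norm_nonneg _)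
  have h5 := mul_le_mul_of_nonneg_left h4 (Nat.cast_nonneg (α := ℝ) n)
  rw [e]
  refine (norm_add₃_le).trans ?_
  rw [lipField]
  linarith

variable {ν : Measure ℝ} {C : Set ℝ} [Countable C] {a b α β : ℝ} {x v : DynFun (Fin n → ℝ)}

/-- By definition of ρ, weighting with it turns the base measure into Lebesgue measure on ordinary
times. Thus f enters the integral over dynamic time without any contribution from jumps. -/
theorem setIntegral_time {E : Type*} [NormedAddCommGroup E] [NormedSpace ℝ E]
    (hρm : Measurable ρ)
    (hρ : baseMeasure (volume.restrict (Ioo a b)) ∅ = (baseMeasure ν C).withDensity (fun p => ρ p))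
    (ha : a ≤ α) (hb : β ≤ b) (F : ℝ × ℝ → E) :
    ∫ p in dynTime α β, (ρ p : ℝ) • F p ∂(baseMeasure ν C) = ∫ t in Ioo α β, F (t, -1 / 2) := by
  have h1 := setIntegral_withDensity_eq_setIntegral_smul (μ := baseMeasure ν C) hρm F
    (measurableSet_dynTime α β)
  rw [← hρ, baseMeasure_empty, measurableEmbedding_left.setIntegral_map] at h1
  have : (fun t : ℝ => (t, (-1 / 2 : ℝ))) ⁻¹' dynTime α β = Ioo α β := by
    ext t; simp [dynTime, left_mem_J]
  rw [this, Measure.restrict_restrict measurableSet_Ioo,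
    inter_eq_left.2 (Ioo_subset_Ioo ha hb)] at h1
  exact h1.symm

theorem integrableOn_time {E : Type*} [NormedAddCommGroup E] [NormedSpace ℝ E]
    (hρm : Measurable ρ)
    (hρ : baseMeasure (volume.restrict (Ioo a b)) ∅ = (baseMeasure ν C).withDensity (fun p => ρ p))
    (ha : a ≤ α) (hb : β ≤ b) {F : ℝ × ℝ → E} (hF : IntegrableOn (fun t => F (t, -1 / 2)) (Ioo α β)) :
    IntegrableOn (fun p => (ρ p : ℝ) • F p) (dynTime α β) (baseMeasure ν C) := by
  have h1 : IntegrableOn F (dynTime α β) (baseMeasure (volume.restrict (Ioo a b)) ∅) := by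
    rw [baseMeasure_empty, measurableEmbedding_left.integrableOn_map_iff]
    have : (fun t : ℝ => (t, (-1 / 2 : ℝ))) ⁻¹' dynTime α β = Ioo α β := by
      ext t; simp [dynTime, left_mem_J]
    rw [this, IntegrableOn, Measure.restrict_restrict measurableSet_Ioo,
      inter_eq_left.2 (Ioo_subset_Ioo ha hb)]
    exact hF
  rw [hρ, IntegrableOn, restrict_withDensity (measurableSet_dynTime α β),
    integrable_withDensity_iff_integrable_smul hρm] at h1
  exact h1

theorem aestronglyMeasurable_time {E : Type*} [NormedAddCommGroup E] [NormedSpace ℝ E]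
    (hρm : Measurable ρ)
    (hρ : baseMeasure (volume.restrict (Ioo a b)) ∅ = (baseMeasure ν C).withDensity (fun p => ρ p))
    (ha : a ≤ α) (hb : β ≤ b) {F : ℝ × ℝ → E}
    (hF : AEStronglyMeasurable (fun t => F (t, -1 / 2)) (volume.restrict (Ioo α β))) :
    AEStronglyMeasurable (fun p => (ρ p : ℝ) • F p) ((baseMeasure ν C).restrict (dynTime α β)) := by
  have h1 : AEStronglyMeasurable F
      ((baseMeasure (volume.restrict (Ioo a b)) ∅).restrict (dynTime α β)) := by
    refine aestronglyMeasurable_dynTime ?_ fun τ hτ => absurd hτ (notMem_empty τ)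
    rw [Measure.restrict_restrict measurableSet_Ioo, inter_eq_left.2 (Ioo_subset_Ioo ha hb)]
    exact hF
  rw [hρ, restrict_withDensity (measurableSet_dynTime α β), aestronglyMeasurable_withDensity_iff hρm] at h1
  exact h1

theorem aestronglyMeasurable_g (hD : IsOpen D) (hg : IsSGInTime D g)
    (hgL : ∀ t x y, (t, x) ∈ D → (t, y) ∈ D → ∀ s ∈ J, ‖g t x s - g t y s‖ ≤ Kg * ‖x - y‖)
    (hx : ∀ t ∈ Ioo α β, SGAt x t) (hxD : ∀ t ∈ Ioo α β, ∀ s ∈ J, (t, x t s) ∈ D) :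
    AEStronglyMeasurable (fun p : ℝ × ℝ => g p.1 (x p.1 p.2) p.2)
      ((baseMeasure ν C).restrict (dynTime α β)) :=
  aestronglyMeasurable_dynTime (aestronglyMeasurable_g_left hD hg hgL hx hxD ν)
    fun τ _ hτ => aestronglyMeasurable_g_right hD hg hgL (hx τ hτ) (hxD τ hτ)

theorem aestronglyMeasurable_pi_apply₂ {X : Type*} [MeasurableSpace X] {μ : Measure X}
    {F : X → Fin n → Fin n → ℝ} (h : AEStronglyMeasurable F μ) (i j : Fin n) :
    AEStronglyMeasurable (fun p => F p i j) μ :=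
  ((continuous_apply j).comp (continuous_apply i) :
    Continuous fun y : Fin n → Fin n → ℝ => y i j).comp_aestronglyMeasurable h

theorem aestronglyMeasurable_field (hD : IsOpen D) (hf : IsCaratheodory D f) (hg : IsSGInTime D g)
    (hgL : ∀ t x y, (t, x) ∈ D → (t, y) ∈ D → ∀ s ∈ J, ‖g t x s - g t y s‖ ≤ Kg * ‖x - y‖)
    (hρm : Measurable ρ)
    (hρ : baseMeasure (volume.restrict (Ioo a b)) ∅ = (baseMeasure ν C).withDensity (fun p => ρ p))
    (ha : a ≤ α) (hb : β ≤ b)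
    (hθ : AEStronglyMeasurable θ ((baseMeasure ν C).restrict (dynTime α β)))
    (hx : ∀ t ∈ Ioo α β, SGAt x t) (hxD : ∀ t ∈ Ioo α β, ∀ s ∈ J, (t, x t s) ∈ D) :
    AEStronglyMeasurable (fun p => field f g ρ θ p (x p.1 p.2))
      ((baseMeasure ν C).restrict (dynTime α β)) := by
  refine AEStronglyMeasurable.add (f := fun p : ℝ × ℝ => (ρ p : ℝ) • f p.1 (x p.1 p.2))
    (g := fun p : ℝ × ℝ => fun i => ∑ j, g p.1 (x p.1 p.2) p.2 i j * θ p j)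
    (aestronglyMeasurable_time hρm hρ ha hb (aestronglyMeasurable_f hD hf hx hxD)) ?_
  have hg' := aestronglyMeasurable_g (ν := ν) (C := C) hD hg hgL hx hxD
  refine (aemeasurable_pi_lambda _ fun i => ?_).aestronglyMeasurable
  refine Finset.aemeasurable_fun_sum _ fun j _ => ?_
  exact (aestronglyMeasurable_pi_apply₂ hg' i j).aemeasurable.mul
    ((continuous_apply j).comp_aestronglyMeasurable hθ).aemeasurable

theorem integrableOn_field (hD : IsOpen D) (hf : IsCaratheodory D f) (hg : IsSGInTime D g)
    (hgL : ∀ t x y, (t, x) ∈ D → (t, y) ∈ D → ∀ s ∈ J, ‖g t x s - g t y s‖ ≤ Kg * ‖x - y‖)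
    (hρm : Measurable ρ)
    (hρ : baseMeasure (volume.restrict (Ioo a b)) ∅ = (baseMeasure ν C).withDensity (fun p => ρ p))
    (ha : a ≤ α) (hb : β ≤ b) (hθ : IntegrableOn θ (dynTime α β) (baseMeasure ν C))
    (hx : ∀ t ∈ Ioo α β, SGAt x t) {K : Set (ℝ × (Fin n → ℝ))} (hKD : K ⊆ D) (hK : IsCompact K)
    (hxK : ∀ t ∈ Ioo α β, ∀ s ∈ J, (t, x t s) ∈ K) :
    IntegrableOn (fun p => field f g ρ θ p (x p.1 p.2)) (dynTime α β) (baseMeasure ν C) := by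
  have hxD : ∀ t ∈ Ioo α β, ∀ s ∈ J, (t, x t s) ∈ D := fun t ht s hs => hKD (hxK t ht s hs)
  obtain ⟨m, hm, hfm⟩ := hf.2.2 K hKD hK
  obtain ⟨G, hG0, hG⟩ := hg.exists_bound hD hgL hKD hK
  have hfi : IntegrableOn (fun t => f t (x t (-1 / 2))) (Ioo α β) := by
    refine hm.integrableOn.mono' (aestronglyMeasurable_f hD hf hx hxD) ?_
    refine (ae_restrict_iff' measurableSet_Ioo).2 ?_
    filter_upwards [hfm] with t ht ht' using ht _ (hxK t ht' _ left_mem_J)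
  have h1 := integrableOn_time (F := fun p : ℝ × ℝ => f p.1 (x p.1 p.2)) hρm hρ ha hb hfi
  have h2 : IntegrableOn (fun p => ‖(ρ p : ℝ) • f p.1 (x p.1 p.2)‖ + n * (G * ‖θ p‖))
      (dynTime α β) (baseMeasure ν C) := h1.norm.add ((hθ.norm.const_mul G).const_mul n)
  refine h2.mono' (aestronglyMeasurable_field hD hf hg hgL hρm hρ ha hb hθ.aestronglyMeasurable hx hxD) ?_
  refine (ae_restrict_iff' (measurableSet_dynTime α β)).2 (Eventually.of_forall fun p hp => ?_)
  refine (norm_add_le _ _).trans (add_le_add le_rfl ((norm_sum_mul_le _ _).trans ?_))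
  have := hG _ (hxK p.1 hp.1 p.2 hp.2) p.2 hp.2
  gcongr

/-- Moving g to the side of the test function leaves the derivative of v to be paired with the
bounded measurable function g φ, and this pairing is integration against θ. Together with the time
integral of f it is integration against the field. -/
theorem integral_add_sum_derivPairing_eq [IsFiniteMeasure ν] [NullSingletonClass ν]
    (hD : IsOpen D) (hf : IsCaratheodory D f) (hg : IsSGInTime D g)
    (hgL : ∀ t x y, (t, x) ∈ D → (t, y) ∈ D → ∀ s ∈ J, ‖g t x s - g t y s‖ ≤ Kg * ‖x - y‖)
    (hρm : Measurable ρ)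
    (hρ : baseMeasure (volume.restrict (Ioo a b)) ∅ = (baseMeasure ν C).withDensity (fun p => ρ p))
    (ha : a ≤ α) (hb : β ≤ b) (hαβ : α < β) (hv : HasDensity a b (baseMeasure ν C) θ v)
    (hx : ∀ t ∈ Ioo α β, SGAt x t) {K : Set (ℝ × (Fin n → ℝ))} (hKD : K ⊆ D) (hK : IsCompact K)
    (hxK : ∀ t ∈ Ioo α β, ∀ s ∈ J, (t, x t s) ∈ K) {φ : DynFun ℝ}
    (hφ : IsTestFunction (Ioo α β) φ) (i : Fin n) :
    (∫ t in Ioo α β, f t (ord x t) i * ord φ t) +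
      ∑ j, derivPairing α β (fun t s => v t s j) (fun t s => g t (x t s) s i j * φ t s) =
    ∫ p in dynTime α β, φ p.1 p.2 * field f g ρ θ p (x p.1 p.2) i ∂(baseMeasure ν C) := by
  have hxD : ∀ t ∈ Ioo α β, ∀ s ∈ J, (t, x t s) ∈ D := fun t ht s hs => hKD (hxK t ht s hs)
  have hv' := hv.mono ha hb
  obtain ⟨m, hm, hfm⟩ := hf.2.2 K hKD hK
  obtain ⟨G, hG0, hG⟩ := hg.exists_bound hD hgL hKD hK
  obtain ⟨M, hM0, hM⟩ := hφ.exists_bound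
  have hφm : AEStronglyMeasurable (fun p : ℝ × ℝ => φ p.1 p.2)
      ((baseMeasure ν C).restrict (dynTime α β)) :=
    aestronglyMeasurable_dynTime (hφ.aestronglyMeasurable_left ν)
      fun τ _ hτ => hφ.aestronglyMeasurable_right hτ
  have hgm := aestronglyMeasurable_g (ν := ν) (C := C) hD hg hgL hx hxD
  have hfi : IntegrableOn (fun t => f t (x t (-1 / 2)) i * φ t (-1 / 2)) (Ioo α β) := by
    refine (hm.integrableOn.const_mul M).mono'
      (((continuous_apply i).comp_aestronglyMeasurable (aestronglyMeasurable_f hD hf hx hxD)).mul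
        (hφ.aestronglyMeasurable_left volume)) ?_
    refine (ae_restrict_iff' measurableSet_Ioo).2 ?_
    filter_upwards [hfm] with t ht ht'
    rw [norm_mul, mul_comm]
    exact mul_le_mul (hM t ht' _ left_mem_J) ((norm_le_pi_norm _ i).trans
      (ht _ (hxK t ht' _ left_mem_J))) (norm_nonneg _) hM0
  have e1 := setIntegral_time (F := fun p : ℝ × ℝ => f p.1 (x p.1 p.2) i * φ p.1 p.2) hρm hρ ha hb
  have i1 := integrableOn_time (F := fun p : ℝ × ℝ => f p.1 (x p.1 p.2) i * φ p.1 p.2) hρm hρ ha hb hfi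
  have i2 (j : Fin n) : IntegrableOn (fun p => (g p.1 (x p.1 p.2) p.2 i j * φ p.1 p.2) * θ p j)
      (dynTime α β) (baseMeasure ν C) := by
    refine Integrable.bdd_mul (c := G * M) (hv'.apply j).integrableOn
      ((aestronglyMeasurable_pi_apply₂ hgm i j).mul hφm) ?_
    refine (ae_restrict_iff' (measurableSet_dynTime α β)).2 (Eventually.of_forall fun p hp => ?_)
    rw [norm_mul]
    exact mul_le_mul (((norm_le_pi_norm _ j).trans (norm_le_pi_norm _ i)).trans
      (hG _ (hxK p.1 hp.1 p.2 hp.2) p.2 hp.2)) (hM p.1 hp.1 p.2 hp.2) (norm_nonneg _) hG0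
  have e2 (j : Fin n) : derivPairing α β (fun t s => v t s j) (fun t s => g t (x t s) s i j * φ t s) =
      ∫ p in dynTime α β, (g p.1 (x p.1 p.2) p.2 i j * φ p.1 p.2) * θ p j ∂(baseMeasure ν C) :=
    (hv'.apply j).derivPairing_eq hαβ
      ((aestronglyMeasurable_pi_apply₂ (aestronglyMeasurable_g_left hD hg hgL hx hxD ν) i j).mul
        (hφ.aestronglyMeasurable_left ν)) (i2 j)
  rw [Finset.sum_congr rfl fun j _ => e2 j, ← integral_finsetSum _ fun j _ => i2 j]
  refine (congrArg (· + _) e1.symm).trans ?_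
  rw [← integral_add i1 (integrable_finsetSum _ fun j _ => i2 j)]
  refine integral_congr_ae (Eventually.of_forall fun p => ?_)
  simp only [field, Pi.add_apply, Pi.smul_apply, smul_eq_mul, mul_add, Finset.mul_sum]
  refine congrArg₂ _ (by ring) (Finset.sum_congr rfl fun j _ => by ring)

end Field

/-! ### Indicators of segments as test functions -/

section Decided

/-- A property which eventually holds or eventually fails. -/
def Decided {X : Type*} (l : Filter X) (P : X → Prop) : Prop :=
  (∀ᶠ r in l, P r) ∨ ∀ᶠ r in l, ¬P r

variable {X : Type*} {l : Filter X} {P Q : X → Prop}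

theorem Decided.and (hP : Decided l P) (hQ : Decided l Q) : Decided l fun r => P r ∧ Q r := by
  rcases hP with hP | hP
  · rcases hQ with hQ | hQ
    · exact Or.inl (hP.and hQ)
    · exact Or.inr (hQ.mono fun r hr h => hr h.2)
  · exact Or.inr (hP.mono fun r hr h => hr h.1)

theorem Decided.not (hP : Decided l P) : Decided l fun r => ¬P r := by
  rcases hP with hP | hP
  · exact Or.inr (hP.mono fun r hr h => h hr)
  · exact Or.inl hP

theorem Decided.or (hP : Decided l P) (hQ : Decided l Q) : Decided l fun r => P r ∨ Q r := by
  have := (hP.not.and hQ.not).not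
  simpa only [not_and_or, not_not] using this

theorem Decided.const (p : Prop) : Decided l fun _ => p := by
  by_cases h : p
  · exact Or.inl (Eventually.of_forall fun _ => h)
  · exact Or.inr (Eventually.of_forall fun _ => h)

theorem decided_le_right (c s : ℝ) : Decided (𝓝[>] s) fun r => c ≤ r := by
  by_cases h : c ≤ s
  · exact Or.inl (eventually_nhdsWithin_of_forall fun r hr => h.trans (le_of_lt hr))
  · refine Or.inr ?_
    filter_upwards [Ioo_mem_nhdsGT (not_le.1 h)] with r hr using not_le.2 hr.2

theorem decided_le_left (c s : ℝ) : Decided (𝓝[<] s) fun r => c ≤ r := by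
  by_cases h : c < s
  · refine Or.inl ?_
    filter_upwards [Ioo_mem_nhdsLT h] with r hr using hr.1.le
  · exact Or.inr (eventually_nhdsWithin_of_forall fun r hr => not_le.2 (lt_of_lt_of_le hr (not_lt.1 h)))

theorem decided_lt_right (c s : ℝ) : Decided (𝓝[>] s) fun r => c < r := by
  by_cases h : c ≤ s
  · exact Or.inl (eventually_nhdsWithin_of_forall fun r hr => h.trans_lt hr)
  · refine Or.inr ?_
    filter_upwards [Ioo_mem_nhdsGT (not_le.1 h)] with r hr using not_lt.2 hr.2.le

theorem decided_lt_left (c s : ℝ) : Decided (𝓝[<] s) fun r => c < r := by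
  by_cases h : c < s
  · refine Or.inl ?_
    filter_upwards [Ioo_mem_nhdsLT h] with r hr using hr.1
  · exact Or.inr (eventually_nhdsWithin_of_forall fun r hr => not_lt.2 (le_of_lt (lt_of_lt_of_le hr (not_lt.1 h))))

theorem Decided.exists_tendsto_indicator (h : Decided l P) :
    ∃ c : ℝ, Tendsto ({r | P r}.indicator fun _ => (1 : ℝ)) l (𝓝 c) := by
  rcases h with h | h
  · exact ⟨1, tendsto_const_nhds.congr' (h.mono fun r hr =>
      (indicator_of_mem (show r ∈ {r | P r} from hr) _).symm)⟩
  · exact ⟨0, tendsto_const_nhds.congr' (h.mono fun r hr =>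
      (indicator_of_notMem (show r ∉ {r | P r} from hr) _).symm)⟩

end Decided

/-- The indicator function of a segment of dynamic time. -/
def segFun (p q : ℝ × ℝ) : DynFun ℝ := fun t s => (seg p q).indicator (fun _ => 1) (t, s)

/-- Membership in a segment is a Boolean combination of order conditions, so on each fibre it is
eventually constant on either side of any s. At times close to but different from t it no longer
depends on s, because fibres over times other than the two ends lie wholly inside or outside. -/
theorem isTestFunction_segFun {α β : ℝ} {p q : ℝ × ℝ} (hp : p.1 ∈ Ioo α β) (hq : q.1 ∈ Ioo α β) :
    IsTestFunction (Ioo α β) (segFun p q) := by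
  have hmem (t s : ℝ) : (t, s) ∈ seg p q ↔ ((-1 / 2 ≤ s ∧ ¬ (1 / 2 < s)) ∧ (p.1 < t ∨ p.1 = t ∧ p.2 ≤ s)) ∧
      (t < q.1 ∨ t = q.1 ∧ ¬ (q.2 ≤ s)) := by
    simp only [mem_seg, J, mem_Icc, not_le, not_lt, and_assoc]
  have hfun (t : ℝ) : segFun p q t = {s | (t, s) ∈ seg p q}.indicator fun _ => (1 : ℝ) := rfl
  refine ⟨fun t _ => ⟨⟨fun s hs => ?_, fun s hs => ?_⟩, ?_, ?_⟩, Icc p.1 q.1, isCompact_Icc, ?_, ?_⟩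
  · rw [hfun]
    refine Decided.exists_tendsto_indicator ?_
    simp only [hmem]
    exact (((decided_le_right _ s).and (decided_lt_right _ s).not).and
      ((Decided.const _).or ((Decided.const _).and (decided_le_right _ s)))).and
      ((Decided.const _).or ((Decided.const _).and (decided_le_right _ s).not))
  · rw [hfun]
    refine Decided.exists_tendsto_indicator ?_
    simp only [hmem]
    exact (((decided_le_left _ s).and (decided_lt_left _ s).not).and
      ((Decided.const _).or ((Decided.const _).and (decided_le_left _ s)))).and
      ((Decided.const _).or ((Decided.const _).and (decided_le_left _ s).not))
  -- The interval (t - η, t) is kept free of the times of both end points.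
  · obtain ⟨η, hη, h1, h2⟩ : ∃ η > 0, (p.1 < t → p.1 ≤ t - η) ∧ (q.1 < t → q.1 ≤ t - η) := by
      refine ⟨min (if p.1 < t then t - p.1 else 1) (if q.1 < t then t - q.1 else 1), ?_, ?_, ?_⟩
      · refine lt_min ?_ ?_ <;> split_ifs with h <;> linarith
      · intro h
        rw [if_pos h]
        linarith [min_le_left (t - p.1) (if q.1 < t then t - q.1 else 1)]
      · intro h
        rw [if_pos h]
        linarith [min_le_right (if p.1 < t then t - p.1 else 1) (t - q.1)]
    refine ⟨if p.1 < t ∧ t ≤ q.1 then 1 else 0, fun ε hε => ⟨η, hη, fun r hr s hs => ?_⟩⟩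
    have : (r, s) ∈ seg p q ↔ p.1 < t ∧ t ≤ q.1 := by
      rw [mem_seg]
      constructor
      · rintro ⟨-, h3, h4⟩
        refine ⟨?_, ?_⟩
        · rcases h3 with h | h
          · exact h.trans hr.2
          · exact h.1.trans_lt hr.2
        · by_contra h5
          have := h2 (not_le.1 h5)
          rcases h4 with h | h
          · linarith [hr.1]
          · linarith [hr.1, h.1]
      · rintro ⟨h3, h4⟩
        exact ⟨hs, Or.inl ((h1 h3).trans_lt hr.1), Or.inl (hr.2.trans_le h4)⟩
    by_cases h : p.1 < t ∧ t ≤ q.1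
    · rw [segFun, indicator_of_mem (this.2 h), if_pos h, sub_self, norm_zero]
      exact hε.le
    · rw [segFun, indicator_of_notMem (fun h' => h (this.1 h')), if_neg h, sub_self, norm_zero]
      exact hε.le
  · obtain ⟨η, hη, h1, h2⟩ : ∃ η > 0, (t < p.1 → t + η ≤ p.1) ∧ (t < q.1 → t + η ≤ q.1) := by
      refine ⟨min (if t < p.1 then p.1 - t else 1) (if t < q.1 then q.1 - t else 1), ?_, ?_, ?_⟩
      · refine lt_min ?_ ?_ <;> split_ifs with h <;> linarith
      · intro h
        rw [if_pos h]
        linarith [min_le_left (p.1 - t) (if t < q.1 then q.1 - t else 1)]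
      · intro h
        rw [if_pos h]
        linarith [min_le_right (if t < p.1 then p.1 - t else 1) (q.1 - t)]
    refine ⟨if p.1 ≤ t ∧ t < q.1 then 1 else 0, fun ε hε => ⟨η, hη, fun r hr s hs => ?_⟩⟩
    have : (r, s) ∈ seg p q ↔ p.1 ≤ t ∧ t < q.1 := by
      rw [mem_seg]
      constructor
      · rintro ⟨-, h3, h4⟩
        refine ⟨?_, ?_⟩
        · by_contra h5
          have := h1 (not_le.1 h5)
          rcases h3 with h | h
          · linarith [hr.2]
          · linarith [hr.2, h.1]
        · rcases h4 with h | h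
          · exact hr.1.trans h
          · exact hr.1.trans_eq h.1
      · rintro ⟨h3, h4⟩
        exact ⟨hs, Or.inl (h3.trans_lt hr.1), Or.inl (hr.2.trans_le (h2 h4))⟩
    by_cases h : p.1 ≤ t ∧ t < q.1
    · rw [segFun, indicator_of_mem (this.2 h), if_pos h, sub_self, norm_zero]
      exact hε.le
    · rw [segFun, indicator_of_notMem (fun h' => h (this.1 h')), if_neg h, sub_self, norm_zero]
      exact hε.le
  · exact fun t ht => ⟨hp.1.trans_le ht.1, ht.2.trans_lt hq.2⟩
  · rintro t ⟨-, ht⟩ s -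
    refine indicator_of_notMem (fun h => ht ?_) _
    rw [mem_seg] at h
    constructor
    · rcases h.2.1 with h | h
      exacts [h.le, h.1.le]
    · rcases h.2.2 with h | h
      exacts [h.le, h.1.le]

theorem integral_segFun_mul {α β : ℝ} {p q : ℝ × ℝ} (hp : p ∈ dynTime α β) (hq : q ∈ dynTime α β)
    (μ : Measure (ℝ × ℝ)) (F : ℝ × ℝ → ℝ) :
    ∫ r in dynTime α β, segFun p q r.1 r.2 * F r ∂μ = ∫ r in seg p q, F r ∂μ := by
  have : (fun r : ℝ × ℝ => segFun p q r.1 r.2 * F r) = (seg p q).indicator F := by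
    ext r
    by_cases h : r ∈ seg p q
    · rw [indicator_of_mem h, segFun, indicator_of_mem (show (r.1, r.2) ∈ seg p q from h), one_mul]
    · rw [indicator_of_notMem h, segFun, indicator_of_notMem (show (r.1, r.2) ∉ seg p q from h),
        zero_mul]
  rw [this, setIntegral_indicator (measurableSet_seg p q),
    inter_eq_right.2 (seg_subset_dynTime hp hq)]

theorem exists_Icc_subset_of_mem {Ω : Set ℝ} (hΩ : IsOpen Ω) (hΩ' : Ω.OrdConnected) {t t' : ℝ}
    (ht : t ∈ Ω) (ht' : t' ∈ Ω) : ∃ α β, α < t ∧ t' < β ∧ Icc α β ⊆ Ω := by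
  obtain ⟨ε, hε, h1⟩ := Metric.isOpen_iff.1 hΩ t ht
  obtain ⟨ε', hε', h2⟩ := Metric.isOpen_iff.1 hΩ t' ht'
  refine ⟨t - ε / 2, t' + ε' / 2, by linarith, by linarith, hΩ'.out (h1 ?_) (h2 ?_)⟩
  · rw [Metric.mem_ball, Real.dist_eq, abs_lt]; constructor <;> linarith
  · rw [Metric.mem_ball, Real.dist_eq, abs_lt]; constructor <;> linarith

theorem MemSBVLoc.sgAt {E : Type*} [NormedAddCommGroup E] {Ω : Set ℝ} {x : DynFun E}
    (h : MemSBVLoc Ω x) (hΩ : IsOpen Ω) (hΩ' : Ω.OrdConnected) {t : ℝ} (ht : t ∈ Ω) : SGAt x t := by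
  obtain ⟨α, β, h1, h2, h3⟩ := exists_Icc_subset_of_mem hΩ hΩ' ht ht
  exact (h α β (h1.trans h2) h3).1.sgAt ⟨h1, h2⟩

/-! ### The distributional equation and the integral equation -/

section Equivalence

variable {n : ℕ} {D : Set (ℝ × (Fin n → ℝ))} {f : ℝ → (Fin n → ℝ) → (Fin n → ℝ)}
  {g : ℝ → (Fin n → ℝ) → ℝ → (Fin n → Fin n → ℝ)} {Kg : ℝ}
  {ρ : ℝ × ℝ → NNReal} {θ : ℝ × ℝ → (Fin n → ℝ)}
  {ν : Measure ℝ} {C : Set ℝ} [Countable C] {a b : ℝ} {x v : DynFun (Fin n → ℝ)} {t₀ : ℝ}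
  {x₀ : Fin n → ℝ} [IsFiniteMeasure ν] [NullSingletonClass ν]

/-- Testing with the indicator of the segment [p, q) turns the left side into the increment of x and
the right side into the integral of the field. -/
theorem IsSolution.sub_eq {Ω : Set ℝ}
    (hD : IsOpen D) (hf : IsCaratheodory D f) (hg : IsSGInTime D g)
    (hgL : ∀ t x y, (t, x) ∈ D → (t, y) ∈ D → ∀ s ∈ J, ‖g t x s - g t y s‖ ≤ Kg * ‖x - y‖)
    (hρm : Measurable ρ)
    (hρ : baseMeasure (volume.restrict (Ioo a b)) ∅ = (baseMeasure ν C).withDensity (fun p => ρ p))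
    (hv : HasDensity a b (baseMeasure ν C) θ v) (hΩ : IsOpen Ω) (hΩ' : Ω.OrdConnected)
    (hx : IsSolution D f g v t₀ x₀ Ω x) {p q : ℝ × ℝ} (hp : p ∈ dynTime a b) (hq : q ∈ dynTime a b)
    (hp' : p.1 ∈ Ω) (hq' : q.1 ∈ Ω) (hpq : toLex p ≤ toLex q) :
    x q.1 q.2 - x p.1 p.2 = ∫ r in seg p q, field f g ρ θ r (x r.1 r.2) ∂(baseMeasure ν C) := by
  obtain ⟨h1, h2, -, h3⟩ := hx
  obtain ⟨α, β, hα, hβ, hαβ⟩ := exists_Icc_subset_of_mem (hΩ.inter isOpen_Ioo)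
    (hΩ'.inter ordConnected_Ioo) (t := p.1) (t' := q.1) ⟨hp', hp.1⟩ ⟨hq', hq.1⟩
  have hle : p.1 ≤ q.1 := by
    rw [Prod.Lex.toLex_le_toLex] at hpq
    rcases hpq with h | h
    exacts [h.le, h.1.le]
  have hlt : α < β := by linarith
  have ha : a ≤ α := (hαβ (left_mem_Icc.2 hlt.le)).2.1.le
  have hb : β ≤ b := (hαβ (right_mem_Icc.2 hlt.le)).2.2.le
  have hΩs : Icc α β ⊆ Ω := fun t ht => (hαβ ht).1
  have hs : ∀ t ∈ Icc α β, SGAt x t := fun t ht => h1.sgAt hΩ hΩ' (hΩs ht)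
  have hp1 : p ∈ dynTime α β := ⟨⟨hα, by linarith⟩, hp.2⟩
  have hq1 : q ∈ dynTime α β := ⟨⟨by linarith, hβ⟩, hq.2⟩
  obtain ⟨K, hKD, hK, hxK⟩ := exists_compact_graph hD hs fun t ht => h2 t (hΩs ht)
  -- A density of x exists for some base measure unrelated to that of the control. This suffices:
  -- the pairing with the segment collapses to the increment of x, in which no measure is left.
  obtain ⟨ν₁, C₁, θ₁, hν₁, hν₁', hC₁, hθ₁, -⟩ := (h1 α β hlt hΩs).exists_hasDensity_pi hlt
  have : Countable C₁ := hC₁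
  have hφ := isTestFunction_segFun (α := α) (β := β) hp1.1 hq1.1
  have hi := integrableOn_field hD hf hg hgL hρm hρ ha hb (hv.mono ha hb).integrableOn
    (fun t ht => hs t (Ioo_subset_Icc_self ht)) hKD hK
    (fun t ht => hxK t (Ioo_subset_Icc_self ht))
  ext i
  have e1 := h3 α β hlt hΩs _ hφ i
  rw [integral_add_sum_derivPairing_eq hD hf hg hgL hρm hρ ha hb hlt hv
    (fun t ht => hs t (Ioo_subset_Icc_self ht)) hKD hK
    (fun t ht => hxK t (Ioo_subset_Icc_self ht)) hφ i, integral_segFun_mul hp1 hq1] at e1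
  have hbd : ∀ r : ℝ × ℝ, ‖segFun p q r.1 r.2‖ ≤ 1 := by
    intro r
    by_cases h : (r.1, r.2) ∈ seg p q
    · rw [segFun, indicator_of_mem h, norm_one]
    · rw [segFun, indicator_of_notMem h, norm_zero]
      exact zero_le_one
  rw [(hθ₁.apply i).derivPairing_eq hlt (hφ.aestronglyMeasurable_left ν₁)
    ((hθ₁.apply i).integrableOn.bdd_mul (c := 1)
      (aestronglyMeasurable_dynTime (hφ.aestronglyMeasurable_left ν₁)
        fun τ _ hτ => hφ.aestronglyMeasurable_right hτ) (Eventually.of_forall hbd)),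
    integral_segFun_mul hp1 hq1, ← (hθ₁.apply i).sub_eq p hp1 q hq1 hpq] at e1
  rw [Pi.sub_apply, e1, eval_integral fun i =>
    ((hi.mono_set (seg_subset_dynTime hp1 hq1)).eval i)]

/-- Both sides of the equation are integrals of the test function against the same density: the left
because the field is the density of x, the right by `integral_add_sum_derivPairing_eq`. -/
theorem isSolution_of_hasDensity (hab : a < b)
    (hD : IsOpen D) (hf : IsCaratheodory D f) (hg : IsSGInTime D g)
    (hgL : ∀ t x y, (t, x) ∈ D → (t, y) ∈ D → ∀ s ∈ J, ‖g t x s - g t y s‖ ≤ Kg * ‖x - y‖)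
    (hρm : Measurable ρ)
    (hρ : baseMeasure (volume.restrict (Ioo a b)) ∅ = (baseMeasure ν C).withDensity (fun p => ρ p))
    (hv : HasDensity a b (baseMeasure ν C) θ v)
    (hx : HasDensity a b (baseMeasure ν C) (fun p => field f g ρ θ p (x p.1 p.2)) x)
    {K : Set (ℝ × (Fin n → ℝ))} (hKD : K ⊆ D) (hK : IsCompact K)
    (hxK : ∀ t ∈ Ioo a b, ∀ s ∈ J, (t, x t s) ∈ K) (ht₀ : t₀ ∈ Ioo a b)
    (hx₀ : x t₀ (-1 / 2) = x₀) : IsSolution D f g v t₀ x₀ (Ioo a b) x := by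
  have hs : ∀ t ∈ Ioo a b, SGAt x t := fun t ht => (hx.memSG hab).sgAt ht
  refine ⟨fun α β hαβ hsub => (hx.mono (hsub (left_mem_Icc.2 hαβ.le)).1.le
    (hsub (right_mem_Icc.2 hαβ.le)).2.le).memSBV hαβ, fun t ht s hs => hKD (hxK t ht s hs),
    hx₀ ▸ (hs t₀ ht₀).left, fun α β hαβ hsub φ hφ i => ?_⟩
  have ha : a ≤ α := (hsub (left_mem_Icc.2 hαβ.le)).1.le
  have hb : β ≤ b := (hsub (right_mem_Icc.2 hαβ.le)).2.le
  have hsub' : Ioo α β ⊆ Ioo a b := Ioo_subset_Ioo ha hb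
  obtain ⟨M, hM0, hM⟩ := hφ.exists_bound
  rw [integral_add_sum_derivPairing_eq hD hf hg hgL hρm hρ ha hb hαβ hv
    (fun t ht => hs t (hsub' ht)) hKD hK (fun t ht => hxK t (hsub' ht)) hφ i]
  refine ((hx.mono ha hb).apply i).derivPairing_eq hαβ (hφ.aestronglyMeasurable_left ν) ?_
  refine ((hx.mono ha hb).apply i).integrableOn.bdd_mul (c := M)
    (aestronglyMeasurable_dynTime (hφ.aestronglyMeasurable_left ν)
        fun τ _ hτ => hφ.aestronglyMeasurable_right hτ) ?_
  exact (ae_restrict_iff' (measurableSet_dynTime α β)).2 (Eventually.of_forall fun p hp =>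
    hM p.1 hp.1 p.2 hp.2)

end Equivalence

/-! ### Primitives, the exponential weight and Gronwall's inequality -/

/-- The dynamic times between `p` and `q`. -/
def btw (p q : ℝ × ℝ) : Set (ℝ × ℝ) := seg p q ∪ seg q p

theorem measurableSet_btw (p q : ℝ × ℝ) : MeasurableSet (btw p q) :=
  (measurableSet_seg p q).union (measurableSet_seg q p)

theorem btw_eq_left {p q : ℝ × ℝ} (h : toLex p ≤ toLex q) : btw p q = seg p q := by
  rw [btw, seg_eq_empty h, union_empty]

theorem btw_eq_right {p q : ℝ × ℝ} (h : toLex q ≤ toLex p) : btw p q = seg q p := by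
  rw [btw, seg_eq_empty h, empty_union]

theorem btw_subset_dynTime {a b : ℝ} {p q : ℝ × ℝ} (hp : p ∈ dynTime a b) (hq : q ∈ dynTime a b) :
    btw p q ⊆ dynTime a b :=
  union_subset (seg_subset_dynTime hp hq) (seg_subset_dynTime hq hp)

section Primitive

variable {E : Type*} [NormedAddCommGroup E] [NormedSpace ℝ E] {a b : ℝ} {μ : Measure (ℝ × ℝ)}
  {θ : ℝ × ℝ → E} {w : DynFun E}

theorem HasDensity.norm_sub_le (h : HasDensity a b μ θ w) {p q : ℝ × ℝ} (hp : p ∈ dynTime a b)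
    (hq : q ∈ dynTime a b) : ‖w q.1 q.2 - w p.1 p.2‖ ≤ ∫ r in btw p q, ‖θ r‖ ∂μ := by
  rcases le_total (toLex p) (toLex q) with hpq | hpq
  · rw [h.sub_eq p hp q hq hpq, btw_eq_left hpq]
    exact norm_integral_le_integral_norm _
  · rw [norm_sub_rev, h.sub_eq q hq p hp hpq, btw_eq_right hpq]
    exact norm_integral_le_integral_norm _

theorem setIntegral_seg_add (hθ : IntegrableOn θ (dynTime a b) μ) {p q r : ℝ × ℝ}
    (hp : p ∈ dynTime a b) (hq : q ∈ dynTime a b) (hr : r ∈ dynTime a b)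
    (hpq : toLex p ≤ toLex q) (hqr : toLex q ≤ toLex r) :
    ∫ z in seg p r, θ z ∂μ = ∫ z in seg p q, θ z ∂μ + ∫ z in seg q r, θ z ∂μ := by
  rw [seg_union hpq hqr, setIntegral_union (seg_disjoint _ _ _) (measurableSet_seg _ _)
    (hθ.mono_set (seg_subset_dynTime hp hq)) (hθ.mono_set (seg_subset_dynTime hq hr))]

/-- The indefinite integral of a density with a given value at a given dynamic time. -/
def primitive (μ : Measure (ℝ × ℝ)) (θ : ℝ × ℝ → E) (p : ℝ × ℝ) (c : E) : DynFun E := fun t s =>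
  c + (∫ r in seg p (t, s), θ r ∂μ - ∫ r in seg (t, s) p, θ r ∂μ)

theorem primitive_self (p : ℝ × ℝ) (c : E) : primitive μ θ p c p.1 p.2 = c := by
  simp [primitive]

theorem hasDensity_primitive (hθ : IntegrableOn θ (dynTime a b) μ) {p : ℝ × ℝ}
    (hp : p ∈ dynTime a b) (c : E) : HasDensity a b μ θ (primitive μ θ p c) := by
  refine ⟨hθ, fun q hq r hr hqr => ?_⟩
  simp only [primitive, Prod.mk.eta]
  rcases le_total (toLex p) (toLex q) with hpq | hpq
  · rw [seg_eq_empty hpq, seg_eq_empty (hpq.trans hqr), setIntegral_seg_add hθ hp hq hr hpq hqr]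
    simp
  · rcases le_total (toLex p) (toLex r) with hpr | hpr
    · rw [seg_eq_empty hpr, seg_eq_empty hpq, setIntegral_seg_add hθ hq hp hr hpq hpr]
      simp [add_comm]
    · rw [seg_eq_empty hpr, seg_eq_empty hpq, setIntegral_seg_add hθ hq hr hp hqr hpr]
      simp

end Primitive

section Weight

/-- With F the primitive of k, the function exp(4F)/4 is absolutely continuous and has the integrand
as its derivative almost everywhere. -/
theorem integral_mul_exp {k : ℝ → ℝ} (hk : IntegrableOn k J) {s : ℝ} (hs : s ∈ J) :
    ∫ r in Ico (-1 / 2) s, k r * Real.exp (4 * ∫ z in Ico (-1 / 2) r, k z) =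
      (Real.exp (4 * ∫ z in Ico (-1 / 2) s, k z) - 1) / 4 := by
  have hle : (-1 / 2 : ℝ) ≤ 1 / 2 := by norm_num
  have hki : IntervalIntegrable k volume (-1 / 2) (1 / 2) := by
    rw [intervalIntegrable_iff_integrableOn_Icc_of_le hle]; exact hk
  set F : ℝ → ℝ := fun r => ∫ z in (-1 / 2 : ℝ)..r, k z
  have hF {r : ℝ} (hr : -1 / 2 ≤ r) : ∫ z in Ico (-1 / 2) r, k z = F r := by
    rw [integral_Ico_eq_integral_Ioc]
    exact (intervalIntegral.integral_of_le hr).symm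
  have hFac : AbsolutelyContinuousOnInterval F (-1 / 2) (1 / 2) :=
    hki.absolutelyContinuousOnInterval_intervalIntegral left_mem_uIcc
  obtain ⟨M, hM⟩ := hFac.exists_bound
  -- F is bounded, and the exponential is Lipschitz on bounded intervals; composition with a
  -- Lipschitz function preserves absolute continuity.
  have hexp : ContDiffOn ℝ 1 (fun y : ℝ => Real.exp (4 * y) / 4) (Icc (-M) M) := by fun_prop
  obtain ⟨L, hL⟩ := hexp.exists_lipschitzOnWith (by decide) (convex_Icc _ _) isCompact_Icc
  have hEac : AbsolutelyContinuousOnInterval (fun r => Real.exp (4 * F r) / 4) (-1 / 2) s := by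
    refine (absolutelyContinuousOnInterval_comp L.2 hFac fun x hx y hy => ?_).mono ?_
    · exact hL.dist_le_mul _ (abs_le.1 (hM x hx)) _ (abs_le.1 (hM y hy))
    · rw [uIcc_of_le hs.1, uIcc_of_le hle]
      exact Icc_subset_Icc_right hs.2
  have hd : ∀ᵐ r, r ∈ uIcc (-1 / 2 : ℝ) (1 / 2) → HasDerivAt F (k r) r := by
    filter_upwards [hki.ae_hasDerivAt_integral] with r hr hr'
    exact hr hr' _ left_mem_uIcc
  have e1 := hEac.integral_deriv_eq_sub
  rw [intervalIntegral.integral_of_le hs.1] at e1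
  rw [integral_Ico_eq_integral_Ioc, hF hs.1]
  have e2 : Real.exp (4 * F s) / 4 - Real.exp (4 * F (-1 / 2)) / 4 = (Real.exp (4 * F s) - 1) / 4 := by
    simp only [F, intervalIntegral.integral_same, mul_zero, Real.exp_zero]
    ring
  rw [← e2, ← e1]
  refine setIntegral_congr_ae measurableSet_Ioc ?_
  filter_upwards [hd] with r hr hr'
  rw [hF hr'.1.le]
  have h1 := hr (by rw [uIcc_of_le hle]; exact ⟨hr'.1.le, hr'.2.trans hs.2⟩)
  have h2 := ((h1.const_mul 4).exp.div_const 4).deriv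
  rw [h2]
  ring

variable {ν : Measure ℝ} {C : Set ℝ} {a b t₀ : ℝ} {κ : ℝ × ℝ → ℝ}

/-- The exponential weight which grows only during the time `t₀`. -/
def weight (κ : ℝ × ℝ → ℝ) (t₀ : ℝ) (p : ℝ × ℝ) : ℝ :=
  if p.1 < t₀ then 1 else if p.1 = t₀ then Real.exp (4 * ∫ r in Ico (-1 / 2) p.2, κ (t₀, r))
  else Real.exp (4 * ∫ r in J, κ (t₀, r))

theorem integral_Ico_le (hκ : ∀ p, 0 ≤ κ p) (hi : IntegrableOn (fun s => κ (t₀, s)) J) {s s' : ℝ}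
    (hs : s' ∈ J) (hss : s ≤ s') :
    ∫ r in Ico (-1 / 2) s, κ (t₀, r) ≤ ∫ r in Ico (-1 / 2) s', κ (t₀, r) :=
  setIntegral_mono_set (hi.mono_set (show Ico (-1 / 2) s' ⊆ J from fun _ hr => ⟨hr.1, hr.2.le.trans hs.2⟩))
    (Eventually.of_forall fun _ => hκ _) (Ico_subset_Ico_right hss).eventuallyLE

theorem one_le_weight (hκ : ∀ p, 0 ≤ κ p) (p : ℝ × ℝ) : 1 ≤ weight κ t₀ p := by
  rw [weight]
  split_ifs
  · exact le_rfl
  · exact Real.one_le_exp (mul_nonneg (by norm_num) (integral_nonneg fun r => hκ _))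
  · exact Real.one_le_exp (mul_nonneg (by norm_num) (integral_nonneg fun r => hκ _))

theorem weight_le (hκ : ∀ p, 0 ≤ κ p) (hi : IntegrableOn (fun s => κ (t₀, s)) J) {p : ℝ × ℝ}
    (hp : p.2 ∈ J) : weight κ t₀ p ≤ Real.exp (4 * ∫ r in J, κ (t₀, r)) := by
  rw [weight]
  split_ifs
  · exact Real.one_le_exp (mul_nonneg (by norm_num) (integral_nonneg fun r => hκ _))
  · refine Real.exp_le_exp.2 (mul_le_mul_of_nonneg_left ?_ (by norm_num))
    exact setIntegral_mono_set hi (Eventually.of_forall fun _ => hκ _)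
      (show Ico (-1 / 2) p.2 ⊆ J from fun _ hr => ⟨hr.1, hr.2.le.trans hp.2⟩).eventuallyLE
  · exact le_rfl

theorem aestronglyMeasurable_weight [Countable C] (hκ : ∀ p, 0 ≤ κ p)
    (hi : IntegrableOn (fun s => κ (t₀, s)) J) :
    AEStronglyMeasurable (weight κ t₀) ((baseMeasure ν C).restrict (dynTime a b)) := by
  have h1 : MeasurableSet {t : ℝ | t < t₀} := measurableSet_Iio
  have h2 : MeasurableSet {t : ℝ | t = t₀} := measurableSet_singleton t₀
  refine aestronglyMeasurable_dynTime (Measurable.aestronglyMeasurable ?_) fun τ _ _ => ?_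
  · exact Measurable.ite h1 measurable_const (Measurable.ite h2
      (measurable_const (a := Real.exp (4 * ∫ r in Ico (-1 / 2) (-1 / 2), κ (t₀, r)))) measurable_const)
  · rcases lt_trichotomy τ t₀ with h | rfl | h
    · simp only [weight, h, if_true]
      exact aestronglyMeasurable_const
    · simp only [weight, lt_irrefl, if_false, if_true]
      refine (aemeasurable_restrict_of_monotoneOn measurableSet_J fun s _ s' hs' hss => ?_).aestronglyMeasurable
      exact Real.exp_le_exp.2 (mul_le_mul_of_nonneg_left (integral_Ico_le hκ hi hs' hss) (by norm_num))
    · simp only [weight, h.not_gt, h.ne', if_false]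
      exact aestronglyMeasurable_const

theorem integrableOn_mul_weight [Countable C] (hκ : ∀ p, 0 ≤ κ p)
    (hi : IntegrableOn (fun s => κ (t₀, s)) J)
    (hκi : IntegrableOn κ (dynTime a b) (baseMeasure ν C)) :
    IntegrableOn (fun p => κ p * weight κ t₀ p) (dynTime a b) (baseMeasure ν C) := by
  refine hκi.mul_bdd (c := Real.exp (4 * ∫ r in J, κ (t₀, r))) (aestronglyMeasurable_weight hκ hi) ?_
  refine (ae_restrict_iff' (measurableSet_dynTime a b)).2 (Eventually.of_forall fun p hp => ?_)
  rw [Real.norm_of_nonneg (zero_le_one.trans (one_le_weight hκ p))]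
  exact weight_le hκ hi hp.2

/-- Before t₀ the weight is 1 and κ has mass at most 1/4. During t₀ the integral equals (W - 1)/4.
After t₀ the weight is constant, and the total is at most (W - 1)/4 + W/4. Each is at most W/2,
which gives the contraction factor 1/2 however large κ is on the fibre. -/
theorem integral_mul_weight_le [Countable C] [NullSingletonClass ν] (hκ : ∀ p, 0 ≤ κ p)
    (hκi : IntegrableOn κ (dynTime a b) (baseMeasure ν C)) (ht₀ : t₀ ∈ Ioo a b) (hC : t₀ ∈ C)
    (hoff : ∫ p in dynTime a b ∩ {p | p.1 ≠ t₀}, κ p ∂(baseMeasure ν C) ≤ 1 / 4)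
    {q : ℝ × ℝ} (hq : q ∈ dynTime a b) :
    ∫ p in btw (t₀, -1 / 2) q, κ p * weight κ t₀ p ∂(baseMeasure ν C) ≤ weight κ t₀ q / 2 := by
  have hi : IntegrableOn (fun s => κ (t₀, s)) J := by
    refine (IntegrableOn.baseMeasure_right (measurableSet_dynTime a b) hκi hC).mono_set ?_
    exact fun s hs => ⟨hs, ht₀, hs⟩
  have hWi := integrableOn_mul_weight hκ hi hκi
  have hp0 : (t₀, (-1 / 2 : ℝ)) ∈ dynTime a b := ⟨ht₀, left_mem_J⟩
  have hp1 : (t₀, (1 / 2 : ℝ)) ∈ dynTime a b := ⟨ht₀, right_mem_J⟩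
  have hoffi : IntegrableOn κ (dynTime a b ∩ {p | p.1 ≠ t₀}) (baseMeasure ν C) :=
    hκi.mono_set inter_subset_left
  have hslice (s : ℝ) (hs : s ∈ J) :
      ∫ p in seg (t₀, -1 / 2) (t₀, s), κ p * weight κ t₀ p ∂(baseMeasure ν C) =
        (weight κ t₀ (t₀, s) - 1) / 4 := by
    rw [setIntegral_seg_right left_mem_J hs (hWi.mono_set (seg_subset_dynTime hp0 ⟨ht₀, hs⟩)),
      if_pos hC]
    simp only [weight, lt_irrefl, if_false, if_true]
    exact integral_mul_exp hi hs
  rcases lt_trichotomy q.1 t₀ with h | h | h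
  · have hle : toLex q ≤ toLex (t₀, (-1 / 2 : ℝ)) := Prod.Lex.toLex_le_toLex.2 (Or.inl h)
    have hlt : ∀ p ∈ seg q (t₀, -1 / 2), p.1 < t₀ := by
      intro p hp
      rw [mem_seg] at hp
      rcases hp.2.2 with h | h
      · exact h
      · exact absurd h.2 (not_lt.2 hp.1.1)
    rw [btw_eq_right hle, setIntegral_congr_fun (g := κ) (measurableSet_seg _ _) fun p hp => by
      simp only [weight, hlt p hp, if_true, mul_one]]
    have h1 : weight κ t₀ q = 1 := by simp [weight, h]
    rw [h1]
    refine (setIntegral_mono_set hoffi (Eventually.of_forall fun _ => hκ _)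
      (show seg q (t₀, -1 / 2) ⊆ dynTime a b ∩ {p | p.1 ≠ t₀} from fun p hp => ⟨seg_subset_dynTime hq hp0 hp,
        (hlt p hp).ne⟩).eventuallyLE).trans (hoff.trans (by norm_num))
  · obtain ⟨t, s⟩ := q
    obtain rfl : t = t₀ := h
    rw [btw_eq_left (toLex_left_le hq.2), hslice s hq.2]
    linarith [one_le_weight hκ (t₀ := t) (t, s)]
  · have hle : toLex (t₀, (1 / 2 : ℝ)) ≤ toLex q := Prod.Lex.toLex_le_toLex.2 (Or.inl h)
    have hW : weight κ t₀ (t₀, 1 / 2) = weight κ t₀ q := by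
      simp only [weight, lt_irrefl, if_false, if_true, h.not_gt, h.ne']
      rw [J, integral_Icc_eq_integral_Ico]
    rw [btw_eq_left ((toLex_left_le right_mem_J).trans hle), setIntegral_seg_add hWi hp0 hp1 hq
      (toLex_left_le right_mem_J) hle, hslice _ right_mem_J, hW]
    have hge : ∀ p ∈ seg (t₀, 1 / 2) q, t₀ < p.1 ∨ p = (t₀, 1 / 2) := by
      intro p hp
      rw [mem_seg] at hp
      rcases hp.2.1 with h | h
      · exact Or.inl h
      · exact Or.inr (Prod.ext h.1.symm (le_antisymm hp.1.2 h.2))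
    rw [setIntegral_congr_fun (g := fun p => κ p * weight κ t₀ q) (measurableSet_seg _ _) fun p hp => by
      rcases hge p hp with h1 | h1
      · simp only [weight, h1.not_gt, h1.ne', h.not_gt, h.ne', if_false]
      · simp only [h1, hW], integral_mul_const]
    have h2 : ∫ p in seg (t₀, 1 / 2) q, κ p ∂(baseMeasure ν C) ≤ 1 / 4 := by
      refine (setIntegral_mono_set hoffi (Eventually.of_forall fun _ => hκ _) ?_).trans hoff
      have h3 : ∀ᵐ p ∂(baseMeasure ν C), p ≠ (t₀, 1 / 2) := by
        rw [ae_iff]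
        simp only [not_not]
        exact baseMeasure_singleton _
      filter_upwards [h3] with p hp1' hp'
      refine ⟨seg_subset_dynTime hp1 hq hp', ?_⟩
      rcases hge p hp' with h4 | h4
      · exact h4.ne'
      · exact absurd h4 hp1'
    have h4 := one_le_weight hκ (t₀ := t₀) q
    nlinarith

/-- Gronwall's inequality on dynamic time. -/
theorem le_of_le_add_integral [Countable C] [NullSingletonClass ν] (hκ : ∀ p, 0 ≤ κ p)
    (hκi : IntegrableOn κ (dynTime a b) (baseMeasure ν C)) (ht₀ : t₀ ∈ Ioo a b) (hC : t₀ ∈ C)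
    (hoff : ∫ p in dynTime a b ∩ {p | p.1 ≠ t₀}, κ p ∂(baseMeasure ν C) ≤ 1 / 4)
    {e : ℝ × ℝ → ℝ} {η B : ℝ} (he0 : ∀ p, 0 ≤ e p) (heB : ∀ p ∈ dynTime a b, e p ≤ B)
    (he : ∀ q ∈ dynTime a b, e q ≤ η + ∫ p in btw (t₀, -1 / 2) q, κ p * e p ∂(baseMeasure ν C))
    {q : ℝ × ℝ} (hq : q ∈ dynTime a b) : e q ≤ 2 * η * weight κ t₀ q := by
  have hi : IntegrableOn (fun s => κ (t₀, s)) J := by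
    refine (IntegrableOn.baseMeasure_right (measurableSet_dynTime a b) hκi hC).mono_set ?_
    exact fun s hs => ⟨hs, ht₀, hs⟩
  have hp0 : (t₀, (-1 / 2 : ℝ)) ∈ dynTime a b := ⟨ht₀, left_mem_J⟩
  have hW0 (p : ℝ × ℝ) : 0 < weight κ t₀ p := zero_lt_one.trans_le (one_le_weight hκ p)
  -- Let d be the supremum of e/W, which is finite since e is bounded and W ≥ 1. The weighted
  -- estimate gives d ≤ η + d/2, that is d ≤ 2η.
  set A := (fun p => e p / weight κ t₀ p) '' dynTime a b
  have hA : BddAbove A := by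
    refine ⟨B, ?_⟩
    rintro _ ⟨p, hp, rfl⟩
    exact (div_le_self (he0 p) (one_le_weight hκ p)).trans (heB p hp)
  set d := sSup A
  have hd {p : ℝ × ℝ} (hp : p ∈ dynTime a b) : e p ≤ d * weight κ t₀ p :=
    (div_le_iff₀ (hW0 p)).1 (le_csSup hA (mem_image_of_mem _ hp))
  have hd0 : 0 ≤ d := by
    have := (he0 _).trans (hd hp0)
    exact nonneg_of_mul_nonneg_left this (hW0 _)
  have hη : d ≤ η + d / 2 := by
    refine csSup_le ⟨_, mem_image_of_mem _ hp0⟩ ?_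
    rintro _ ⟨p, hp, rfl⟩
    rw [div_le_iff₀ (hW0 p)]
    have h1 : ∫ r in btw (t₀, -1 / 2) p, κ r * e r ∂(baseMeasure ν C) ≤
        ∫ r in btw (t₀, -1 / 2) p, d * (κ r * weight κ t₀ r) ∂(baseMeasure ν C) := by
      refine integral_mono_of_nonneg (Eventually.of_forall fun r => mul_nonneg (hκ r) (he0 r))
        (((integrableOn_mul_weight hκ hi hκi).mono_set (btw_subset_dynTime hp0 hp)).const_mul d) ?_
      refine (ae_restrict_iff' (measurableSet_btw _ _)).2 (Eventually.of_forall fun r hr => ?_)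
      have := mul_le_mul_of_nonneg_left (hd (btw_subset_dynTime hp0 hp hr)) (hκ r)
      calc κ r * e r ≤ κ r * (d * weight κ t₀ r) := this
        _ = d * (κ r * weight κ t₀ r) := by ring
    rw [integral_const_mul] at h1
    have h2 := mul_le_mul_of_nonneg_left (integral_mul_weight_le hκ hκi ht₀ hC hoff hp) hd0
    have h3 := he p hp
    -- A negative η is impossible: at (t₀, -1/2) the domain of integration is empty and the
    -- assumption reads e ≤ η, whereas e ≥ 0.
    have hη0 : 0 ≤ η ∨ η < 0 := le_or_gt 0 η
    rcases hη0 with hη0 | hη0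
    · have h4 := le_mul_of_one_le_right hη0 (one_le_weight hκ (t₀ := t₀) p)
      linarith
    · have h5 := he _ hp0
      rw [btw, seg_eq_empty le_rfl, union_empty, setIntegral_empty] at h5
      linarith [he0 (t₀, -1 / 2)]
  have := hd hq
  have h6 : d ≤ 2 * η := by linarith
  exact this.trans (mul_le_mul_of_nonneg_right h6 (hW0 q).le)

end Weight

/-! ### Successive approximations and comparison of indefinite integrals -/

section Existence

variable {n : ℕ} {D : Set (ℝ × (Fin n → ℝ))} {f : ℝ → (Fin n → ℝ) → (Fin n → ℝ)}
  {g : ℝ → (Fin n → ℝ) → ℝ → (Fin n → Fin n → ℝ)} {Kf Kg : ℝ}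
  {ρ : ℝ × ℝ → NNReal} {θ θ' θc : ℝ × ℝ → (Fin n → ℝ)}
  {ν : Measure ℝ} {C : Set ℝ} {a b t₀ : ℝ} {x y c v : DynFun (Fin n → ℝ)}
  {x₀ : Fin n → ℝ}

/-- The assumptions on the right hand side of the equation. -/
structure IsLipschitzField (D : Set (ℝ × (Fin n → ℝ))) (f : ℝ → (Fin n → ℝ) → (Fin n → ℝ))
    (g : ℝ → (Fin n → ℝ) → ℝ → (Fin n → Fin n → ℝ)) (Kf Kg : ℝ) : Prop where
  isOpen : IsOpen D
  caratheodory : IsCaratheodory D f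
  sg : IsSGInTime D g
  lip_f : ∀ t x y, (t, x) ∈ D → (t, y) ∈ D → ‖f t x - f t y‖ ≤ Kf * ‖x - y‖
  lip_g : ∀ t x y, (t, x) ∈ D → (t, y) ∈ D → ∀ s ∈ J, ‖g t x s - g t y s‖ ≤ Kg * ‖x - y‖

/-- `ρ` is the density of Lebesgue measure on the ordinary times of `(a, b)`. -/
structure IsTimeDensity (a b : ℝ) (ν : Measure ℝ) (C : Set ℝ) (ρ : ℝ × ℝ → NNReal) : Prop where
  measurable : Measurable ρ
  eq : baseMeasure (volume.restrict (Ioo a b)) ∅ = (baseMeasure ν C).withDensity (fun p => ρ p)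

theorem lipField_nonneg (p : ℝ × ℝ) : 0 ≤ lipField n Kf Kg ρ θ p := by
  have : (0 : ℝ) ≤ ρ p := (ρ p).2
  rw [lipField]
  positivity

variable [Countable C]

theorem IsTimeDensity.integrableOn (hρ : IsTimeDensity a b ν C ρ) :
    IntegrableOn (fun p => (ρ p : ℝ)) (dynTime a b) (baseMeasure ν C) := by
  have := integrableOn_time (F := fun _ => (1 : ℝ)) hρ.measurable hρ.eq le_rfl le_rfl
    (integrableOn_const measure_Ioo_lt_top.ne)
  simpa using this

theorem integrableOn_lipField (hρ : IsTimeDensity a b ν C ρ)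
    (hθ : IntegrableOn θ (dynTime a b) (baseMeasure ν C)) :
    IntegrableOn (lipField n Kf Kg ρ θ) (dynTime a b) (baseMeasure ν C) :=
  (hρ.integrableOn.const_mul |Kf|).add (hθ.norm.const_mul (n * |Kg|))

variable [NullSingletonClass ν] [IsFiniteMeasure ν]

theorem HasDensity.sgAt {E : Type*} [NormedAddCommGroup E] [NormedSpace ℝ E] [CompleteSpace E]
    {θ : ℝ × ℝ → E} {x : DynFun E} (h : HasDensity a b (baseMeasure ν C) θ x) {t : ℝ}
    (ht : t ∈ Ioo a b) : SGAt x t :=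
  (h.memSG (ht.1.trans ht.2)).sgAt ht

/-- Existence by successive approximations in a tube around an approximate solution. -/
theorem exists_hasDensity_field (hF : IsLipschitzField D f g Kf Kg) (hρ : IsTimeDensity a b ν C ρ)
    (hθ : IntegrableOn θ (dynTime a b) (baseMeasure ν C)) (ht₀ : t₀ ∈ Ioo a b) (hC : t₀ ∈ C)
    (hc : HasDensity a b (baseMeasure ν C) θc c) (hc₀ : c t₀ (-1 / 2) = x₀)
    {K : Set (ℝ × (Fin n → ℝ))} (hKD : K ⊆ D) (hK : IsCompact K) {δ η Wm : ℝ}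
    (htube : ∀ p ∈ dynTime a b, ∀ ξ, ‖ξ - c p.1 p.2‖ ≤ δ → (p.1, ξ) ∈ K)
    (hoff : ∫ p in dynTime a b ∩ {p | p.1 ≠ t₀}, lipField n Kf Kg ρ θ p ∂(baseMeasure ν C) ≤ 1 / 4)
    (hη : ∫ p in dynTime a b, ‖field f g ρ θ p (c p.1 p.2) - θc p‖ ∂(baseMeasure ν C) ≤ η)
    (hW : ∀ p ∈ dynTime a b, weight (lipField n Kf Kg ρ θ) t₀ p ≤ Wm) (hδ : 2 * η * Wm ≤ δ) :
    ∃ x : DynFun (Fin n → ℝ),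
      HasDensity a b (baseMeasure ν C) (fun p => field f g ρ θ p (x p.1 p.2)) x ∧
      x t₀ (-1 / 2) = x₀ ∧ ∀ p ∈ dynTime a b, ‖x p.1 p.2 - c p.1 p.2‖ ≤ δ := by
  set μ := baseMeasure ν C
  set κ := lipField n Kf Kg ρ θ
  have hκ : ∀ p, 0 ≤ κ p := lipField_nonneg
  have hκi : IntegrableOn κ (dynTime a b) μ := integrableOn_lipField hρ hθ
  have hi₀ : IntegrableOn (fun s => κ (t₀, s)) J := by
    refine (IntegrableOn.baseMeasure_right (measurableSet_dynTime a b) hκi hC).mono_set ?_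
    exact fun s hs => ⟨hs, ht₀, hs⟩
  set W := weight κ t₀
  have hW1 (p : ℝ × ℝ) : 1 ≤ W p := one_le_weight hκ p
  have hp0 : (t₀, (-1 / 2 : ℝ)) ∈ dynTime a b := ⟨ht₀, left_mem_J⟩
  have hη0 : 0 ≤ η := (integral_nonneg fun _ => norm_nonneg _).trans hη
  have hδ0 : 0 ≤ δ := by
    have := (zero_le_one.trans (hW1 _)).trans (hW _ hp0)
    exact le_trans (by positivity) hδ
  -- The Picard iterates, started from the approximate solution c.
  obtain ⟨X, hX0, hXs⟩ : ∃ X : ℕ → DynFun (Fin n → ℝ), X 0 = c ∧ ∀ k, X (k + 1) =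
      primitive μ (fun p => field f g ρ θ p (X k p.1 p.2)) (t₀, -1 / 2) x₀ :=
    ⟨fun k => Nat.rec c
      (fun _ z => primitive μ (fun p => field f g ρ θ p (z p.1 p.2)) (t₀, -1 / 2) x₀) k, rfl,
      fun _ => rfl⟩
  have hinK {z : DynFun (Fin n → ℝ)} (hz : ∀ p ∈ dynTime a b, ‖z p.1 p.2 - c p.1 p.2‖ ≤ δ) :
      ∀ t ∈ Ioo a b, ∀ s ∈ J, (t, z t s) ∈ K := fun t ht s hs => htube (t, s) ⟨ht, hs⟩ _ (hz (t, s) ⟨ht, hs⟩)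
  have hfi {z : DynFun (Fin n → ℝ)} {θz} (hz : HasDensity a b μ θz z)
      (hz' : ∀ p ∈ dynTime a b, ‖z p.1 p.2 - c p.1 p.2‖ ≤ δ) :
      IntegrableOn (fun p => field f g ρ θ p (z p.1 p.2)) (dynTime a b) μ :=
    integrableOn_field hF.isOpen hF.caratheodory hF.sg hF.lip_g hρ.measurable hρ.eq le_rfl le_rfl hθ
      (fun t ht => hz.sgAt ht) hKD hK (hinK hz')
  have hlip {p : ℝ × ℝ} (hp : p ∈ dynTime a b) {ξ ζ : Fin n → ℝ} (hξ : ‖ξ - c p.1 p.2‖ ≤ δ)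
      (hζ : ‖ζ - c p.1 p.2‖ ≤ δ) : ‖field f g ρ θ p ξ - field f g ρ θ p ζ‖ ≤ κ p * ‖ξ - ζ‖ := by
    have := norm_field_sub_le (ρ := ρ) (θ := θ) (θ' := θ) hF.lip_f hF.lip_g hp.2 (hKD (htube p hp ξ hξ))
      (hKD (htube p hp ζ hζ))
    simpa using this
  -- Three facts are carried along together: a density, hence the measurability of the next
  -- integrand; the distance to c, a partial geometric sum which never exceeds 2ηW ≤ δ, so that the
  -- iterate stays in the tube; and the increment, halved at each step.
  have key (k : ℕ) : (∃ θz, HasDensity a b μ θz (X k)) ∧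
      (∀ p ∈ dynTime a b, ‖X k p.1 p.2 - c p.1 p.2‖ ≤ 2 * η * (1 - (1 / 2) ^ k) * W p) ∧
      ∀ p ∈ dynTime a b, ‖X (k + 1) p.1 p.2 - X k p.1 p.2‖ ≤ η * (1 / 2) ^ k * W p := by
    have htoδ {k : ℕ} (h : ∀ p ∈ dynTime a b,
        ‖X k p.1 p.2 - c p.1 p.2‖ ≤ 2 * η * (1 - (1 / 2) ^ k) * W p) :
        ∀ p ∈ dynTime a b, ‖X k p.1 p.2 - c p.1 p.2‖ ≤ δ := by
      intro p hp
      refine ((h p hp).trans ?_).trans ((mul_le_mul_of_nonneg_left (hW p hp)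
        (by positivity : 0 ≤ 2 * η)).trans hδ)
      refine mul_le_mul_of_nonneg_right ?_ (zero_le_one.trans (hW1 p))
      refine mul_le_of_le_one_right (by positivity) ?_
      have : (0 : ℝ) ≤ (1 / 2) ^ k := by positivity
      linarith
    have hzero {k : ℕ} : X k t₀ (-1 / 2) = x₀ := by
      cases k with
      | zero => rw [hX0, hc₀]
      | succ k => rw [hXs]; exact primitive_self (t₀, -1 / 2) x₀
    induction k with
    | zero =>
      refine ⟨⟨θc, hX0 ▸ hc⟩, fun p hp => by simp [hX0], fun p hp => ?_⟩
      rw [hXs, hX0]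
      have hci := hfi hc (fun p hp => by simpa using hδ0)
      have h1 := ((hasDensity_primitive hci hp0 x₀).sub hc).norm_sub_le hp0 hp
      simp only [Pi.sub_apply] at h1
      have h2 : primitive μ (fun p => field f g ρ θ p (c p.1 p.2)) (t₀, -1 / 2) x₀ t₀ (-1 / 2) -
          c t₀ (-1 / 2) = 0 := by
        rw [hc₀, sub_eq_zero]; exact primitive_self (t₀, -1 / 2) x₀
      rw [h2, sub_zero] at h1
      rw [pow_zero, mul_one]
      refine (h1.trans ((setIntegral_mono_set (hci.sub hc.integrableOn).norm
        (Eventually.of_forall fun _ => norm_nonneg _)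
        (btw_subset_dynTime hp0 hp).eventuallyLE).trans hη)).trans
        (le_mul_of_one_le_right hη0 (hW1 p))
    | succ k ih =>
      obtain ⟨⟨θz, hz⟩, h1, h2⟩ := ih
      have hi := hfi hz (htoδ h1)
      have hd := hasDensity_primitive hi hp0 x₀
      rw [← hXs] at hd
      have h3 : ∀ p ∈ dynTime a b,
          ‖X (k + 1) p.1 p.2 - c p.1 p.2‖ ≤ 2 * η * (1 - (1 / 2) ^ (k + 1)) * W p := by
        intro p hp
        have e := norm_sub_le_norm_sub_add_norm_sub (X (k + 1) p.1 p.2) (X k p.1 p.2) (c p.1 p.2)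
        refine (e.trans (add_le_add (h2 p hp) (h1 p hp))).trans_eq ?_
        rw [pow_succ]
        ring
      have hi' := hfi hd (htoδ h3)
      refine ⟨⟨_, hd⟩, h3, fun p hp => ?_⟩
      have hd' := hasDensity_primitive hi' hp0 x₀
      rw [← hXs] at hd'
      have h4 := (hd'.sub hd).norm_sub_le hp0 hp
      simp only [Pi.sub_apply] at h4
      have h5 : X (k + 1 + 1) t₀ (-1 / 2) - X (k + 1) t₀ (-1 / 2) = 0 := by rw [hzero, hzero, sub_self]
      rw [h5, sub_zero] at h4
      refine h4.trans ?_
      have h6 : ∫ r in btw (t₀, -1 / 2) p, ‖field f g ρ θ r (X (k + 1) r.1 r.2) -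
          field f g ρ θ r (X k r.1 r.2)‖ ∂μ ≤
          ∫ r in btw (t₀, -1 / 2) p, η * (1 / 2) ^ k * (κ r * W r) ∂μ := by
        refine integral_mono_of_nonneg (Eventually.of_forall fun r => norm_nonneg _)
          (((integrableOn_mul_weight hκ hi₀ hκi).mono_set (btw_subset_dynTime hp0 hp)).const_mul _) ?_
        refine (ae_restrict_iff' (measurableSet_btw _ _)).2 (Eventually.of_forall fun r hr => ?_)
        have hr' := btw_subset_dynTime hp0 hp hr
        refine (hlip hr' (htoδ h3 r hr') (htoδ h1 r hr')).trans ?_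
        refine (mul_le_mul_of_nonneg_left (h2 r hr') (hκ r)).trans_eq ?_
        ring
      rw [integral_const_mul] at h6
      refine h6.trans ((mul_le_mul_of_nonneg_left
        (integral_mul_weight_le hκ hκi ht₀ hC hoff hp) (by positivity)).trans_eq ?_)
      rw [pow_succ]
      ring
  have hXδ (k : ℕ) : ∀ p ∈ dynTime a b, ‖X k p.1 p.2 - c p.1 p.2‖ ≤ δ := by
    intro p hp
    refine (((key k).2.1 p hp).trans ?_).trans ((mul_le_mul_of_nonneg_left (hW p hp)
      (by positivity : 0 ≤ 2 * η)).trans hδ)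
    refine mul_le_mul_of_nonneg_right ?_ (zero_le_one.trans (hW1 p))
    refine mul_le_of_le_one_right (by positivity) ?_
    have : (0 : ℝ) ≤ (1 / 2) ^ k := by positivity
    linarith
  have hconv : ∀ p ∈ dynTime a b, ∃ z, Tendsto (fun k => X k p.1 p.2) atTop (𝓝 z) := by
    intro p hp
    refine cauchySeq_tendsto_of_complete (cauchySeq_of_le_geometric (1 / 2) (η * W p) (by norm_num)
      fun k => ?_)
    rw [dist_comm, dist_eq_norm]
    refine ((key k).2.2 p hp).trans_eq ?_
    ring
  choose! z hz using hconv
  set x : DynFun (Fin n → ℝ) := fun t s => z (t, s)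
  have hx : ∀ p ∈ dynTime a b, Tendsto (fun k => X k p.1 p.2) atTop (𝓝 (x p.1 p.2)) := hz
  have hxδ : ∀ p ∈ dynTime a b, ‖x p.1 p.2 - c p.1 p.2‖ ≤ δ := fun p hp =>
    le_of_tendsto ((hx p hp).sub_const _).norm (Eventually.of_forall fun k => hXδ k p hp)
  have hx₀ : x t₀ (-1 / 2) = x₀ := by
    refine tendsto_nhds_unique ((hx _ hp0).comp (tendsto_add_atTop_nat 1)) ?_
    exact tendsto_const_nhds.congr fun k => by
      rw [Function.comp_apply, hXs]; exact (primitive_self (t₀, -1 / 2) x₀).symm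
  have hXi (k : ℕ) : IntegrableOn (fun p => field f g ρ θ p (X k p.1 p.2)) (dynTime a b) μ :=
    hfi (key k).1.choose_spec (hXδ k)
  have hlim : ∀ p ∈ dynTime a b, Tendsto (fun k => field f g ρ θ p (X k p.1 p.2)) atTop
      (𝓝 (field f g ρ θ p (x p.1 p.2))) := by
    intro p hp
    rw [tendsto_iff_norm_sub_tendsto_zero]
    refine squeeze_zero (fun _ => norm_nonneg _) (fun k => hlip hp (hXδ k p hp) (hxδ p hp)) ?_
    simpa using (tendsto_iff_norm_sub_tendsto_zero.1 (hx p hp)).const_mul (κ p)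
  have hbi : IntegrableOn (fun p => ‖field f g ρ θ p (c p.1 p.2)‖ + κ p * δ) (dynTime a b) μ :=
    (hX0 ▸ hXi 0 : IntegrableOn (fun p => field f g ρ θ p (c p.1 p.2)) (dynTime a b) μ).norm.add
      (hκi.mul_const δ)
  have hbd {p : ℝ × ℝ} (hp : p ∈ dynTime a b) {ξ : Fin n → ℝ} (hξ : ‖ξ - c p.1 p.2‖ ≤ δ) :
      ‖field f g ρ θ p ξ‖ ≤ ‖field f g ρ θ p (c p.1 p.2)‖ + κ p * δ := by
    have h1 := norm_sub_norm_le (field f g ρ θ p ξ) (field f g ρ θ p (c p.1 p.2))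
    have h2 := hlip hp hξ (ζ := c p.1 p.2) (by simpa using hδ0)
    have h3 := mul_le_mul_of_nonneg_left hξ (hκ p)
    linarith
  have hall {P : ℝ × ℝ → Prop} (h : ∀ p ∈ dynTime a b, P p) : ∀ᵐ p ∂(μ.restrict (dynTime a b)), P p :=
    (ae_restrict_iff' (measurableSet_dynTime a b)).2 (Eventually.of_forall h)
  have hxi : IntegrableOn (fun p => field f g ρ θ p (x p.1 p.2)) (dynTime a b) μ := by
    refine hbi.mono' (aestronglyMeasurable_of_tendsto_ae atTop
      (fun k => (hXi k).aestronglyMeasurable) (hall hlim)) (hall fun p hp => hbd hp (hxδ p hp))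
  refine ⟨x, ⟨hxi, fun p hp q hq hpq => ?_⟩, hx₀, hxδ⟩
  have hsub := seg_subset_dynTime hp hq
  -- The increments of the iterate k + 1 are integrals of the field along the iterate k, so the left
  -- side is shifted by one before passing to the limit.
  refine tendsto_nhds_unique (((hx q hq).sub (hx p hp)).comp (tendsto_add_atTop_nat 1))
    (Tendsto.congr (fun k => ?_) (f₁ := fun k => ∫ r in seg p q, field f g ρ θ r (X k r.1 r.2) ∂μ) ?_)
  · rw [Function.comp_apply, hXs]
    exact ((hasDensity_primitive (hXi k) hp0 x₀).sub_eq p hp q hq hpq).symm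
  refine tendsto_integral_of_dominated_convergence
    (fun p => ‖field f g ρ θ p (c p.1 p.2)‖ + κ p * δ)
    (fun k => ((hXi k).mono_set hsub).aestronglyMeasurable) (hbi.mono_set hsub)
    (fun k => ae_restrict_of_ae_restrict_of_subset hsub (hall fun p hp => hbd hp (hXδ k p hp)))
    (ae_restrict_of_ae_restrict_of_subset hsub (hall hlim))

/-- Comparison of two solutions for different controls. -/
theorem norm_sub_le_of_hasDensity (hF : IsLipschitzField D f g Kf Kg) (hρ : IsTimeDensity a b ν C ρ)
    (hθ : IntegrableOn θ (dynTime a b) (baseMeasure ν C))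
    (hθ' : IntegrableOn θ' (dynTime a b) (baseMeasure ν C)) (hC : t₀ ∈ C)
    (hoff : ∫ p in dynTime a b ∩ {p | p.1 ≠ t₀}, lipField n Kf Kg ρ θ' p ∂(baseMeasure ν C) ≤ 1 / 4)
    {η Wm G : ℝ} (hG : 0 ≤ G)
    (hW : ∀ p ∈ dynTime a b, weight (lipField n Kf Kg ρ θ') t₀ p ≤ Wm)
    (hη : n * G * ∫ p in dynTime a b, ‖θ' p - θ p‖ ∂(baseMeasure ν C) ≤ η)
    {α β : ℝ} (ha : a ≤ α) (hb : β ≤ b) (ht₀ : t₀ ∈ Ioo α β)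
    (hx : HasDensity α β (baseMeasure ν C) (fun p => field f g ρ θ p (x p.1 p.2)) x)
    (hxD : ∀ p ∈ dynTime α β, (p.1, x p.1 p.2) ∈ D)
    (hxG : ∀ p ∈ dynTime α β, ‖g p.1 (x p.1 p.2) p.2‖ ≤ G)
    (hy : HasDensity α β (baseMeasure ν C) (fun p => field f g ρ θ' p (y p.1 p.2)) y)
    (hyD : ∀ p ∈ dynTime α β, (p.1, y p.1 p.2) ∈ D)
    (h₀ : x t₀ (-1 / 2) = y t₀ (-1 / 2)) {p : ℝ × ℝ} (hp : p ∈ dynTime α β) :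
    ‖y p.1 p.2 - x p.1 p.2‖ ≤ 2 * η * Wm := by
  set μ := baseMeasure ν C
  set κ := lipField n Kf Kg ρ θ'
  have hκ : ∀ p, 0 ≤ κ p := lipField_nonneg
  have hsub : dynTime α β ⊆ dynTime a b := prod_mono (Ioo_subset_Ioo ha hb) subset_rfl
  have hκi : IntegrableOn κ (dynTime a b) μ := integrableOn_lipField hρ hθ'
  have hp0 : (t₀, (-1 / 2 : ℝ)) ∈ dynTime α β := ⟨ht₀, left_mem_J⟩
  have hη0 : 0 ≤ η := (mul_nonneg (by positivity) (integral_nonneg fun _ => norm_nonneg _)).trans hη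
  have hdi : IntegrableOn (fun p => ‖θ' p - θ p‖) (dynTime a b) μ := (hθ'.sub hθ).norm
  have hd := hy.sub hx
  have hn {q : ℝ × ℝ} (hq : q ∈ dynTime α β) : ‖y q.1 q.2 - x q.1 q.2‖ ≤ ∫ r in btw (t₀, -1 / 2) q,
      ‖field f g ρ θ' r (y r.1 r.2) - field f g ρ θ r (x r.1 r.2)‖ ∂μ := by
    have := hd.norm_sub_le hp0 hq
    simpa only [Pi.sub_apply, h₀, sub_self, sub_zero] using this
  -- The difference vanishes at (t₀, -1/2), so the L¹ norm of the difference of the densities is an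
  -- a priori bound. Gronwall is applied with the Lipschitz constant for θ', and the change of the
  -- control, weighted by the bound of g along x, is the inhomogeneity.
  have hg := le_of_le_add_integral (e := fun q => ‖y q.1 q.2 - x q.1 q.2‖) (η := η)
    (B := ∫ r in dynTime α β, ‖field f g ρ θ' r (y r.1 r.2) - field f g ρ θ r (x r.1 r.2)‖ ∂μ)
    hκ (hκi.mono_set hsub) ht₀ hC ?_ (fun _ => norm_nonneg _) (fun q hq => ?_) (fun q hq => ?_) hp
  · exact hg.trans (mul_le_mul_of_nonneg_left (hW p (hsub hp)) (by positivity))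
  · exact (setIntegral_mono_set (hκi.mono_set inter_subset_left)
      (Eventually.of_forall fun _ => hκ _)
      (inter_subset_inter_left _ hsub).eventuallyLE).trans hoff
  · exact (hn hq).trans (setIntegral_mono_set hd.integrableOn.norm
      (Eventually.of_forall fun _ => norm_nonneg _) (btw_subset_dynTime hp0 hq).eventuallyLE)
  · have hbs := btw_subset_dynTime hp0 hq
    have hei : IntegrableOn (fun r => κ r * ‖y r.1 r.2 - x r.1 r.2‖) (btw (t₀, -1 / 2) q) μ := by
      refine ((hκi.mono_set hsub).mono_set hbs).mul_bdd
        (c := ∫ r in dynTime α β, ‖field f g ρ θ' r (y r.1 r.2) - field f g ρ θ r (x r.1 r.2)‖ ∂μ) ?_ ?_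
      · have h1 : AEStronglyMeasurable (fun r : ℝ × ℝ => y r.1 r.2 - x r.1 r.2)
            (μ.restrict (dynTime α β)) :=
          aestronglyMeasurable_dynTime (aestronglyMeasurable_ord (fun t ht => hd.sgAt ht) ν)
            fun τ _ hτ => (hd.sgAt hτ).continuousOn.aestronglyMeasurable measurableSet_J
        exact (h1.mono_measure (Measure.restrict_mono hbs le_rfl)).norm
      · refine (ae_restrict_iff' (measurableSet_btw _ _)).2 (Eventually.of_forall fun r hr => ?_)
        rw [norm_norm]
        exact (hn (hbs hr)).trans (setIntegral_mono_set hd.integrableOn.norm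
          (Eventually.of_forall fun _ => norm_nonneg _)
          (btw_subset_dynTime hp0 (hbs hr)).eventuallyLE)
    have hdi' : IntegrableOn (fun r => n * G * ‖θ' r - θ r‖) (dynTime a b) μ := hdi.const_mul _
    refine (hn hq).trans ?_
    calc ∫ r in btw (t₀, -1 / 2) q, ‖field f g ρ θ' r (y r.1 r.2) - field f g ρ θ r (x r.1 r.2)‖ ∂μ
        ≤ ∫ r in btw (t₀, -1 / 2) q, (n * G * ‖θ' r - θ r‖ + κ r * ‖y r.1 r.2 - x r.1 r.2‖) ∂μ := by
          refine integral_mono_of_nonneg (Eventually.of_forall fun _ => norm_nonneg _)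
            ((hdi'.mono_set (hbs.trans hsub)).add hei) ?_
          refine (ae_restrict_iff' (measurableSet_btw _ _)).2 (Eventually.of_forall fun r hr => ?_)
          refine (norm_field_sub_le hF.lip_f hF.lip_g (hbs hr).2 (hyD r (hbs hr)) (hxD r (hbs hr))).trans ?_
          rw [add_comm]
          refine add_le_add ?_ le_rfl
          rw [mul_assoc]
          exact mul_le_mul_of_nonneg_left (mul_le_mul_of_nonneg_right (hxG r (hbs hr)) (norm_nonneg _))
            (Nat.cast_nonneg n)
      _ = ∫ r in btw (t₀, -1 / 2) q, n * G * ‖θ' r - θ r‖ ∂μ +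
          ∫ r in btw (t₀, -1 / 2) q, κ r * ‖y r.1 r.2 - x r.1 r.2‖ ∂μ :=
          integral_add (hdi'.mono_set (hbs.trans hsub)) hei
      _ ≤ _ := by
          refine add_le_add ?_ le_rfl
          refine le_trans (setIntegral_mono_set hdi' (Eventually.of_forall fun _ => by positivity)
            (hbs.trans hsub).eventuallyLE) ?_
          rw [integral_const_mul]
          exact hη

end Existence

/-! ### Solutions on subintervals and the path of the limit system -/

section

variable {n : ℕ} {D : Set (ℝ × (Fin n → ℝ))} {f : ℝ → (Fin n → ℝ) → (Fin n → ℝ)}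
  {g : ℝ → (Fin n → ℝ) → ℝ → (Fin n → Fin n → ℝ)} {Kf Kg : ℝ}
  {ρ : ℝ × ℝ → NNReal} {θ θ' θu : ℝ × ℝ → (Fin n → ℝ)}
  {ν : Measure ℝ} {C : Set ℝ} {a b t₀ : ℝ} {x y u v v' : DynFun (Fin n → ℝ)}
  {x₀ : Fin n → ℝ} {γ : ℝ → (Fin n → ℝ)}

theorem IsSolution.left_eq {Ω : Set ℝ} (hy : IsSolution D f g v t₀ x₀ Ω y) (hΩ : IsOpen Ω)
    (hΩ' : Ω.OrdConnected) (ht₀ : t₀ ∈ Ω) : y t₀ (-1 / 2) = x₀ :=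
  tendsto_nhds_unique (tendsto_ord_left (hy.1.sgAt hΩ hΩ' ht₀).left left_mem_J)
    (tendsto_ord_left hy.2.2.1 left_mem_J)

variable [Countable C] [NullSingletonClass ν] [IsFiniteMeasure ν]

/-- Over a compact interval the graph of a solution lies in a compact subset of D, and there the
field is integrable. Near the ends of Ω this argument is not available. -/
theorem IsSolution.hasDensity {Ω : Set ℝ} (hF : IsLipschitzField D f g Kf Kg)
    (hρ : IsTimeDensity a b ν C ρ) (hv : HasDensity a b (baseMeasure ν C) θ v)
    (hΩ : IsOpen Ω) (hΩ' : Ω.OrdConnected) (hy : IsSolution D f g v t₀ x₀ Ω y) {α β : ℝ}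
    (ha : a ≤ α) (hb : β ≤ b) (hαβ : Icc α β ⊆ Ω) :
    HasDensity α β (baseMeasure ν C) (fun p => field f g ρ θ p (y p.1 p.2)) y := by
  have hs : ∀ t ∈ Icc α β, SGAt y t := fun t ht => hy.1.sgAt hΩ hΩ' (hαβ ht)
  obtain ⟨K, hKD, hK, hyK⟩ := exists_compact_graph hF.isOpen hs fun t ht => hy.2.1 t (hαβ ht)
  refine ⟨integrableOn_field hF.isOpen hF.caratheodory hF.sg hF.lip_g hρ.measurable hρ.eq ha hb
    (hv.mono ha hb).integrableOn (fun t ht => hs t (Ioo_subset_Icc_self ht)) hKD hK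
    (fun t ht => hyK t (Ioo_subset_Icc_self ht)), fun p hp q hq hpq => ?_⟩
  have hsub : dynTime α β ⊆ dynTime a b := prod_mono (Ioo_subset_Ioo ha hb) subset_rfl
  exact hy.sub_eq hF.isOpen hF.caratheodory hF.sg hF.lip_g hρ.measurable hρ.eq hv hΩ hΩ'
    (hsub hp) (hsub hq) (hαβ (Ioo_subset_Icc_self hp.1)) (hαβ (Ioo_subset_Icc_self hq.1)) hpq

/-- Comparison of a solution with the solution obtained by successive approximations. -/
theorem IsSolution.norm_sub_le (hF : IsLipschitzField D f g Kf Kg) (hρ : IsTimeDensity a b ν C ρ)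
    (hθ : IntegrableOn θ (dynTime a b) (baseMeasure ν C))
    (hv' : HasDensity a b (baseMeasure ν C) θ' v') (hC : t₀ ∈ C) (ht₀ : t₀ ∈ Ioo a b)
    (hoff : ∫ p in dynTime a b ∩ {p | p.1 ≠ t₀}, lipField n Kf Kg ρ θ' p ∂(baseMeasure ν C) ≤ 1 / 4)
    {η Wm G : ℝ} (hG : 0 ≤ G)
    (hW : ∀ p ∈ dynTime a b, weight (lipField n Kf Kg ρ θ') t₀ p ≤ Wm)
    (hη : n * G * ∫ p in dynTime a b, ‖θ' p - θ p‖ ∂(baseMeasure ν C) ≤ η)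
    (hx : HasDensity a b (baseMeasure ν C) (fun p => field f g ρ θ p (x p.1 p.2)) x)
    (hx₀ : x t₀ (-1 / 2) = x₀)
    (hxD : ∀ p ∈ dynTime a b, (p.1, x p.1 p.2) ∈ D)
    (hxG : ∀ p ∈ dynTime a b, ‖g p.1 (x p.1 p.2) p.2‖ ≤ G)
    {Ω : Set ℝ} (hΩ : IsOpen Ω) (hΩ' : Ω.OrdConnected) (hΩ₀ : t₀ ∈ Ω)
    (hy : IsSolution D f g v' t₀ x₀ Ω y) {p : ℝ × ℝ} (hp : p ∈ dynTime a b) (hpΩ : p.1 ∈ Ω) :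
    ‖y p.1 p.2 - x p.1 p.2‖ ≤ 2 * η * Wm := by
  -- A compact interval around both t₀ and the time of p, inside Ω and (a, b). The constants of the
  -- comparison come from (a, b) and do not depend on it.
  obtain ⟨α, β, hα, hβ, hαβ⟩ := exists_Icc_subset_of_mem (hΩ.inter isOpen_Ioo)
    (hΩ'.inter ordConnected_Ioo) (t := min t₀ p.1) (t' := max t₀ p.1)
    (by rcases min_choice t₀ p.1 with h | h <;> rw [h]; exacts [⟨hΩ₀, ht₀⟩, ⟨hpΩ, hp.1⟩])
    (by rcases max_choice t₀ p.1 with h | h <;> rw [h]; exacts [⟨hΩ₀, ht₀⟩, ⟨hpΩ, hp.1⟩])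
  have h1 := lt_min_iff.1 hα
  have h2 := max_lt_iff.1 hβ
  have hlt : α < β := h1.1.trans h2.1
  have ha : a ≤ α := (hαβ (left_mem_Icc.2 hlt.le)).2.1.le
  have hb : β ≤ b := (hαβ (right_mem_Icc.2 hlt.le)).2.2.le
  have hsub : dynTime α β ⊆ dynTime a b := prod_mono (Ioo_subset_Ioo ha hb) subset_rfl
  exact norm_sub_le_of_hasDensity hF hρ hθ hv'.integrableOn hC hoff hG hW hη ha hb ⟨h1.1, h2.1⟩
    (hx.mono ha hb) (fun q hq => hxD q (hsub hq)) (fun q hq => hxG q (hsub hq))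
    (hy.hasDensity hF hρ hv' hΩ hΩ' ha hb fun t ht => (hαβ ht).1)
    (fun q hq => hy.2.1 _ (hαβ (Ioo_subset_Icc_self hq.1)).1 _ hq.2)
    (by rw [hx₀, hy.left_eq hΩ hΩ' hΩ₀]) ⟨⟨h1.2, h2.2⟩, hp.2⟩

/-- The solution of the equation which ignores all times but `t₀`. -/
def limitPath (t₀ : ℝ) (γ : ℝ → (Fin n → ℝ)) : DynFun (Fin n → ℝ) := fun t s =>
  if t < t₀ then γ (-1 / 2) else if t = t₀ then γ s else γ (1 / 2)

open scoped Classical in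
-- The path moves only during t₀, so its density is concentrated on that fibre. There the limit
-- system identifies it with γ', because θu is the derivative of u(t₀) almost everywhere.
theorem hasDensity_limitPath (hu : HasDensity a b (baseMeasure ν C) θu u) (ht₀ : t₀ ∈ Ioo a b)
    (hC : t₀ ∈ C) (hγ : IsLimitSolution D g u t₀ x₀ γ) {G : ℝ}
    (hG : ∀ s ∈ J, ‖g t₀ (γ s) s‖ ≤ G) :
    HasDensity a b (baseMeasure ν C) (fun p => if p.1 = t₀ then
      fun i => ∑ j, g p.1 (limitPath t₀ γ p.1 p.2) p.2 i j * θu p j else 0) (limitPath t₀ γ) := by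
  set θc : ℝ × ℝ → (Fin n → ℝ) := fun p => if p.1 = t₀ then
      fun i => ∑ j, g p.1 (limitPath t₀ γ p.1 p.2) p.2 i j * θu p j else 0
  have hγi (i : Fin n) : AbsolutelyContinuousOnInterval (fun s => γ s i) (-1 / 2) (1 / 2) :=
    absolutelyContinuousOnInterval_comp zero_le_one hγ.1 fun x _ y _ => by
      rw [one_mul]; exact dist_le_pi_dist (γ x) (γ y) i
  have hae : ∀ᵐ s ∂(volume.restrict J), ∀ i, HasDerivAt (fun s => γ s i) (θc (t₀, s) i) s := by
    have h1 : ∀ᵐ s ∂(volume.restrict J), ∀ j, HasDerivAt (fun s => u t₀ s j) (θu (t₀, s) j) s :=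
      ae_all_iff.2 fun j => (hu.apply j).deriv_ae_eq ht₀ hC
    filter_upwards [hγ.2.2.2, h1] with s hs hs1 i
    have h2 := hasDerivAt_pi.1 hs i
    simp only [(hs1 _).deriv] at h2
    simpa [θc, limitPath] using h2
  have hne {p : ℝ × ℝ} (hp : p.1 ≠ t₀) : θc p = 0 := if_neg hp
  -- On the fibre over t₀, measurability is inherited from the derivative of γ, without any argument
  -- about g along γ.
  have hθm : AEStronglyMeasurable θc ((baseMeasure ν C).restrict (dynTime a b)) := by
    refine aestronglyMeasurable_dynTime (Measurable.aestronglyMeasurable ?_) fun τ _ _ => ?_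
    · have : (fun t => θc (t, -1 / 2)) = fun t => if t = t₀ then θc (t₀, -1 / 2) else 0 := by
        ext1 t
        split_ifs with h
        · rw [h]
        · exact hne h
      rw [this]
      exact Measurable.ite (measurableSet_singleton t₀) measurable_const measurable_const
    · by_cases h : τ = t₀
      · rw [h]
        refine (aemeasurable_pi_lambda _ fun i => ?_).aestronglyMeasurable
        exact (measurable_deriv fun s => γ s i).aemeasurable.congr (hae.mono fun s hs => (hs i).deriv)
      · have : (fun s => θc (τ, s)) = fun _ => 0 := funext fun s => hne h
        rw [this]
        exact aestronglyMeasurable_const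
  have hi : IntegrableOn θc (dynTime a b) (baseMeasure ν C) := by
    refine Integrable.mono' (g := fun p => n * (G * ‖θu p‖))
      ((hu.integrableOn.norm.const_mul G).const_mul n) hθm ?_
    refine (ae_restrict_iff' (measurableSet_dynTime a b)).2 (Eventually.of_forall fun p hp => ?_)
    by_cases h : p.1 = t₀
    · have e : θc p = fun i => ∑ j, g t₀ (γ p.2) p.2 i j * θu p j := by
        simp only [θc, h, if_true, limitPath, lt_irrefl, if_false]
      rw [e]
      refine (norm_sum_mul_le _ _).trans ?_
      have := hG p.2 hp.2
      gcongr
    · rw [hne h, norm_zero]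
      have := (norm_nonneg _).trans (hG _ left_mem_J)
      positivity
  have hslice {s : ℝ} (hs : s ∈ J) : γ s - γ (-1 / 2) = ∫ r in Ico (-1 / 2) s, θc (t₀, r) := by
    have hi0 : IntegrableOn (fun r => θc (t₀, r)) J := by
      refine (IntegrableOn.baseMeasure_right (measurableSet_dynTime a b) hi hC).mono_set ?_
      exact fun s hs => ⟨hs, ht₀, hs⟩
    have hsub : Ico (-1 / 2) s ⊆ J := fun r hr => ⟨hr.1, hr.2.le.trans hs.2⟩
    ext i
    rw [eval_integral fun i => (hi0.mono_set hsub).eval i]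
    have hac := (hγi i).mono (c := -1 / 2) (d := s) (by
      rw [uIcc_of_le hs.1, uIcc_of_le (by norm_num)]; exact Icc_subset_Icc_right hs.2)
    rw [Pi.sub_apply, ← hac.integral_deriv_eq_sub, intervalIntegral.integral_of_le hs.1,
      integral_Ioc_eq_integral_Ioo, integral_Ico_eq_integral_Ioo]
    exact integral_congr_ae (ae_restrict_of_ae_restrict_of_subset
      (show Ioo (-1 / 2) s ⊆ J from fun r hr => ⟨hr.1.le, hr.2.le.trans hs.2⟩)
      (hae.mono fun r hr => (hr i).deriv))
  refine HasDensity.of_left hi (fun t ht s hs => ?_) fun t ht t' ht' htt => ?_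
  · rw [setIntegral_seg_right left_mem_J hs
      (hi.mono_set (seg_subset_dynTime ⟨ht, left_mem_J⟩ ⟨ht, hs⟩))]
    by_cases h : t = t₀
    · rw [h, if_pos hC, ← hslice hs]
      simp [limitPath]
    · have : ∀ r, θc (t, r) = 0 := fun r => hne h
      simp only [this, integral_zero, ite_self]
      simp [limitPath, h]
  · rw [setIntegral_seg_left (hi.mono_set (seg_subset_dynTime ⟨ht, left_mem_J⟩ ⟨ht', left_mem_J⟩))]
    have e1 : ∫ r in Ico t t', θc (r, -1 / 2) ∂ν = 0 := by
      refine integral_eq_zero_of_ae (ae_restrict_of_ae ?_)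
      filter_upwards [Measure.ae_ne ν t₀] with r hr using hne hr
    have e2 : ∀ τ, τ ≠ t₀ → (Ico t t').indicator
        (fun τ => if τ ∈ C then ∫ s in J, θc (τ, s) else 0) τ = 0 := by
      intro τ hτ
      have : ∀ r, θc (τ, r) = 0 := fun r => hne hτ
      by_cases h : τ ∈ Ico t t'
      · rw [indicator_of_mem h]
        simp only [this, integral_zero, ite_self]
      · rw [indicator_of_notMem h]
    have e3 : ∫ s in J, θc (t₀, s) = γ (1 / 2) - γ (-1 / 2) := by
      rw [hslice right_mem_J, J, integral_Icc_eq_integral_Ico]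
    rw [e1, zero_add, tsum_eq_single t₀ e2]
    by_cases h : t₀ ∈ Ico t t'
    · rw [indicator_of_mem h, if_pos hC, e3]
      have h3 : limitPath t₀ γ t (-1 / 2) = γ (-1 / 2) := by
        rcases h.1.lt_or_eq with h4 | h4
        · simp [limitPath, h4]
        · simp [limitPath, h4]
      have h5 : limitPath t₀ γ t' (-1 / 2) = γ (1 / 2) := by
        simp [limitPath, h.2.not_gt, h.2.ne']
      rw [ord, ord, h3, h5]
    · rw [indicator_of_notMem h, ord, ord, sub_eq_zero]
      rw [mem_Ico, not_and_or, not_le, not_lt] at h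
      rcases h with h | h
      · have h6 := h.trans_le htt
        simp [limitPath, h.not_gt, h.ne', h6.not_gt, h6.ne']
      · have h6 := htt.trans h
        have h7 {r : ℝ} (hr : r ≤ t₀) : limitPath t₀ γ r (-1 / 2) = γ (-1 / 2) := by
          rcases hr.lt_or_eq with h4 | h4
          · simp [limitPath, h4]
          · simp [limitPath, h4]
        rw [h7 h, h7 h6]

end

/-! ### Common base measures and uniform estimates -/

section Common

variable {n : ℕ} {a b : ℝ}

/-- Under a common base measure the densities can be subtracted, and having a density implies
membership. -/
theorem MemSBV.sub {u v : DynFun (Fin n → ℝ)} (hv : MemSBV a b v) (hu : MemSBV a b u) (hab : a < b) :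
    MemSBV a b (v - u) := by
  obtain ⟨ν₁, C₁, θ₁, i₁, j₁, c₁, h₁, -⟩ := hv.exists_hasDensity_pi hab
  obtain ⟨ν₂, C₂, θ₂, i₂, j₂, c₂, h₂, -⟩ := hu.exists_hasDensity_pi hab
  have : NullSingletonClass (ν₁ + ν₂) := ⟨fun x => by simp⟩
  have hc : (C₁ ∪ C₂).Countable := c₁.union c₂
  have : Countable ↑(C₁ ∪ C₂) := hc
  obtain ⟨θ₁', h₁', -⟩ := h₁.transport (ν' := ν₁ + ν₂)
    (Measure.AbsolutelyContinuous.rfl.add_right _) subset_union_left hc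
  obtain ⟨θ₂', h₂', -⟩ := h₂.transport (ν' := ν₁ + ν₂) (by
    rw [add_comm]; exact Measure.AbsolutelyContinuous.rfl.add_right _) subset_union_right hc
  exact (h₁'.sub h₂').memSBV hab

/-- Densities with respect to a common measure, which also dominates time. -/
theorem exists_common_density {u w w' : DynFun (Fin n → ℝ)} {ν₀ : Measure ℝ} [IsFiniteMeasure ν₀]
    [NullSingletonClass ν₀] {C₀ : Set ℝ} (hC₀ : C₀.Countable) {θ₀ : ℝ × ℝ → (Fin n → ℝ)}
    (hu : HasDensity a b (baseMeasure ν₀ C₀) θ₀ u) (hw : MemSBV a b w) (hw' : MemSBV a b w')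
    (hab : a < b) (t₀ : ℝ) :
    ∃ (ν : Measure ℝ) (C : Set ℝ) (ρ : ℝ × ℝ → NNReal) (θu θw θw' : ℝ × ℝ → (Fin n → ℝ)),
      IsFiniteMeasure ν ∧ NullSingletonClass ν ∧ C.Countable ∧ t₀ ∈ C ∧ IsTimeDensity a b ν C ρ ∧
      HasDensity a b (baseMeasure ν C) θu u ∧
      (∀ S, MeasurableSet S → ∫⁻ p in S, ‖θu p‖ₑ ∂(baseMeasure ν C) =
        ∫⁻ p in S, ‖θ₀ p‖ₑ ∂(baseMeasure ν₀ C₀)) ∧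
      HasDensity a b (baseMeasure ν C) θw w ∧
      ∫⁻ p in dynTime a b, ‖θw p‖ₑ ∂(baseMeasure ν C) ≤ n * sbvNorm a b w ∧
      HasDensity a b (baseMeasure ν C) θw' w' ∧
      ∫⁻ p in dynTime a b, ‖θw' p‖ₑ ∂(baseMeasure ν C) ≤ n * sbvNorm a b w' := by
  obtain ⟨ν₁, C₁, θ₁, i₁, j₁, c₁, h₁, l₁⟩ := hw.exists_hasDensity_pi hab
  obtain ⟨ν₂, C₂, θ₂, i₂, j₂, c₂, h₂, l₂⟩ := hw'.exists_hasDensity_pi hab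
  -- Lebesgue measure is included so that time has a density ρ, and t₀ is put into C so that its
  -- fibre is present even if no control jumps there.
  set ν := ν₀ + (ν₁ + (ν₂ + volume.restrict (Ioo a b)))
  have hν : NullSingletonClass ν := ⟨fun x => by simp [ν]⟩
  set C := {t₀} ∪ C₀ ∪ C₁ ∪ C₂
  have hc : C.Countable := (((countable_singleton t₀).union hC₀).union c₁).union c₂
  have a0 : ν₀ ≪ ν := Measure.AbsolutelyContinuous.rfl.add_right _
  have hr {μ μ' : Measure ℝ} : μ' ≪ μ + μ' := by
    rw [add_comm]; exact Measure.AbsolutelyContinuous.rfl.add_right _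
  have a1 : ν₁ ≪ ν := (Measure.AbsolutelyContinuous.rfl.add_right _).trans hr
  have a2 : ν₂ ≪ ν := ((Measure.AbsolutelyContinuous.rfl.add_right _).trans hr).trans hr
  have a3 : volume.restrict (Ioo a b) ≪ ν := (hr.trans hr).trans hr
  obtain ⟨ρ, hρ, hρ'⟩ := exists_baseMeasure_eq_withDensity (C := ∅) a3 (empty_subset C) hc
  obtain ⟨θu, hu1, hu2⟩ := hu.transport a0 (C' := C) (fun τ hτ => Or.inl (Or.inl (Or.inr hτ))) hc
  obtain ⟨θw, hw1, hw2⟩ := h₁.transport a1 (C' := C) (fun τ hτ => Or.inl (Or.inr hτ)) hc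
  obtain ⟨θw', hw1', hw2'⟩ := h₂.transport a2 (C' := C) (fun τ hτ => Or.inr hτ) hc
  refine ⟨ν, C, ρ, θu, θw, θw', inferInstance, hν, hc, Or.inl (Or.inl (Or.inl rfl)), ⟨hρ, hρ'⟩, hu1,
    hu2, hw1, ?_, hw1', ?_⟩
  · rw [hw2 _ (measurableSet_dynTime a b)]; exact l₁
  · rw [hw2' _ (measurableSet_dynTime a b)]; exact l₂

end Common

section

variable {n : ℕ} {D : Set (ℝ × (Fin n → ℝ))} {f : ℝ → (Fin n → ℝ) → (Fin n → ℝ)}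
  {g : ℝ → (Fin n → ℝ) → ℝ → (Fin n → Fin n → ℝ)} {Kf Kg : ℝ}
  {ρ : ℝ × ℝ → NNReal} {θ θ' θu : ℝ × ℝ → (Fin n → ℝ)}
  {ν : Measure ℝ} {C : Set ℝ} {a b t₀ : ℝ} {x y u v v' : DynFun (Fin n → ℝ)}
  {x₀ : Fin n → ℝ} {γ : ℝ → (Fin n → ℝ)}
  [Countable C] [NullSingletonClass ν] [IsFiniteMeasure ν]

theorem IsTimeDensity.integral_eq (hρ : IsTimeDensity a b ν C ρ) (hab : a ≤ b) :
    ∫ p in dynTime a b, (ρ p : ℝ) ∂(baseMeasure ν C) = b - a := by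
  have := setIntegral_time (F := fun _ => (1 : ℝ)) hρ.measurable hρ.eq le_rfl le_rfl
  simpa [hab] using this

/-- The total mass of ρ is the length of the interval, and the mass of θ exceeds that of θu by at
most their L¹ distance. The bound is thus uniform over all controls near u and all base measures. -/
theorem setIntegral_lipField_le (hρ : IsTimeDensity a b ν C ρ) (hab : a ≤ b)
    (hθ : IntegrableOn θ (dynTime a b) (baseMeasure ν C))
    (hθu : IntegrableOn θu (dynTime a b) (baseMeasure ν C)) {S : Set (ℝ × ℝ)}
    (hS : S ⊆ dynTime a b) {ε N : ℝ}
    (hε : ∫ p in dynTime a b, ‖θ p - θu p‖ ∂(baseMeasure ν C) ≤ ε)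
    (hN : ∫ p in S, ‖θu p‖ ∂(baseMeasure ν C) ≤ N) :
    ∫ p in S, lipField n Kf Kg ρ θ p ∂(baseMeasure ν C) ≤
      |Kf| * (b - a) + n * |Kg| * (N + ε) := by
  have h1 : ∫ p in S, (ρ p : ℝ) ∂(baseMeasure ν C) ≤ b - a := by
    rw [← hρ.integral_eq hab]
    exact setIntegral_mono_set hρ.integrableOn (Eventually.of_forall fun p => (ρ p).2)
      hS.eventuallyLE
  have hd : IntegrableOn (fun p => ‖θ p - θu p‖) (dynTime a b) (baseMeasure ν C) := (hθ.sub hθu).norm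
  have h2 : ∫ p in S, ‖θ p‖ ∂(baseMeasure ν C) ≤ N + ε := by
    calc ∫ p in S, ‖θ p‖ ∂(baseMeasure ν C)
        ≤ ∫ p in S, (‖θu p‖ + ‖θ p - θu p‖) ∂(baseMeasure ν C) := by
          refine integral_mono (hθ.mono_set hS).norm
            ((hθu.mono_set hS).norm.add (hd.mono_set hS)) fun p => ?_
          have := norm_sub_norm_le (θ p) (θu p)
          simp only
          linarith
      _ = ∫ p in S, ‖θu p‖ ∂(baseMeasure ν C) + ∫ p in S, ‖θ p - θu p‖ ∂(baseMeasure ν C) :=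
          integral_add (hθu.mono_set hS).norm (hd.mono_set hS)
      _ ≤ N + ε := add_le_add hN ((setIntegral_mono_set hd
          (Eventually.of_forall fun p => norm_nonneg _) hS.eventuallyLE).trans hε)
  have h3 : ∫ p in S, lipField n Kf Kg ρ θ p ∂(baseMeasure ν C) =
      |Kf| * ∫ p in S, (ρ p : ℝ) ∂(baseMeasure ν C) +
        n * |Kg| * ∫ p in S, ‖θ p‖ ∂(baseMeasure ν C) := by
    rw [← integral_const_mul, ← integral_const_mul]
    exact integral_add ((hρ.integrableOn.mono_set hS).const_mul _)
      ((hθ.mono_set hS).norm.const_mul _)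
  rw [h3]
  gcongr

theorem weight_lipField_le (hρ : IsTimeDensity a b ν C ρ) (ht₀ : t₀ ∈ Ioo a b) (hC : t₀ ∈ C)
    (hθ : IntegrableOn θ (dynTime a b) (baseMeasure ν C)) {I : ℝ}
    (hI : ∫ p in dynTime a b, lipField n Kf Kg ρ θ p ∂(baseMeasure ν C) ≤ I) :
    ∀ p ∈ dynTime a b, weight (lipField n Kf Kg ρ θ) t₀ p ≤ Real.exp (4 * I) := by
  intro p hp
  have hκ : ∀ p, 0 ≤ lipField n Kf Kg ρ θ p := lipField_nonneg
  have hκi : IntegrableOn (lipField n Kf Kg ρ θ) (dynTime a b) (baseMeasure ν C) :=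
    integrableOn_lipField hρ hθ
  have hi₀ : IntegrableOn (fun s => lipField n Kf Kg ρ θ (t₀, s)) J := by
    refine (IntegrableOn.baseMeasure_right (measurableSet_dynTime a b) hκi hC).mono_set ?_
    exact fun s hs => ⟨hs, ht₀, hs⟩
  refine (weight_le hκ hi₀ hp.2).trans (Real.exp_le_exp.2 (mul_le_mul_of_nonneg_left ?_ (by norm_num)))
  have hsub : seg (t₀, -1 / 2) (t₀, 1 / 2) ⊆ dynTime a b :=
    seg_subset_dynTime ⟨ht₀, left_mem_J⟩ ⟨ht₀, right_mem_J⟩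
  have h1 := setIntegral_seg_right left_mem_J right_mem_J (hκi.mono_set hsub)
  rw [if_pos hC, ← integral_Icc_eq_integral_Ico] at h1
  rw [J, ← h1]
  exact (setIntegral_mono_set hκi (Eventually.of_forall hκ) hsub.eventuallyLE).trans hI

theorem limitPath_mem {t s : ℝ} (hs : s ∈ J) :
    ∃ s' ∈ J, limitPath t₀ γ t s = γ s' := by
  rw [limitPath]
  split_ifs
  exacts [⟨_, left_mem_J, rfl⟩, ⟨s, hs, rfl⟩, ⟨_, right_mem_J, rfl⟩]

/-- Existence of a solution close to the solution of the limit system. -/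
theorem exists_solution (hF : IsLipschitzField D f g Kf Kg) (hρ : IsTimeDensity a b ν C ρ)
    (ht₀ : t₀ ∈ Ioo a b) (hC : t₀ ∈ C) (hu : HasDensity a b (baseMeasure ν C) θu u)
    (hθ : IntegrableOn θ (dynTime a b) (baseMeasure ν C))
    (hγ : IsLimitSolution D g u t₀ x₀ γ) {K : Set (ℝ × (Fin n → ℝ))} (hKD : K ⊆ D)
    (hK : IsCompact K) {δ : ℝ} (hδ : 0 ≤ δ)
    (htube : ∀ t ∈ Ioo a b, ∀ s ∈ J, ∀ ξ, ‖ξ - γ s‖ ≤ δ → (t, ξ) ∈ K) {G : ℝ} (hG0 : 0 ≤ G)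
    (hG : ∀ p ∈ K, ∀ s ∈ J, ‖g p.1 p.2 s‖ ≤ G) {m : ℝ → ℝ} (hm : Integrable m)
    (hfm : ∀ᵐ t, ∀ ξ, (t, ξ) ∈ K → ‖f t ξ‖ ≤ m t) {ε Wm : ℝ}
    (hε : ∫ p in dynTime a b, ‖θ p - θu p‖ ∂(baseMeasure ν C) ≤ ε)
    (hεu : ∫ p in dynTime a b ∩ {p | p.1 ≠ t₀}, ‖θu p‖ ∂(baseMeasure ν C) ≤ ε)
    (hoff : ∫ p in dynTime a b ∩ {p | p.1 ≠ t₀}, lipField n Kf Kg ρ θ p ∂(baseMeasure ν C) ≤ 1 / 4)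
    (hW : ∀ p ∈ dynTime a b, weight (lipField n Kf Kg ρ θ) t₀ p ≤ Wm)
    (hWδ : 2 * ((∫ t in Ioo a b, ‖m t‖) + n * G * (ε + ε)) * Wm ≤ δ) :
    ∃ x : DynFun (Fin n → ℝ),
      HasDensity a b (baseMeasure ν C) (fun p => field f g ρ θ p (x p.1 p.2)) x ∧
      x t₀ (-1 / 2) = x₀ ∧ ∀ p ∈ dynTime a b, (p.1, x p.1 p.2) ∈ K := by
  classical
  set c := limitPath t₀ γ
  have htube' : ∀ p ∈ dynTime a b, ∀ ξ, ‖ξ - c p.1 p.2‖ ≤ δ → (p.1, ξ) ∈ K := by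
    intro p hp ξ hξ
    obtain ⟨s, hs, he⟩ := limitPath_mem (t₀ := t₀) (γ := γ) (t := p.1) hp.2
    exact htube p.1 hp.1 s hs ξ (by rwa [← he])
  have hcK : ∀ p ∈ dynTime a b, (p.1, c p.1 p.2) ∈ K := fun p hp =>
    htube' p hp _ (by simpa using hδ)
  have hGγ : ∀ s ∈ J, ‖g t₀ (γ s) s‖ ≤ G := fun s hs =>
    hG (t₀, γ s) (htube t₀ ht₀ s hs _ (by simpa using hδ)) s hs
  have hc := hasDensity_limitPath hu ht₀ hC hγ hGγ
  set θc : ℝ × ℝ → (Fin n → ℝ) := fun p => if p.1 = t₀ then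
      fun i => ∑ j, g p.1 (c p.1 p.2) p.2 i j * θu p j else 0
  have hcs : ∀ t ∈ Ioo a b, SGAt c t := fun t ht => hc.sgAt ht
  have hcD : ∀ t ∈ Ioo a b, ∀ s ∈ J, (t, c t s) ∈ D := fun t ht s hs => hKD (hcK (t, s) ⟨ht, hs⟩)
  have hfi : IntegrableOn (fun t => f t (c t (-1 / 2))) (Ioo a b) := by
    refine hm.integrableOn.mono' (aestronglyMeasurable_f hF.isOpen hF.caratheodory hcs hcD) ?_
    refine (ae_restrict_iff' measurableSet_Ioo).2 ?_
    filter_upwards [hfm] with t ht ht' using ht _ (hcK (t, _) ⟨ht', left_mem_J⟩)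
  have hft : ∫ p in dynTime a b, (ρ p : ℝ) • ‖f p.1 (c p.1 p.2)‖ ∂(baseMeasure ν C) ≤
      ∫ t in Ioo a b, ‖m t‖ := by
    rw [setIntegral_time (F := fun p : ℝ × ℝ => ‖f p.1 (c p.1 p.2)‖) hρ.measurable hρ.eq le_rfl le_rfl]
    refine integral_mono_ae hfi.norm hm.norm.integrableOn ?_
    refine (ae_restrict_iff' measurableSet_Ioo).2 ?_
    filter_upwards [hfm] with t ht ht'
    exact (ht _ (hcK (t, _) ⟨ht', left_mem_J⟩)).trans (le_abs_self _)
  have hfi' : IntegrableOn (fun p : ℝ × ℝ => (ρ p : ℝ) • ‖f p.1 (c p.1 p.2)‖) (dynTime a b)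
      (baseMeasure ν C) :=
    integrableOn_time (F := fun p : ℝ × ℝ => ‖f p.1 (c p.1 p.2)‖) hρ.measurable hρ.eq le_rfl le_rfl
      hfi.norm
  have hSm : MeasurableSet {p : ℝ × ℝ | p.1 ≠ t₀} :=
    (measurableSet_singleton t₀).compl.preimage measurable_fst
  -- The part of the control u off t₀, which `limitPath` ignores.
  set ψ : ℝ × ℝ → ℝ := {p : ℝ × ℝ | p.1 ≠ t₀}.indicator fun p => ‖θu p‖
  have hψi : IntegrableOn ψ (dynTime a b) (baseMeasure ν C) := hu.integrableOn.norm.indicator hSm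
  have hψ : ∫ p in dynTime a b, ψ p ∂(baseMeasure ν C) ≤ ε := by
    rw [setIntegral_indicator hSm]
    exact hεu
  have hdi : IntegrableOn (fun p => ‖θ p - θu p‖) (dynTime a b) (baseMeasure ν C) :=
    (hθ.sub hu.integrableOn).norm
  -- The defect of the limit path. On the fibre over t₀ the term g θu cancels and g (θ - θu)
  -- remains. Off t₀ the whole of g θ remains, with ‖θ‖ ≤ ‖θ - θu‖ + ‖θu‖. The term with f is
  -- bounded by m everywhere.
  have hη : ∫ p in dynTime a b, ‖field f g ρ θ p (c p.1 p.2) - θc p‖ ∂(baseMeasure ν C) ≤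
      (∫ t in Ioo a b, ‖m t‖) + n * G * (ε + ε) := by
    have hi2 : IntegrableOn (fun p => n * G * (‖θ p - θu p‖ + ψ p)) (dynTime a b) (baseMeasure ν C) :=
      (hdi.add hψi).const_mul _
    calc ∫ p in dynTime a b, ‖field f g ρ θ p (c p.1 p.2) - θc p‖ ∂(baseMeasure ν C)
        ≤ ∫ p in dynTime a b, ((ρ p : ℝ) • ‖f p.1 (c p.1 p.2)‖ + n * G * (‖θ p - θu p‖ + ψ p))
            ∂(baseMeasure ν C) := by
          refine integral_mono_of_nonneg (Eventually.of_forall fun _ => norm_nonneg _)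
            (hfi'.add hi2) ?_
          refine (ae_restrict_iff' (measurableSet_dynTime a b)).2 (Eventually.of_forall fun p hp => ?_)
          have hGp := hG _ (hcK p hp) p.2 hp.2
          have hρ0 : (0 : ℝ) ≤ ρ p := (ρ p).2
          have e0 : ‖(ρ p : ℝ) • f p.1 (c p.1 p.2)‖ = (ρ p : ℝ) • ‖f p.1 (c p.1 p.2)‖ := by
            rw [norm_smul, Real.norm_of_nonneg hρ0, smul_eq_mul]
          by_cases h : p.1 = t₀
          · have e : field f g ρ θ p (c p.1 p.2) - θc p = (ρ p : ℝ) • f p.1 (c p.1 p.2) +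
                fun i => ∑ j, g p.1 (c p.1 p.2) p.2 i j * (θ p - θu p) j := by
              ext i
              simp only [field, θc, if_pos h, Pi.sub_apply, Pi.add_apply, mul_sub, Finset.sum_sub_distrib]
              ring
            have e1 : ψ p = 0 :=
              indicator_of_notMem (show p ∉ {p : ℝ × ℝ | p.1 ≠ t₀} from fun h' => h' h) _
            simp only [e, e1, add_zero]
            refine (norm_add_le _ _).trans (add_le_add e0.le ((norm_sum_mul_le _ _).trans ?_))
            rw [mul_assoc]
            gcongr
          · have e : field f g ρ θ p (c p.1 p.2) - θc p = (ρ p : ℝ) • f p.1 (c p.1 p.2) +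
                fun i => ∑ j, g p.1 (c p.1 p.2) p.2 i j * θ p j := by
              simp only [field, θc, if_neg h, sub_zero]
            have e1 : ψ p = ‖θu p‖ := indicator_of_mem (show p ∈ {p : ℝ × ℝ | p.1 ≠ t₀} from h) _
            simp only [e, e1]
            refine (norm_add_le _ _).trans (add_le_add e0.le ((norm_sum_mul_le _ _).trans ?_))
            rw [mul_assoc]
            have := norm_sub_norm_le (θ p) (θu p)
            gcongr
            linarith
      _ = ∫ p in dynTime a b, (ρ p : ℝ) • ‖f p.1 (c p.1 p.2)‖ ∂(baseMeasure ν C) +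
            n * G * (∫ p in dynTime a b, ‖θ p - θu p‖ ∂(baseMeasure ν C) +
              ∫ p in dynTime a b, ψ p ∂(baseMeasure ν C)) := by
          rw [integral_add hfi' hi2, integral_const_mul, integral_add hdi hψi]
      _ ≤ (∫ t in Ioo a b, ‖m t‖) + n * G * (ε + ε) := add_le_add hft
          (mul_le_mul_of_nonneg_left (add_le_add hε hψ) (by positivity))
  obtain ⟨x, h1, h2, h3⟩ := exists_hasDensity_field hF hρ hθ ht₀ hC hc (x₀ := x₀)
    (by simp [limitPath, hγ.2.1]) hKD hK htube' hoff hη hW hWδ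
  exact ⟨x, h1, h2, fun p hp => htube' p hp _ (h3 p hp)⟩

/-- The norm of the difference of two solutions on the whole interval is controlled by the
difference of the densities of the controls. -/
theorem IsSolution.sbvNorm_sub_le (hF : IsLipschitzField D f g Kf Kg) (hρ : IsTimeDensity a b ν C ρ)
    (hv : HasDensity a b (baseMeasure ν C) θ v)
    (hv' : HasDensity a b (baseMeasure ν C) θ' v') (hC : t₀ ∈ C) (ht₀ : t₀ ∈ Ioo a b)
    (hoff : ∫ p in dynTime a b ∩ {p | p.1 ≠ t₀}, lipField n Kf Kg ρ θ p ∂(baseMeasure ν C) ≤ 1 / 4)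
    (hoff' : ∫ p in dynTime a b ∩ {p | p.1 ≠ t₀}, lipField n Kf Kg ρ θ' p ∂(baseMeasure ν C) ≤ 1 / 4)
    {η Wm G I : ℝ} (hG : 0 ≤ G)
    (hW : ∀ p ∈ dynTime a b, weight (lipField n Kf Kg ρ θ) t₀ p ≤ Wm)
    (hW' : ∀ p ∈ dynTime a b, weight (lipField n Kf Kg ρ θ') t₀ p ≤ Wm)
    (hI : ∫ p in dynTime a b, lipField n Kf Kg ρ θ' p ∂(baseMeasure ν C) ≤ I)
    (hη : n * G * ∫ p in dynTime a b, ‖θ' p - θ p‖ ∂(baseMeasure ν C) ≤ η)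
    (hx : HasDensity a b (baseMeasure ν C) (fun p => field f g ρ θ p (x p.1 p.2)) x)
    (hx₀ : x t₀ (-1 / 2) = x₀)
    (hxD : ∀ p ∈ dynTime a b, (p.1, x p.1 p.2) ∈ D)
    (hxG : ∀ p ∈ dynTime a b, ‖g p.1 (x p.1 p.2) p.2‖ ≤ G)
    {y y' : DynFun (Fin n → ℝ)} (hy : IsSolution D f g v t₀ x₀ (Ioo a b) y)
    (hy' : IsSolution D f g v' t₀ x₀ (Ioo a b) y') :
    sbvNorm a b (y' - y) ≤ ENNReal.ofReal (4 * η * Wm + 2 * (2 * η * Wm * I + η)) := by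
  set μ := baseMeasure ν C
  have hab : a < b := ht₀.1.trans ht₀.2
  have hall {P : ℝ × ℝ → Prop} (h : ∀ p ∈ dynTime a b, P p) : ∀ᵐ p ∂(μ.restrict (dynTime a b)), P p :=
    (ae_restrict_iff' (measurableSet_dynTime a b)).2 (Eventually.of_forall h)
  have hp0 : (t₀, (-1 / 2 : ℝ)) ∈ dynTime a b := ⟨ht₀, left_mem_J⟩
  have hη0 : 0 ≤ η := (mul_nonneg (by positivity) (integral_nonneg fun _ => norm_nonneg _)).trans hη
  have hWm : 0 ≤ Wm := (zero_le_one.trans (one_le_weight lipField_nonneg _)).trans (hW _ hp0)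
  -- For the same control the comparison holds with η = 0, so y is the constructed solution and
  -- inherits the bound of g along x.
  have hyx : ∀ p ∈ dynTime a b, y p.1 p.2 = x p.1 p.2 := by
    intro p hp
    have := hy.norm_sub_le hF hρ hv.integrableOn hv hC ht₀ hoff hG hW (η := 0) (by simp) hx hx₀ hxD
      hxG isOpen_Ioo ordConnected_Ioo ht₀ hp hp.1
    rw [mul_zero, zero_mul] at this
    exact sub_eq_zero.1 (norm_le_zero_iff.1 this)
  have hy'x : ∀ p ∈ dynTime a b, ‖y' p.1 p.2 - x p.1 p.2‖ ≤ 2 * η * Wm := fun p hp =>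
    hy'.norm_sub_le hF hρ hv.integrableOn hv' hC ht₀ hoff' hG hW' hη hx hx₀ hxD
      hxG isOpen_Ioo ordConnected_Ioo ht₀ hp hp.1
  have hκi : IntegrableOn (lipField n Kf Kg ρ θ') (dynTime a b) μ :=
    integrableOn_lipField hρ hv'.integrableOn
  have hdi : IntegrableOn (fun p => ‖θ' p - θ p‖) (dynTime a b) μ :=
    (hv'.integrableOn.sub hv.integrableOn).norm
  have hbi : IntegrableOn (fun p => lipField n Kf Kg ρ θ' p * (2 * η * Wm) + n * G * ‖θ' p - θ p‖)
      (dynTime a b) μ := (hκi.mul_const _).add (hdi.const_mul _)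
  have hbd : ∀ p ∈ dynTime a b,
      ‖field f g ρ θ' p (y' p.1 p.2) - field f g ρ θ p (x p.1 p.2)‖ ≤
        lipField n Kf Kg ρ θ' p * (2 * η * Wm) + n * G * ‖θ' p - θ p‖ := by
    intro p hp
    refine (norm_field_sub_le hF.lip_f hF.lip_g hp.2 (hy'.2.1 _ hp.1 _ hp.2) (hxD p hp)).trans ?_
    refine add_le_add (mul_le_mul_of_nonneg_left (hy'x p hp) (lipField_nonneg p)) ?_
    rw [mul_assoc]
    exact mul_le_mul_of_nonneg_left (mul_le_mul_of_nonneg_right (hxG p hp) (norm_nonneg _))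
      (Nat.cast_nonneg n)
  have hs' : ∀ t ∈ Ioo a b, SGAt y' t := fun t ht => hy'.1.sgAt isOpen_Ioo ordConnected_Ioo ht
  -- A solution is controlled a priori only on compact subintervals. Integrability up to the ends
  -- follows because the field along y' differs from the integrable field along x by a dominated
  -- function.
  have hy'i : IntegrableOn (fun p => field f g ρ θ' p (y' p.1 p.2)) (dynTime a b) μ := by
    have h1 : IntegrableOn (fun p => field f g ρ θ' p (y' p.1 p.2) - field f g ρ θ p (x p.1 p.2))
        (dynTime a b) μ := by
      refine hbi.mono' (AEStronglyMeasurable.sub (aestronglyMeasurable_field hF.isOpen hF.caratheodory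
        hF.sg hF.lip_g hρ.measurable hρ.eq le_rfl le_rfl hv'.integrableOn.aestronglyMeasurable hs' hy'.2.1)
        hx.integrableOn.aestronglyMeasurable) (hall hbd)
    have h2 := h1.add hx.integrableOn
    refine h2.congr (Eventually.of_forall fun p => ?_)
    simp only [Pi.add_apply, sub_add_cancel]
  have hfy : ∀ p ∈ dynTime a b, field f g ρ θ p (y p.1 p.2) = field f g ρ θ p (x p.1 p.2) :=
    fun p hp => by rw [hyx p hp]
  have hdy' : HasDensity a b μ (fun p => field f g ρ θ' p (y' p.1 p.2)) y' :=
    ⟨hy'i, fun p hp q hq hpq => hy'.sub_eq hF.isOpen hF.caratheodory hF.sg hF.lip_g hρ.measurable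
      hρ.eq hv' isOpen_Ioo ordConnected_Ioo hp hq hp.1 hq.1 hpq⟩
  have hdy : HasDensity a b μ (fun p => field f g ρ θ p (x p.1 p.2)) y :=
    ⟨hx.integrableOn, fun p hp q hq hpq => by
      rw [hyx p hp, hyx q hq]; exact hx.sub_eq p hp q hq hpq⟩
  have hd := hdy'.sub hdy
  -- The uniform estimate 2ηWm serves as bound of the values, and the same estimate, integrated
  -- against the Lipschitz constant and increased by η for the change of control, bounds the L¹ norm
  -- of the density of y' - y.
  refine (hd.sbvNorm_le hab (M := ENNReal.ofReal (2 * η * Wm)) fun t ht => ?_).trans ?_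
  · rw [← ofReal_norm]
    refine ENNReal.ofReal_le_ofReal ?_
    rw [ord, Pi.sub_apply, Pi.sub_apply, hyx (t, -1 / 2) ⟨ht, left_mem_J⟩]
    exact hy'x (t, -1 / 2) ⟨ht, left_mem_J⟩
  · have h1 : ∫⁻ p in dynTime a b,
        ‖field f g ρ θ' p (y' p.1 p.2) - field f g ρ θ p (x p.1 p.2)‖ₑ ∂μ ≤
        ENNReal.ofReal (2 * η * Wm * I + η) := by
      rw [← ofReal_integral_norm_eq_lintegral_enorm hd.integrableOn]
      refine ENNReal.ofReal_le_ofReal ?_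
      refine (integral_mono_of_nonneg (Eventually.of_forall fun _ => norm_nonneg _) hbi (hall hbd)).trans ?_
      rw [integral_add (hκi.mul_const _) (hdi.const_mul _), integral_mul_const, integral_const_mul]
      refine add_le_add ?_ hη
      rw [mul_comm]
      gcongr
    have hI0 : 0 ≤ I := (integral_nonneg fun p => lipField_nonneg p).trans hI
    have h2 : (2 : ℝ≥0∞) = ENNReal.ofReal 2 := by simp
    refine (add_le_add le_rfl (mul_le_mul_right h1 2)).trans ?_
    rw [h2, ← ENNReal.ofReal_mul (by norm_num), ← ENNReal.ofReal_mul (by norm_num),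
      ← ENNReal.ofReal_add (by positivity) (by positivity)]
    refine ENNReal.ofReal_le_ofReal ?_
    linarith

end

/-! ### Choice of the interval and of the constants -/

/-- The mass at τ itself is removed, since it does not shrink with the interval; in the application
it is the jump of u at t₀, which may be large. -/
theorem tendsto_measure_punctured (Λ : Measure ℝ) [IsFiniteMeasure Λ] (τ : ℝ) :
    Tendsto (fun h => Λ (Ioo (τ - h) (τ + h) \ {τ})) (𝓝[>] 0) (𝓝 0) := by
  have h1 := (tendsto_measure_Ioo_left Λ τ).add (tendsto_measure_Ioo_right Λ τ)
  rw [add_zero] at h1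
  refine tendsto_of_tendsto_of_tendsto_of_le_of_le tendsto_const_nhds h1 (fun _ => zero_le) fun h => ?_
  refine (measure_mono ?_).trans (measure_union_le _ _)
  rintro t ⟨ht, ht'⟩
  rcases lt_or_gt_of_ne (show t ≠ τ from ht') with h2 | h2
  exacts [Or.inl ⟨ht.1, h2⟩, Or.inr ⟨h2, ht.2⟩]

section

variable {n : ℕ} {D : Set (ℝ × (Fin n → ℝ))} {f : ℝ → (Fin n → ℝ) → (Fin n → ℝ)}
  {g : ℝ → (Fin n → ℝ) → ℝ → (Fin n → Fin n → ℝ)} {Kf Kg : ℝ}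
  {t₀ : ℝ} {u : DynFun (Fin n → ℝ)} {x₀ : Fin n → ℝ} {γ : ℝ → (Fin n → ℝ)}

/-- A compact tube in `D` around the solution of the limit system. -/
theorem IsLimitSolution.exists_tube (hγ : IsLimitSolution D g u t₀ x₀ γ) (hD : IsOpen D) :
    ∃ δ > 0, ∃ K ⊆ D, IsCompact K ∧
      ∀ t s ξ, |t - t₀| ≤ δ → s ∈ J → ‖ξ - γ s‖ ≤ δ → (t, ξ) ∈ K := by
  have hcont : ContinuousOn γ J := by
    have := hγ.1.continuousOn
    rwa [uIcc_of_le (by norm_num)] at this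
  have hK₀ : IsCompact ((fun s => (t₀, γ s)) '' J) :=
    isCompact_Icc.image_of_continuousOn (continuousOn_const.prodMk hcont)
  have hsub : (fun s => (t₀, γ s)) '' J ⊆ D := by
    rintro _ ⟨s, hs, rfl⟩
    exact hγ.2.2.1 s hs
  obtain ⟨δ, hδ, hδD⟩ := hK₀.exists_cthickening_subset_open hD hsub
  refine ⟨δ, hδ, _, hδD, hK₀.cthickening, fun t s ξ ht hs hξ => ?_⟩
  refine Metric.mem_cthickening_of_dist_le _ (t₀, γ s) _ _ ⟨s, hs, rfl⟩ ?_
  rw [Prod.dist_eq, Real.dist_eq, dist_eq_norm]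
  exact max_le ht hξ

theorem tendsto_setIntegral_Ioo {m : ℝ → ℝ} (hm : Integrable m) (τ : ℝ) :
    Tendsto (fun h => ∫ t in Ioo (τ - h) (τ + h), ‖m t‖) (𝓝[>] 0) (𝓝 0) := by
  have : IsFiniteMeasure (volume.withDensity fun t => ‖m t‖ₑ) := isFiniteMeasure_withDensity hm.2.ne
  have h1 := tendsto_measure_punctured (volume.withDensity fun t => ‖m t‖ₑ) τ
  have h2 := (ENNReal.tendsto_toReal ENNReal.zero_ne_top).comp h1
  refine h2.congr fun h => ?_
  rw [Function.comp_apply, withDensity_apply _ (measurableSet_Ioo.diff (measurableSet_singleton τ)),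
    integral_norm_eq_lintegral_enorm hm.aestronglyMeasurable.restrict,
    setLIntegral_congr (sdiff_null_ae_eq_self (by simp))]

theorem exists_pos_mul_le {c d : ℝ} (hc : 0 ≤ c) (hd : 0 < d) : ∃ ε > 0, ε * c ≤ d :=
  ⟨d / (c + 1), by positivity, by
    rw [div_mul_eq_mul_div, div_le_iff₀ (by positivity)]
    nlinarith⟩

/-- On a small interval around `t₀`, all controls with a density close to that of `u` satisfy the
smallness conditions for existence and stability, with common constants. -/
theorem exists_local_frame {I : Set ℝ} (hI : IsOpen I) (ht₀ : t₀ ∈ I)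
    (hF : IsLipschitzField D f g Kf Kg) (hu : MemSBVLoc I u) (hγ : IsLimitSolution D g u t₀ x₀ γ) :
    ∃ h > 0, Icc (t₀ - h) (t₀ + h) ⊆ I ∧ ∃ (K : Set (ℝ × (Fin n → ℝ))) (G Iκ Wm ε : ℝ)
      (ν₀ : Measure ℝ) (C₀ : Set ℝ) (θ₀ : ℝ × ℝ → (Fin n → ℝ)),
      K ⊆ D ∧ IsCompact K ∧ 0 ≤ G ∧ (∀ p ∈ K, ∀ s ∈ J, ‖g p.1 p.2 s‖ ≤ G) ∧ 0 < ε ∧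
      IsFiniteMeasure ν₀ ∧ NullSingletonClass ν₀ ∧ C₀.Countable ∧
      HasDensity (t₀ - h) (t₀ + h) (baseMeasure ν₀ C₀) θ₀ u ∧
      ∀ (ν : Measure ℝ) (C : Set ℝ) (ρ : ℝ × ℝ → NNReal) (θu θ : ℝ × ℝ → (Fin n → ℝ)),
        IsFiniteMeasure ν → NullSingletonClass ν → C.Countable → t₀ ∈ C →
        IsTimeDensity (t₀ - h) (t₀ + h) ν C ρ →
        HasDensity (t₀ - h) (t₀ + h) (baseMeasure ν C) θu u →
        (∀ S, MeasurableSet S → ∫⁻ p in S, ‖θu p‖ₑ ∂(baseMeasure ν C) =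
          ∫⁻ p in S, ‖θ₀ p‖ₑ ∂(baseMeasure ν₀ C₀)) →
        IntegrableOn θ (dynTime (t₀ - h) (t₀ + h)) (baseMeasure ν C) →
        ∫ p in dynTime (t₀ - h) (t₀ + h), ‖θ p - θu p‖ ∂(baseMeasure ν C) ≤ ε →
        ∫ p in dynTime (t₀ - h) (t₀ + h) ∩ {p | p.1 ≠ t₀}, lipField n Kf Kg ρ θ p
            ∂(baseMeasure ν C) ≤ 1 / 4 ∧
        ∫ p in dynTime (t₀ - h) (t₀ + h), lipField n Kf Kg ρ θ p ∂(baseMeasure ν C) ≤ Iκ ∧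
        (∀ p ∈ dynTime (t₀ - h) (t₀ + h), weight (lipField n Kf Kg ρ θ) t₀ p ≤ Wm) ∧
        ∃ x : DynFun (Fin n → ℝ),
          HasDensity (t₀ - h) (t₀ + h) (baseMeasure ν C)
            (fun p => field f g ρ θ p (x p.1 p.2)) x ∧
          x t₀ (-1 / 2) = x₀ ∧ ∀ p ∈ dynTime (t₀ - h) (t₀ + h), (p.1, x p.1 p.2) ∈ K := by
  obtain ⟨δ, hδ, K, hKD, hK, htube⟩ := hγ.exists_tube hF.isOpen
  obtain ⟨m, hm, hfm⟩ := hF.caratheodory.2.2 K hKD hK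
  obtain ⟨G, hG0, hG⟩ := hF.sg.exists_bound hF.isOpen hF.lip_g hKD hK
  obtain ⟨h₀, hh₀, hI₀⟩ := Metric.nhds_basis_closedBall.mem_iff.1 (hI.mem_nhds ht₀)
  rw [Real.closedBall_eq_Icc] at hI₀
  obtain ⟨ν₀, C₀, θ₀, i₀, j₀, c₀, hd₀, -⟩ :=
    (hu (t₀ - h₀) (t₀ + h₀) (by linarith) hI₀).exists_hasDensity_pi (by linarith)
  set μ₀ := baseMeasure ν₀ C₀
  set N := ∫ p in dynTime (t₀ - h₀) (t₀ + h₀), ‖θ₀ p‖ ∂μ₀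
  have hN : 0 ≤ N := integral_nonneg fun _ => norm_nonneg _
  -- The bound Iκ of the Lipschitz mass, and with it the weight bound Wm, are fixed on the larger
  -- interval of radius h₀. The summand 1 allows for any ε ≤ 1. Since ε and h are chosen afterwards,
  -- no circularity arises.
  set Iκ := |Kf| * (2 * h₀) + n * |Kg| * (N + 1)
  set Wm := Real.exp (4 * Iκ)
  have hWm : 0 < Wm := Real.exp_pos _
  -- The number ε₁ leaves at most 1/8 for the control in the Lipschitz mass off t₀, and ε₂ at most
  -- δ/2 for the control in the weighted defect. The factor 2 in both stands for ε + ε: the mass of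
  -- θu off t₀ and the distance of θ from θu. The other halves are left for time and for f, and are
  -- secured by small h.
  obtain ⟨ε₁, hε₁, hε₁'⟩ := exists_pos_mul_le (c := n * |Kg| * 2) (d := 1 / 8) (by positivity)
    (by norm_num)
  obtain ⟨ε₂, hε₂, hε₂'⟩ := exists_pos_mul_le (c := 2 * (n * G * 2) * Wm) (d := δ / 2) (by positivity)
    (by positivity)
  set ε := min 1 (min ε₁ ε₂)
  have hε : 0 < ε := lt_min one_pos (lt_min hε₁ hε₂)
  have hε1 : ε ≤ 1 := min_le_left _ _
  have hεa : ε * (n * |Kg| * 2) ≤ 1 / 8 := (mul_le_mul_of_nonneg_right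
    ((min_le_right _ _).trans (min_le_left _ _)) (by positivity)).trans hε₁'
  have hεb : ε * (2 * (n * G * 2) * Wm) ≤ δ / 2 := (mul_le_mul_of_nonneg_right
    ((min_le_right _ _).trans (min_le_right _ _)) (by positivity)).trans hε₂'
  have hmass : IsFiniteMeasure (HasDensity.mass (t₀ - h₀) (t₀ + h₀) μ₀ θ₀) :=
    HasDensity.isFiniteMeasure_mass hd₀.integrableOn
  have hlim : Tendsto (fun h : ℝ => h) (𝓝[>] 0) (𝓝 0) := tendsto_id.mono_left nhdsWithin_le_nhds
  have e1 : ∀ᶠ h : ℝ in 𝓝[>] 0, h ≤ min δ h₀ :=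
    hlim.eventually (eventually_le_nhds (lt_min hδ hh₀))
  have e2 : ∀ᶠ h : ℝ in 𝓝[>] 0, |Kf| * (2 * h) ≤ 1 / 8 := by
    have : Tendsto (fun h : ℝ => |Kf| * (2 * h)) (𝓝[>] 0) (𝓝 0) := by
      simpa using (hlim.const_mul 2).const_mul |Kf|
    exact this.eventually (eventually_le_nhds (by norm_num))
  have e3 : ∀ᶠ h : ℝ in 𝓝[>] 0, 2 * (∫ t in Ioo (t₀ - h) (t₀ + h), ‖m t‖) * Wm ≤ δ / 2 := by
    have : Tendsto (fun h : ℝ => 2 * (∫ t in Ioo (t₀ - h) (t₀ + h), ‖m t‖) * Wm) (𝓝[>] 0) (𝓝 0) := by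
      simpa using ((tendsto_setIntegral_Ioo hm t₀).const_mul 2).mul_const Wm
    exact this.eventually (eventually_le_nhds (by positivity))
  -- The mass of the density of u off t₀ becomes at most ε.
  have e4 := (tendsto_measure_punctured (HasDensity.mass (t₀ - h₀) (t₀ + h₀) μ₀ θ₀) t₀).eventually
    (eventually_le_nhds (b := ENNReal.ofReal ε) (by simpa using hε))
  obtain ⟨h, h1, h2, h3, h4, hpos⟩ :=
    (e1.and (e2.and (e3.and (e4.and self_mem_nhdsWithin)))).exists
  have hpos : 0 < h := hpos
  have hhδ : h ≤ δ := h1.trans (min_le_left _ _)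
  have hhh : h ≤ h₀ := h1.trans (min_le_right _ _)
  have ht : t₀ ∈ Ioo (t₀ - h) (t₀ + h) := ⟨by linarith, by linarith⟩
  have hsub : dynTime (t₀ - h) (t₀ + h) ⊆ dynTime (t₀ - h₀) (t₀ + h₀) :=
    prod_mono (Ioo_subset_Ioo (by linarith) (by linarith)) subset_rfl
  have hSm : MeasurableSet (dynTime (t₀ - h) (t₀ + h) ∩ {p | p.1 ≠ t₀}) :=
    (measurableSet_dynTime _ _).inter ((measurableSet_singleton t₀).compl.preimage measurable_fst)
  refine ⟨h, hpos, (Icc_subset_Icc (by linarith) (by linarith)).trans hI₀, K, G, Iκ, Wm, ε, ν₀, C₀,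
    θ₀, hKD, hK, hG0, hG, hε, i₀, j₀, c₀, hd₀.mono (by linarith) (by linarith), ?_⟩
  intro ν C ρ θu θ iν jν cC htC hρ hθu hl hθ hle
  have cC' : Countable C := cC
  have hab : t₀ - h ≤ t₀ + h := by linarith
  -- The masses of θu and θ₀ agree on every measurable set, so the smallness arranged once for θ₀
  -- holds for every admissible base measure.
  have hNu : ∫ p in dynTime (t₀ - h) (t₀ + h), ‖θu p‖ ∂(baseMeasure ν C) ≤ N := by
    rw [integral_norm_eq_lintegral_enorm hθu.integrableOn.aestronglyMeasurable,
      hl _ (measurableSet_dynTime _ _)]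
    simp only [N]
    rw [integral_norm_eq_lintegral_enorm hd₀.integrableOn.aestronglyMeasurable]
    exact ENNReal.toReal_mono hd₀.integrableOn.2.ne (lintegral_mono_set hsub)
  have hεu : ∫ p in dynTime (t₀ - h) (t₀ + h) ∩ {p | p.1 ≠ t₀}, ‖θu p‖ ∂(baseMeasure ν C) ≤ ε := by
    rw [integral_norm_eq_lintegral_enorm
      (hθu.integrableOn.mono_set inter_subset_left).aestronglyMeasurable, hl _ hSm]
    refine ENNReal.toReal_le_of_le_ofReal hε.le (le_trans ?_ h4)
    rw [HasDensity.mass_apply (measurableSet_Ioo.diff (measurableSet_singleton _))]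
    exact lintegral_mono_set fun p hp => ⟨⟨hp.1.1, hp.2⟩, hsub hp.1⟩
  have hoff := setIntegral_lipField_le (Kf := Kf) (Kg := Kg) hρ hab hθ hθu.integrableOn
    (inter_subset_left (t := {p | p.1 ≠ t₀})) hle hεu
  have hoff' : ∫ p in dynTime (t₀ - h) (t₀ + h) ∩ {p | p.1 ≠ t₀}, lipField n Kf Kg ρ θ p
            ∂(baseMeasure ν C) ≤ 1 / 4 := by
    refine hoff.trans ?_
    have r1 : t₀ + h - (t₀ - h) = 2 * h := by ring
    rw [r1]
    linarith
  have hIκ : ∫ p in dynTime (t₀ - h) (t₀ + h), lipField n Kf Kg ρ θ p ∂(baseMeasure ν C) ≤ Iκ := by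
    refine (setIntegral_lipField_le (Kf := Kf) (Kg := Kg) hρ hab hθ hθu.integrableOn subset_rfl hle
      hNu).trans ?_
    have r1 : t₀ + h - (t₀ - h) = 2 * h := by ring
    rw [r1]
    simp only [Iκ]
    gcongr
  have hW := weight_lipField_le hρ ht htC hθ hIκ
  refine ⟨hoff', hIκ, hW, exists_solution hF hρ ht htC hθu hθ hγ hKD hK hδ.le
    (fun t ht s hs ξ hξ => htube t s ξ ?_ hs hξ) hG0 hG hm hfm hle hεu hoff' hW ?_⟩
  · rw [abs_le]
    constructor <;> linarith [ht.1, ht.2]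
  · have : 2 * ((∫ t in Ioo (t₀ - h) (t₀ + h), ‖m t‖) + n * G * (ε + ε)) * Wm =
        2 * (∫ t in Ioo (t₀ - h) (t₀ + h), ‖m t‖) * Wm + ε * (2 * (n * G * 2) * Wm) := by ring
    rw [this]
    linarith

theorem integral_norm_le_of_lintegral_le {E X : Type*} [NormedAddCommGroup E] [MeasurableSpace X]
    {μ : Measure X} {θ : X → E} (hθ : AEStronglyMeasurable θ μ) {M : ℝ≥0∞} {c : ℝ} (hc : 0 ≤ c)
    (h : ∫⁻ p, ‖θ p‖ₑ ∂μ ≤ n * M) (hM : M ≤ ENNReal.ofReal c) : ∫ p, ‖θ p‖ ∂μ ≤ n * c := by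
  rw [integral_norm_eq_lintegral_enorm hθ]
  refine ENNReal.toReal_le_of_le_ofReal (by positivity) (h.trans ?_)
  rw [ENNReal.ofReal_mul (Nat.cast_nonneg n), ENNReal.ofReal_natCast]
  gcongr

end

end DynSys

end

/-! ### The theorem -/

theorem theorem4 {n : ℕ} (I : Set ℝ) (hI : IsOpen I) (hI' : I.OrdConnected)
    (D : Set (ℝ × (Fin n → ℝ))) (hD : IsOpen D) (hDI : ∀ p ∈ D, p.1 ∈ I)
    (t₀ : ℝ) (x₀ : Fin n → ℝ) (h₀ : (t₀, x₀) ∈ D)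
    (f : ℝ → (Fin n → ℝ) → (Fin n → ℝ)) (hf : DynSys.IsCaratheodory D f)
    (Kf : ℝ) (hfL : ∀ t x y, (t, x) ∈ D → (t, y) ∈ D → ‖f t x - f t y‖ ≤ Kf * ‖x - y‖)
    (g : ℝ → (Fin n → ℝ) → ℝ → (Fin n → Fin n → ℝ)) (hg : DynSys.IsSGInTime D g)
    (Kg : ℝ) (hgL : ∀ t x y, (t, x) ∈ D → (t, y) ∈ D → ∀ s ∈ DynSys.J,
      ‖g t x s - g t y s‖ ≤ Kg * ‖x - y‖)
    (u : DynSys.DynFun (Fin n → ℝ)) (hu : DynSys.MemSBVLoc I u)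
    (hγ : ∃ γ, DynSys.IsLimitSolution D g u t₀ x₀ γ) :
    ∃ h > 0, Icc (t₀ - h) (t₀ + h) ⊆ I ∧
      -- existence and uniqueness
      (∃ x, DynSys.MemSBV (t₀ - h) (t₀ + h) x ∧
        DynSys.IsSolution D f g u t₀ x₀ (Ioo (t₀ - h) (t₀ + h)) x ∧
        ∀ (Ω : Set ℝ) (y : DynSys.DynFun (Fin n → ℝ)),
          IsOpen Ω → Ω.OrdConnected → Ω ⊆ I → t₀ ∈ Ω →
          DynSys.IsSolution D f g u t₀ x₀ Ω y →
          ∀ t ∈ Ω ∩ Ioo (t₀ - h) (t₀ + h), ∀ s ∈ DynSys.J, y t s = x t s) ∧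
      -- for all `v` near `u` there is a solution, and it depends continuously on `v`
      ∃ r > (0 : ℝ),
        (∀ v, DynSys.MemSBV (t₀ - h) (t₀ + h) v →
          DynSys.sbvNorm (t₀ - h) (t₀ + h) (v - u) < ENNReal.ofReal r →
          ∃ y, DynSys.MemSBV (t₀ - h) (t₀ + h) y ∧
            DynSys.IsSolution D f g v t₀ x₀ (Ioo (t₀ - h) (t₀ + h)) y) ∧
        ∀ v, DynSys.MemSBV (t₀ - h) (t₀ + h) v →
          DynSys.sbvNorm (t₀ - h) (t₀ + h) (v - u) < ENNReal.ofReal r →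
          ∀ ε > (0 : ℝ), ∃ δ > (0 : ℝ), ∀ v', DynSys.MemSBV (t₀ - h) (t₀ + h) v' →
            DynSys.sbvNorm (t₀ - h) (t₀ + h) (v' - u) < ENNReal.ofReal r →
            DynSys.sbvNorm (t₀ - h) (t₀ + h) (v' - v) < ENNReal.ofReal δ →
            ∀ y y', DynSys.MemSBV (t₀ - h) (t₀ + h) y →
              DynSys.IsSolution D f g v t₀ x₀ (Ioo (t₀ - h) (t₀ + h)) y →
              DynSys.MemSBV (t₀ - h) (t₀ + h) y' →
              DynSys.IsSolution D f g v' t₀ x₀ (Ioo (t₀ - h) (t₀ + h)) y' →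
              DynSys.sbvNorm (t₀ - h) (t₀ + h) (y' - y) < ENNReal.ofReal ε := by
  obtain ⟨γ, hγ⟩ := hγ
  have hF : DynSys.IsLipschitzField D f g Kf Kg := ⟨hD, hf, hg, hfL, hgL⟩
  obtain ⟨h, hh, hhI, K, G, Iκ, Wm, ε, ν₀, C₀, θ₀, hKD, hK, hG0, hG, hε, i₀, j₀, c₀, hd₀, hcore⟩ :=
    DynSys.exists_local_frame hI (hDI _ h₀) hF hu hγ
  set a := t₀ - h
  set b := t₀ + h
  have ht : t₀ ∈ Ioo a b := ⟨by simp only [a]; linarith, by simp only [b]; linarith⟩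
  have hab : a < b := ht.1.trans ht.2
  have hub : DynSys.MemSBV a b u := hu a b hab hhI
  have hxG {x : DynSys.DynFun (Fin n → ℝ)} (hxK : ∀ p ∈ DynSys.dynTime a b, (p.1, x p.1 p.2) ∈ K) :
      ∀ p ∈ DynSys.dynTime a b, ‖g p.1 (x p.1 p.2) p.2‖ ≤ G := fun p hp => hG _ (hxK p hp) p.2 hp.2
  -- A control at distance r has a density at L¹ distance at most n r ≤ ε/2. The other half of ε is
  -- kept for a second control near the first.
  obtain ⟨r, hr, hr'⟩ := DynSys.exists_pos_mul_le (c := (n : ℝ)) (d := ε / 2) (Nat.cast_nonneg n) (by positivity)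
  refine ⟨h, hh, hhI, ?_, r, hr, ?_, ?_⟩
  -- Only the density of u is needed here, so u also fills the two free places.
  · obtain ⟨ν, C, ρ, θu, _, _, iν, jν, cC, htC, hρ, hθu, hl, -⟩ :=
      DynSys.exists_common_density c₀ hd₀ hub hub hab t₀
    have cC' : Countable C := cC
    obtain ⟨hoff, hIκ, hW, x, hx, hx₀, hxK⟩ := hcore ν C ρ θu θu iν jν cC htC hρ hθu hl
      hθu.integrableOn (by simpa using hε.le)
    refine ⟨x, hx.memSBV hab, DynSys.isSolution_of_hasDensity hab hD hf hg hgL hρ.measurable hρ.eq hθu hx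
      hKD hK (fun t ht s hs => hxK (t, s) ⟨ht, hs⟩) ht hx₀, ?_⟩
    intro Ω y hΩ hΩ' _ hΩ₀ hy t htΩ s hs
    -- Uniqueness: equal controls allow η = 0.
    have := hy.norm_sub_le hF hρ hθu.integrableOn hθu htC ht hoff hG0 hW (η := 0) (by simp) hx hx₀
      (fun p hp => hKD (hxK p hp)) (hxG hxK) hΩ hΩ' hΩ₀ (p := (t, s)) ⟨htΩ.2, hs⟩ htΩ.1
    rw [mul_zero, zero_mul] at this
    exact sub_eq_zero.1 (norm_le_zero_iff.1 this)
  · intro v hv hvu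
    -- The density of v is composed as that of u plus that of v - u, so that its distance from θu is
    -- governed by the norm of v - u.
    obtain ⟨ν, C, ρ, θu, θw, _, iν, jν, cC, htC, hρ, hθu, hl, hθw, hle, -⟩ :=
      DynSys.exists_common_density c₀ hd₀ (hv.sub hub hab) hub hab t₀
    have cC' : Countable C := cC
    have hθv := hθu.add hθw
    rw [add_sub_cancel] at hθv
    have h1 := DynSys.integral_norm_le_of_lintegral_le hθw.integrableOn.aestronglyMeasurable hr.le hle hvu.le
    obtain ⟨-, -, -, x, hx, hx₀, hxK⟩ := hcore ν C ρ θu _ iν jν cC htC hρ hθu hl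
      hθv.integrableOn (by simp only [add_sub_cancel_left]; linarith)
    exact ⟨x, hx.memSBV hab, DynSys.isSolution_of_hasDensity hab hD hf hg hgL hρ.measurable hρ.eq hθv hx
      hKD hK (fun t ht s hs => hxK (t, s) ⟨ht, hs⟩) ht hx₀⟩
  · intro v hv hvu e he
    -- The constant c is the absolute value of the bound of `IsSolution.sbvNorm_sub_le` for η = n G
    -- n, which is linear in η. A distance d of the controls gives η = n G n d.
    obtain ⟨d, hd, hd'⟩ := DynSys.exists_pos_mul_le (d := e / 2)
      (c := |4 * (n * G * n) * Wm + 2 * (2 * (n * G * n) * Wm * Iκ + n * G * n)|)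
      (abs_nonneg _) (by positivity)
    refine ⟨min r d, lt_min hr hd, ?_⟩
    intro v' hv' _ hvv y y' _ hy _ hy'
    -- Here v = u + (v - u) and v' = v + (v' - v). The common base measure depends on v', but G, Wm,
    -- Iκ and hence δ were fixed before it. With δ ≤ r, the density of v' too is within n r + n r ≤
    -- ε of θu.
    obtain ⟨ν, C, ρ, θu, θw, θw', iν, jν, cC, htC, hρ, hθu, hl, hθw, hle, hθw', hle'⟩ :=
      DynSys.exists_common_density c₀ hd₀ (hv.sub hub hab) (hv'.sub hv hab) hab t₀
    have cC' : Countable C := cC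
    have hθv := hθu.add hθw
    rw [add_sub_cancel] at hθv
    have hθv' := hθv.add hθw'
    rw [add_sub_cancel] at hθv'
    have h1 := DynSys.integral_norm_le_of_lintegral_le hθw.integrableOn.aestronglyMeasurable hr.le hle hvu.le
    have h2 := DynSys.integral_norm_le_of_lintegral_le hθw'.integrableOn.aestronglyMeasurable
      (lt_min hr hd).le hle' hvv.le
    have h3 : n * min r d ≤ n * r := mul_le_mul_of_nonneg_left (min_le_left _ _) (Nat.cast_nonneg n)
    obtain ⟨hoff, -, hW, x, hx, hx₀, hxK⟩ := hcore ν C ρ θu _ iν jν cC htC hρ hθu hl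
      hθv.integrableOn (by simp only [add_sub_cancel_left]; linarith)
    have h4 : ∫ p in DynSys.dynTime a b, ‖θu p + θw p + θw' p - θu p‖ ∂(DynSys.baseMeasure ν C) ≤ ε := by
      have h5 : ∫ p in DynSys.dynTime a b, ‖θu p + θw p + θw' p - θu p‖ ∂(DynSys.baseMeasure ν C) ≤
          ∫ p in DynSys.dynTime a b, (‖θw p‖ + ‖θw' p‖) ∂(DynSys.baseMeasure ν C) :=
        integral_mono (hθv'.integrableOn.sub hθu.integrableOn).norm
          (hθw.integrableOn.norm.add hθw'.integrableOn.norm) fun p => by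
            simp only [add_assoc, add_sub_cancel_left]
            exact norm_add_le _ _
      rw [integral_add hθw.integrableOn.norm hθw'.integrableOn.norm] at h5
      linarith
    obtain ⟨hoff', hIκ', hW', -⟩ := hcore ν C ρ θu _ iν jν cC htC hρ hθu hl hθv'.integrableOn h4
    have hη : n * G * ∫ p in DynSys.dynTime a b, ‖θu p + θw p + θw' p - (θu p + θw p)‖ ∂(DynSys.baseMeasure ν C) ≤
        n * G * n * d := by
      simp only [add_sub_cancel_left]
      rw [mul_assoc _ _ d]
      refine mul_le_mul_of_nonneg_left (h2.trans ?_) (by positivity)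
      exact mul_le_mul_of_nonneg_left (min_le_right _ _) (Nat.cast_nonneg n)
    refine (DynSys.IsSolution.sbvNorm_sub_le hF hρ hθv hθv' htC ht hoff hoff' hG0 hW hW' hIκ' hη hx hx₀
      (fun p hp => hKD (hxK p hp)) (hxG hxK) hy hy').trans_lt ?_
    rw [ENNReal.ofReal_lt_ofReal_iff he]
    have h6 := mul_le_mul_of_nonneg_left
      (le_abs_self (4 * (n * G * n) * Wm + 2 * (2 * (n * G * n) * Wm * Iκ + n * G * n))) hd.le
    calc _ = d * (4 * (n * G * n) * Wm + 2 * (2 * (n * G * n) * Wm * Iκ + n * G * n)) := by ring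
      _ ≤ e / 2 := h6.trans hd'
      _ < e := by linarith
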